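/- **Proposition 3.4 (reduction of the oscillation at the initial boundary).** Let $n\ge 2$ be an integer, $p\ge 2$, $\Lambda\ge 1$, $\delta\in(0,1)$ and $q>\bar q$, where $\bar q:=1+n/p$ if $p<n$ and $\bar q:=2$ if $p\ge n$. Then there is a constant $\varepsilon_4\in(0,1)$ depending only on $n,p,\Lambda,\delta,q$ such that the following holds. Let $\Omega\subset\mathbb R^n$ be a bounded domain for which there is $r_\Omega>0$ with $|B_\rho(x)\cap\Omega|\le(1-\delta)|B_\rho(x)|$ for all $x\in\partial\Omega$ and $\rho\in(0,r_\Omega)$. Let $T>0$, $\Omega_T=\Omega\times(0,T]$ and $\partial_p\Omega_T=(\overline\Omega\times\{0\})\cup(\partial\Omega\times(0,T])$. Let $\mathcal A(x,t,u,\xi)\in\mathbb R^n$ be measurable in $(x,t)\in\Omega_T$, continuous in $(u,\xi)\in\mathbb R\times\mathbb R^n$, and such that, for a.e. $(x,t)\in\Omega_T$ and all $(u,\xi)$, $$|\mathcal A(x,t,u,\xi)|\le\Lambda|\xi|^{p-1},\qquad \langle\mathcal A(x,t,u,\xi),\xi\rangle\ge\Lambda^{-1}|\xi|^p .$$ Let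 $b\in\mathbb R$, $\varepsilon>0$ and $H_{b,\varepsilon}=\rho_\varepsilon*\chi_{(b,\infty)}$, where $\rho_\varepsilon(s)=\varepsilon^{-1}\rho(s/\varepsilon)$ and $\rho\in C_c^\infty(-1,1)$ is nonnegative, even and has integral one. Let $g$ be uniformly continuous on $\partial_p\Omega_T$. For $x_0\in\overline\Omega$, $r>0$ and $\omega>0$ put $$T^4=\min\{\omega^{2-p}r^p,\,T\},\qquad \sigma Q=(B_{\sigma r}(x_0)\cap\Omega)\times(0,T^4)\quad(0<\sigma\le 1),\qquad Q=1Q.$$ Let $v\in C(\overline Q)$ be a local weak solution of $$\partial_t v-\operatorname{div}\mathcal A(x,t,v,Dv)=-\partial_t H_{b,\varepsilon}(v)\quad\text{in }Q,\qquad v=g\quad\text{on }\overline Q\cap\partial_p\Omega_T ;$$ that is, writing $D=B_r(x_0)\cap\Omega$, $v\in L^p_{\rm loc}(0,T^4;W^{1,p}_{\rm loc}(D))\cap L^\infty_{\rm loc}(0,T^4;L^2_{\rm loc}(D))$ and $$\int_Q\big[-(v+H_{b,\varepsilon}(v))\,\partial_t\varphi+\langle\mathcal A(x,t,v,Dv),D\varphi\rangle\big]\,dx\,dt=0\qquad\text{for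 all }\varphi\in C_c^\infty(Q).$$ Suppose that $$\sup_{B_r(x_0)\cap\Omega}v(\cdot,0)\le\sup_Q v-\frac\omega8,$$ and, in case $B_r(x_0)$ meets $\partial\Omega$, that also $g\le\sup_Q v-\frac\omega8$ on $(B_r(x_0)\cap\partial\Omega)\times(0,T^4)$. Then $$\sup_{\frac14Q}v\le\sup_Q v-\varepsilon_4\,\omega .$$ -/

import Mathlib

open Set MeasureTheory

noncomputable section

namespace StefanInitial

/-- Euclidean space `ℝⁿ`; a space-time point is `z = (x, t) : E n × ℝ`. -/
abbrev E (n : ℕ) := EuclideanSpace ℝ (Fin n)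

/-! ### Geometry -/

/-- A bounded domain: a nonempty bounded connected open set. -/
structure IsBoundedDomain {n : ℕ} (Ω : Set (E n)) : Prop where
  isOpen : IsOpen Ω
  isConnected : IsConnected Ω
  isBounded : Bornology.IsBounded Ω

/-- Outer density: `|B_ρ(x) ∩ Ω| ≤ (1 - δ) |B_ρ(x)|` for all `x ∈ ∂Ω` and `ρ ∈ (0, rΩ)`. -/
def OuterDensity {n : ℕ} (Ω : Set (E n)) (δ rΩ : ℝ) : Prop :=
  ∀ x ∈ frontier Ω, ∀ ρ ∈ Ioo (0 : ℝ) rΩ,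
    volume (Metric.ball x ρ ∩ Ω) ≤ ENNReal.ofReal (1 - δ) * volume (Metric.ball x ρ)

/-- The space-time cylinder `Ω_T = Ω × (0, T]`. -/
def spaceTime {n : ℕ} (Ω : Set (E n)) (T : ℝ) : Set (E n × ℝ) := Ω ×ˢ Ioc 0 T

/-- The parabolic boundary `(closure Ω × {0}) ∪ (∂Ω × (0, T])` of `Ω_T`. -/
def parabolicBoundary {n : ℕ} (Ω : Set (E n)) (T : ℝ) : Set (E n × ℝ) :=
  (closure Ω ×ˢ {0}) ∪ (frontier Ω ×ˢ Ioc 0 T)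

/-- The intrinsic time length `min {ω^(2-p) r^p, T}`. -/
def iniTime (p T r ω : ℝ) : ℝ := min (ω ^ (2 - p) * r ^ p) T

/-- The cylinder `σQ = (B_{σ r}(x₀) ∩ Ω) × (0, min {ω^(2-p) r^p, T})`; `Q` itself is `σ = 1`. -/
def iniCyl {n : ℕ} (Ω : Set (E n)) (p T : ℝ) (x₀ : E n) (r ω σ : ℝ) : Set (E n × ℝ) :=
  (Metric.ball x₀ (σ * r) ∩ Ω) ×ˢ Ioo 0 (iniTime p T r ω)

/-- The threshold exponent: `1 + n/p` if `p < n`, and `2` if `p ≥ n`. -/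
def qBar (n : ℕ) (p : ℝ) : ℝ := if p < n then 1 + n / p else 2

/-! ### The vector field and the regularized jump -/

/-- The structure conditions on a vector field `A (x, t) u ξ`: Carathéodory regularity,
`p`-growth and `p`-coercivity with constant `Λ`, in the space-time set `U`. -/
structure IsPField {n : ℕ} (p Λ : ℝ) (U : Set (E n × ℝ)) (A : E n × ℝ → ℝ → E n → E n) :
    Prop where
  measurable : ∀ (u : ℝ) (ξ : E n), AEStronglyMeasurable (fun z => A z u ξ) (volume.restrict U)
  continuous : ∀ᵐ z ∂(volume.restrict U), Continuous (fun w : ℝ × E n => A z w.1 w.2)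
  growth : ∀ᵐ z ∂(volume.restrict U), ∀ (u : ℝ) (ξ : E n), ‖A z u ξ‖ ≤ Λ * ‖ξ‖ ^ (p - 1)
  coercive : ∀ᵐ z ∂(volume.restrict U), ∀ (u : ℝ) (ξ : E n),
    Λ⁻¹ * ‖ξ‖ ^ p ≤ inner ℝ (A z u ξ) ξ

/-- A symmetric nonnegative mollifier `ρ ∈ C_c^∞(-1, 1)` with integral one. -/
structure IsMollifier (ρ : ℝ → ℝ) : Prop where
  smooth : ContDiff ℝ (⊤ : ℕ∞) ρ
  support : tsupport ρ ⊆ Ioo (-1) 1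
  nonneg : ∀ s, 0 ≤ ρ s
  symm : ∀ s, ρ (-s) = ρ s
  integral_eq_one : ∫ s, ρ s = 1

/-- The Heaviside function with jump at `b` (its value at the single point `b` is immaterial). -/
def heaviside (b s : ℝ) : ℝ := if b < s then 1 else 0

/-- `H_{b,ε} = ρ_ε * H_b`, where `ρ_ε(s) = ε⁻¹ ρ(s / ε)`. -/
def mollifiedHeaviside (ρ : ℝ → ℝ) (b ε s : ℝ) : ℝ :=
  ∫ σ, ε⁻¹ * ρ ((s - σ) / ε) * heaviside b σ

/-! ### Weak derivatives and weak solutions -/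

/-- Spatial gradient of a smooth space-time function. -/
def spaceGrad {n : ℕ} (φ : E n × ℝ → ℝ) (z : E n × ℝ) : E n :=
  gradient (fun y => φ (y, z.2)) z.1

/-- Time derivative of a smooth space-time function. -/
def timeDeriv {n : ℕ} (φ : E n × ℝ → ℝ) (z : E n × ℝ) : ℝ :=
  deriv (fun s => φ (z.1, s)) z.2

/-- The test functions `φ ∈ C_c^∞(U)`. -/
structure IsTest {n : ℕ} (U : Set (E n × ℝ)) (φ : E n × ℝ → ℝ) : Prop where
  smooth : ContDiff ℝ (⊤ : ℕ∞) φ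
  compact : HasCompactSupport φ
  support : tsupport φ ⊆ U

/-- `G` is the weak spatial gradient of `v` in the open set `U`, and `v` and `G` are in
`L^p_loc(U)`. For a cylinder `U = D × (0, τ)` this says that `v` belongs to
`L^p_loc(0, τ; W^{1,p}_loc(D))` with `Dv = G`. -/
structure IsWeakSpaceGrad {n : ℕ} (p : ℝ) (U : Set (E n × ℝ)) (v : E n × ℝ → ℝ)
    (G : E n × ℝ → E n) : Prop where
  memLp : ∀ K ⊆ U, IsCompact K → MemLp v (ENNReal.ofReal p) (volume.restrict K)
  memLp_grad : ∀ K ⊆ U, IsCompact K → MemLp G (ENNReal.ofReal p) (volume.restrict K)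
  byParts : ∀ φ, IsTest U φ →
    ∫ z in U, v z • spaceGrad φ z = -∫ z in U, φ z • G z

/-- `v ∈ L^∞_loc(0, τ; L²_loc(D))`. -/
def LocBddL2 {n : ℕ} (D : Set (E n)) (τ : ℝ) (v : E n × ℝ → ℝ) : Prop :=
  ∀ K ⊆ D, IsCompact K → ∀ t₁ t₂ : ℝ, 0 < t₁ → t₂ < τ → ∃ C : ℝ,
    ∀ᵐ t ∂(volume.restrict (Icc t₁ t₂)),
      ∫⁻ x in K, ENNReal.ofReal (v (x, t) ^ 2) ≤ ENNReal.ofReal C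

/-- `v` is a local weak solution of `∂ₜ v - div A(x, t, v, Dv) = -∂ₜ H(v)` in `D × (0, τ)`. -/
def IsWeakSolution {n : ℕ} (p : ℝ) (A : E n × ℝ → ℝ → E n → E n) (H : ℝ → ℝ)
    (D : Set (E n)) (τ : ℝ) (v : E n × ℝ → ℝ) : Prop :=
  LocBddL2 D τ v ∧
  ∃ G : E n × ℝ → E n, IsWeakSpaceGrad p (D ×ˢ Ioo 0 τ) v G ∧
    ∀ φ, IsTest (D ×ˢ Ioo 0 τ) φ →
      ∫ z in D ×ˢ Ioo 0 τ,
        (-(v z + H (v z)) * timeDeriv φ z + inner ℝ (A z (v z) (G z)) (spaceGrad φ z)) = 0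

end StefanInitial

end

noncomputable section

open Filter Topology Function
open scoped ENNReal NNReal

set_option linter.unusedSectionVars false

namespace StefanInitial

/-! ### Averages of translates: contraction, convergence and smoothing. -/

section

/-! ### Averages of translates -/

/-! Put `M = sup_Q v`, `k₀ = M - ω/8` and `β(s) = s + H(s)`, so that the equation reads `∂ₜ β(v) =
div A`. Above the level `k₀` the solution does not see the parabolic boundary: on the initial slice,
and on `∂Ω` inside the ball, `v ≤ k₀`. By continuity a set `{v ≥ k₁}` with `k₁ > k₀`, taken over a
compact part of the ball and up to a time before the end, is compact in the open cylinder
(`exists_compact_superlevel`). Hence a truncation `F(v)` that vanishes below a level `k > k₀` needs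
no cutoff at `t = 0` or at `∂Ω`. A spatial cutoff `ζ` inside the ball and a decreasing cutoff `χ`
near the final time suffice.

Testing with `F(v) ζ^m χ` produces the energy `∫ F dβ` in the time term. Since `β - id` is
increasing, this energy is at least `∫ F ds`: the jump only adds to the good side and is dropped. So
`SolutionData.caccioppoli` has constants that depend neither on `b` nor on `ε`. All it asks of a
truncation is `F ^ p ≤ N * f ^ (p - 1)` with `f = F'`, which is what absorbs the cross term.

Two truncations give the theorem. With `u = M + d - v`, the logarithmic truncation `u (u⁻¹ - c⁻¹)²`
has a factor `N` independent of `d`, while its energy at `u = 2d` grows like `log (c/d)`. Therefore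
`{v > M - ω/2^(s+4)}` occupies a fraction `O(1/s)` of the cylinder
(`SolutionData.exists_logarithmic_const`). The truncation `(v - k)₊²` feeds a De Giorgi iteration:
if `{v > M - θ}` is a small enough fraction, then `v ≤ M - θ/2` on a smaller ball
(`SolutionData.exists_deGiorgi_const`). Since `θ ≤ ω` and `p ≥ 2`, the cylinder scaled for `ω` is no
longer in time than the one scaled for `θ`. Hence the required fraction does not depend on `θ`, and
`s` can be fixed in advance. `SolutionData.exists_reduction` combines the two.

The remaining work is to justify the test function, since `v` has no time derivative. `F(v) ζ^m χ`
is a limit of compactly supported `C¹` functions (`exists_hasC1Approx`). Their Steklov averages turn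
the weak form into backward difference quotients of `β(v)` (`tendsto_integral_diffQuot`). The
convexity inequality `mul_sub_le_jumpPrimitive_sub` compares these with difference quotients of the
energy, whose limit exists because `χ` is smooth (`integral_flux_le`). -/

/-- The average of the translates of `f` with respect to `μ`. -/
def avg {V F : Type*} [MeasurableSpace V] [Sub V] [NormedAddCommGroup F] [NormedSpace ℝ F]
    (μ : Measure V) (f : V → F) (z : V) : F := ∫ y, f (z - y) ∂μ

section Average

variable {V F : Type*} [NormedAddCommGroup V] [NormedSpace ℝ V] [FiniteDimensional ℝ V]
  [MeasureSpace V] [BorelSpace V] [(volume : Measure V).IsAddHaarMeasure]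
  [NormedAddCommGroup F] [NormedSpace ℝ F] [CompleteSpace F]

lemma stronglyMeasurable_avg {μ : Measure V} [SFinite μ] {f : V → F} (hf : StronglyMeasurable f) :
    StronglyMeasurable (avg μ f) := by
  have : StronglyMeasurable (fun q : V × V => f (q.1 - q.2)) :=
    hf.comp_measurable (measurable_fst.sub measurable_snd)
  exact this.integral_prod_right

lemma lintegral_lintegral_translate (μ : Measure V) [IsProbabilityMeasure μ] {f : V → ℝ≥0∞}
    (hf : Measurable f) : ∫⁻ z, ∫⁻ y, f (z - y) ∂μ = ∫⁻ z, f z := by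
  rw [lintegral_lintegral_swap (by
    exact (hf.comp (measurable_fst.sub measurable_snd)).aemeasurable)]
  simp_rw [lintegral_sub_right_eq_self]
  simp

/-- Jensen's inequality: on a probability space the `L¹` norm is at most the `L^p` norm. -/
lemma enorm_avg_rpow_le (μ : Measure V) [IsProbabilityMeasure μ] {f : V → F}
    (hf : StronglyMeasurable f) {p : ℝ} (hp : 1 ≤ p) (z : V) :
    ‖avg μ f z‖ₑ ^ p ≤ ∫⁻ y, ‖f (z - y)‖ₑ ^ p ∂μ := by
  have hm : StronglyMeasurable (fun y => f (z - y)) :=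
    hf.comp_measurable (measurable_const.sub measurable_id)
  have h0 : 0 < p := by linarith
  have h1 : ‖avg μ f z‖ₑ ≤ eLpNorm (fun y => f (z - y)) (ENNReal.ofReal p) μ := by
    refine (enorm_integral_le_lintegral_enorm _).trans ?_
    rw [← eLpNorm_one_eq_lintegral_enorm]
    exact eLpNorm_le_eLpNorm_of_exponent_le (by simpa using hp) hm.aestronglyMeasurable
  rw [eLpNorm_eq_lintegral_rpow_enorm_toReal (by simpa using h0) (by simp),
    ENNReal.toReal_ofReal h0.le] at h1
  calc _ ≤ _ := ENNReal.rpow_le_rpow h1 h0.le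
    _ = _ := by rw [← ENNReal.rpow_mul]; simp [h0.ne']

/-- Jensen's inequality is integrated in `z`; Tonelli and translation invariance then remove the
average. The measure `μ` may be singular, so smooth kernels and time segments are treated alike. -/
lemma eLpNorm_avg_le (μ : Measure V) [IsProbabilityMeasure μ] {f : V → F}
    (hf : StronglyMeasurable f) {p : ℝ} (hp : 1 ≤ p) :
    eLpNorm (avg μ f) (ENNReal.ofReal p) volume ≤ eLpNorm f (ENNReal.ofReal p) volume := by
  have h0 : 0 < p := by linarith
  rw [eLpNorm_eq_lintegral_rpow_enorm_toReal (by simpa using h0) (by simp),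
    eLpNorm_eq_lintegral_rpow_enorm_toReal (by simpa using h0) (by simp),
    ENNReal.toReal_ofReal h0.le]
  refine ENNReal.rpow_le_rpow ?_ (by positivity)
  rw [← lintegral_lintegral_translate μ (f := fun z => ‖f z‖ₑ ^ p) (by fun_prop)]
  exact lintegral_mono fun z => enorm_avg_rpow_le μ hf hp z

/-- Tonelli makes the inner integral of `‖f(z - y)‖ ^ p` finite for almost every `z`. This is what
makes averaging additive almost everywhere, as a Bochner integral is zero by default where
integrability fails. -/
lemma ae_integrable_translate (μ : Measure V) [IsProbabilityMeasure μ] {f : V → F}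
    (hf : StronglyMeasurable f) {p : ℝ} (hp : 1 ≤ p)
    (h : MemLp f (ENNReal.ofReal p) volume) :
    ∀ᵐ z, Integrable (fun y => f (z - y)) μ := by
  have h0 : 0 < p := by linarith
  have h1 : ∫⁻ z, ‖f z‖ₑ ^ p < ∞ := by
    have := lintegral_rpow_enorm_lt_top_of_eLpNorm_lt_top (by simpa using h0) (by simp) h.2
    rwa [ENNReal.toReal_ofReal h0.le] at this
  rw [← lintegral_lintegral_translate μ (f := fun z => ‖f z‖ₑ ^ p) (by fun_prop)] at h1
  have hm : Measurable (fun z => ∫⁻ y, ‖f (z - y)‖ₑ ^ p ∂μ) := by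
    have : Measurable (fun q : V × V => ‖f (q.1 - q.2)‖ₑ ^ p) :=
      (hf.comp_measurable (measurable_fst.sub measurable_snd)).enorm.pow_const p
    exact this.lintegral_prod_right'
  filter_upwards [ae_lt_top hm h1.ne] with z hz
  have hs : StronglyMeasurable (fun y => f (z - y)) :=
    hf.comp_measurable (measurable_const.sub measurable_id)
  have : MemLp (fun y => f (z - y)) (ENNReal.ofReal p) μ := by
    refine ⟨hs.aestronglyMeasurable, ?_⟩
    rw [eLpNorm_lt_top_iff_lintegral_rpow_enorm_lt_top (by simpa using h0) (by simp),
      ENNReal.toReal_ofReal h0.le]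
    exact hz
  exact this.integrable (by simpa using hp)

lemma norm_avg_sub_le_of_uniform (μ : Measure V) [IsProbabilityMeasure μ] {g : V → F}
    {δ c : ℝ} (hμ : μ (Metric.ball 0 δ)ᶜ = 0) {z : V} (hgi : Integrable (fun y => g (z - y)) μ)
    (hg : ∀ y, ‖y‖ < δ → ‖g (z - y) - g z‖ ≤ c) :
    ‖avg μ g z - g z‖ ≤ c := by
  have : avg μ g z - g z = ∫ y, (g (z - y) - g z) ∂μ := by
    rw [integral_sub hgi (integrable_const _)]; simp [avg]
  rw [this]
  refine (norm_integral_le_of_norm_le_const (C := c) ?_).trans (by simp)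
  have : ∀ᵐ y ∂μ, y ∈ Metric.ball (0 : V) δ := by
    rw [ae_iff]; exact hμ
  filter_upwards [this] with y hy
  exact hg y (by simpa using hy)

lemma avg_eq_zero_of_support {μ : Measure V} {g : V → F}
    {δ : ℝ} (hμ : μ (Metric.ball 0 δ)ᶜ = 0) {K : Set V} (hK : support g ⊆ K) {z : V}
    (hz : z ∉ Metric.thickening δ K) : avg μ g z = 0 := by
  refine integral_eq_zero_of_ae ?_
  have : ∀ᵐ y ∂μ, y ∈ Metric.ball (0 : V) δ := by
    rw [ae_iff]; exact hμ
  filter_upwards [this] with y hy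
  by_contra h
  refine hz (Metric.mem_thickening_iff.2 ⟨z - y, hK h, ?_⟩)
  simpa [dist_eq_norm] using hy

/-- Averages against measures that concentrate at the origin converge in `L^p`. -/
lemma tendsto_eLpNorm_avg_sub {ι : Type*} {l : Filter ι} {μ : ι → Measure V}
    [∀ i, IsProbabilityMeasure (μ i)]
    (hμ : ∀ δ > 0, ∀ᶠ i in l, μ i (Metric.ball 0 δ)ᶜ = 0) {f : V → F}
    (hf : StronglyMeasurable f) {p : ℝ} (hp : 1 ≤ p) (h : MemLp f (ENNReal.ofReal p) volume) :
    Tendsto (fun i => eLpNorm (avg (μ i) f - f) (ENNReal.ofReal p) volume) l (𝓝 0) := by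
  have hp1 : 1 ≤ ENNReal.ofReal p := by simpa using hp
  rw [ENNReal.tendsto_nhds_zero]
  intro ε hε
  by_cases hεt : ε = ∞
  · simp [hεt]
  have hε3 : ε / 3 ≠ 0 := by simp [hε.ne']
  -- Density argument: averaging contracts `L^p`, so replacing `f` by `g` costs two thirds of `ε`.
  -- The averages of `g` converge uniformly, with supports in one fixed compact set.
  obtain ⟨g, hgc, hgf, hgcont, hgp⟩ :=
    h.exists_hasCompactSupport_eLpNorm_sub_le ENNReal.ofReal_ne_top hε3
  have hgm : StronglyMeasurable g := hgcont.stronglyMeasurable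
  obtain ⟨C, hC⟩ := hgcont.bounded_above_of_compact_support hgc
  set K' := Metric.cthickening 1 (tsupport g) with hK'
  have hK'c : IsCompact K' := hgc.isCompact.cthickening
  set V0 := (volume K') ^ (1 / p) with hV0
  have hV0t : V0 ≠ ∞ := (ENNReal.rpow_lt_top_of_nonneg (by positivity) hK'c.measure_ne_top).ne
  obtain ⟨c, hc0, hcV⟩ : ∃ c : ℝ, 0 < c ∧ ENNReal.ofReal c * V0 ≤ ε / 3 := by
    have h3 : Tendsto (fun c : ℝ => ENNReal.ofReal c * V0) (𝓝[>] 0) (𝓝 (ENNReal.ofReal 0 * V0)) :=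
      (ENNReal.Tendsto.mul_const (ENNReal.continuous_ofReal.tendsto 0) (Or.inr hV0t)).mono_left
        nhdsWithin_le_nhds
    rw [ENNReal.ofReal_zero, zero_mul, ENNReal.tendsto_nhds_zero] at h3
    obtain ⟨c, hc⟩ := ((h3 (ε / 3) (pos_iff_ne_zero.2 hε3)).and self_mem_nhdsWithin).exists
    exact ⟨c, hc.2, hc.1⟩
  have huc := hgcont.uniformContinuous_of_tendsto_cocompact hgc.is_zero_at_infty
  obtain ⟨δ, hδ, hδc⟩ := Metric.uniformContinuous_iff.1 huc c hc0
  filter_upwards [hμ (min δ 1) (lt_min hδ one_pos)] with i hi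
  have hgi : ∀ z, Integrable (fun y => g (z - y)) (μ i) := fun z =>
    Integrable.of_bound (hgm.comp_measurable (measurable_const.sub measurable_id)).aestronglyMeasurable
      C (ae_of_all _ fun y => hC _)
  have key : eLpNorm (avg (μ i) g - g) (ENNReal.ofReal p) volume ≤ ε / 3 := by
    have hle : ∀ z, ‖(avg (μ i) g - g) z‖ ≤ ‖K'.indicator (fun _ => c) z‖ := by
      intro z
      by_cases hz : z ∈ K'
      · rw [indicator_of_mem hz, Real.norm_of_nonneg hc0.le]
        refine norm_avg_sub_le_of_uniform (μ i) hi (hgi z) fun y hy => ?_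
        rw [← dist_eq_norm]
        refine (hδc ?_).le
        simpa [dist_eq_norm] using hy.trans_le (min_le_left _ _)
      · have h1 : avg (μ i) g z = 0 := avg_eq_zero_of_support hi (subset_tsupport g) fun h' =>
          hz ((Metric.thickening_mono (min_le_right _ _) _).trans
            (Metric.thickening_subset_cthickening _ _) h')
        have h2 : g z = 0 := image_eq_zero_of_notMem_tsupport fun h' =>
          hz (Metric.self_subset_cthickening _ h')
        simp [h1, h2, hz]
    refine (eLpNorm_mono hle).trans ?_
    rw [eLpNorm_indicator_const hK'c.measurableSet (by simpa using by linarith) (by simp),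
      ENNReal.toReal_ofReal (by linarith), Real.enorm_of_nonneg hc0.le]
    exact hcV
  have hsplit : avg (μ i) f - f =ᵐ[volume] avg (μ i) (f - g) + (avg (μ i) g - g) + (g - f) := by
    filter_upwards [ae_integrable_translate (μ i) hf hp h] with z hz
    have : avg (μ i) (f - g) z = avg (μ i) f z - avg (μ i) g z := integral_sub hz (hgi z)
    simp only [Pi.sub_apply, Pi.add_apply, this]; abel
  rw [eLpNorm_congr_ae hsplit]
  have hm1 := (stronglyMeasurable_avg (μ := μ i) (hf.sub hgm)).aestronglyMeasurable (μ := volume)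
  have hm2 := ((stronglyMeasurable_avg (μ := μ i) hgm).sub hgm).aestronglyMeasurable (μ := volume)
  refine (eLpNorm_add_le (hm1.add hm2) (hgm.sub hf).aestronglyMeasurable hp1).trans ?_
  have e3 : ε = ε / 3 + ε / 3 + ε / 3 := (ENNReal.add_thirds ε).symm
  rw [e3]
  refine add_le_add ((eLpNorm_add_le hm1 hm2 hp1).trans (add_le_add ?_ key)) ?_
  · exact (eLpNorm_avg_le (μ i) (hf.sub hgm) hp).trans hgf
  · rw [eLpNorm_sub_comm]; exact hgf

/-- The derivative of an average of a `C¹` function with compact support. -/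
lemma hasFDerivAt_avg {μ : Measure V} [IsFiniteMeasure μ] {f : V → F} (hf : ContDiff ℝ 1 f)
    (hc : HasCompactSupport f) (z : V) :
    HasFDerivAt (avg μ f) (avg μ (fderiv ℝ f) z) z := by
  have hf' := hf.continuous_fderiv one_ne_zero
  obtain ⟨C, hC⟩ := hf'.bounded_above_of_compact_support (hc.fderiv ℝ)
  obtain ⟨C', hC'⟩ := hf.continuous.bounded_above_of_compact_support hc
  have hcs : ∀ x : V, Continuous (fun y => f (x - y)) := fun x =>
    hf.continuous.comp (continuous_const.sub continuous_id)
  have hcs' : ∀ x : V, Continuous (fun y => fderiv ℝ f (x - y)) := fun x =>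
    hf'.comp (continuous_const.sub continuous_id)
  refine hasFDerivAt_integral_of_dominated_of_fderiv_le (bound := fun _ => C) (s := univ)
    (F' := fun x y => fderiv ℝ f (x - y)) Filter.univ_mem
    ?_ ?_ ?_ ?_ (integrable_const _) ?_
  · exact Eventually.of_forall fun x => (hcs x).aestronglyMeasurable
  · exact Integrable.of_bound (hcs z).aestronglyMeasurable C' (ae_of_all _ fun y => hC' _)
  · exact (hcs' z).aestronglyMeasurable
  · exact ae_of_all _ fun y x _ => hC _
  · refine ae_of_all _ fun y x _ => ?_
    have := (hf.differentiable one_ne_zero (x - y)).hasFDerivAt.comp x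
      ((hasFDerivAt_id x).sub_const y)
    simpa [Function.comp_def] using this

lemma continuous_avg {μ : Measure V} [IsFiniteMeasure μ] {f : V → F} (hf : Continuous f)
    (hc : HasCompactSupport f) : Continuous (avg μ f) := by
  obtain ⟨C, hC⟩ := hf.bounded_above_of_compact_support hc
  refine continuous_of_dominated (bound := fun _ => C) (fun x => ?_) (fun x => ?_)
    (integrable_const _) ?_
  · exact (hf.comp (continuous_const.sub continuous_id)).aestronglyMeasurable
  · exact ae_of_all _ fun y => hC _
  · exact ae_of_all _ fun y => hf.comp (continuous_id.sub continuous_const)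

lemma contDiff_avg {μ : Measure V} [IsFiniteMeasure μ] {f : V → F} (hf : ContDiff ℝ 1 f)
    (hc : HasCompactSupport f) : ContDiff ℝ 1 (avg μ f) := by
  refine contDiff_one_iff_fderiv.2 ⟨fun z => (hasFDerivAt_avg hf hc z).differentiableAt, ?_⟩
  have : fderiv ℝ (avg μ f) = avg μ (fderiv ℝ f) := funext fun z => (hasFDerivAt_avg hf hc z).fderiv
  rw [this]
  exact continuous_avg (hf.continuous_fderiv one_ne_zero) (hc.fderiv ℝ)

lemma hasCompactSupport_avg {μ : Measure V} {f : V → F} {δ : ℝ}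
    (hμ : μ (Metric.ball 0 δ)ᶜ = 0) (hc : HasCompactSupport f) :
    HasCompactSupport (avg μ f) := by
  refine HasCompactSupport.intro (hc.isCompact.cthickening (r := δ)) fun z hz => ?_
  exact avg_eq_zero_of_support hμ (subset_tsupport f) fun h =>
    hz (Metric.thickening_subset_cthickening _ _ h)

/-! ### Smooth averaging kernels -/

/-- The smooth bump function at the origin with radii `1 / (2 (j + 1))` and `1 / (j + 1)`. -/
def kernelBump (V : Type*) [NormedAddCommGroup V] [NormedSpace ℝ V] (j : ℕ) :
    ContDiffBump (0 : V) :=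
  ⟨1 / (2 * (j + 1)), 1 / (j + 1), by positivity, by
    have : (0 : ℝ) ≤ j := j.cast_nonneg
    rw [div_lt_div_iff₀ (by positivity) (by positivity)]; linarith⟩

/-- The normalized kernel `κ_j`. -/
def kernelFun (V : Type*) [NormedAddCommGroup V] [NormedSpace ℝ V] [FiniteDimensional ℝ V]
    [MeasureSpace V] (j : ℕ) : V → ℝ := (kernelBump V j).normed volume

/-- The probability measure `κ_j dz`. -/
def kernelMeasure (V : Type*) [NormedAddCommGroup V] [NormedSpace ℝ V] [FiniteDimensional ℝ V]
    [MeasureSpace V] (j : ℕ) : Measure V :=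
  volume.withDensity fun z => ENNReal.ofReal (kernelFun V j z)

variable (V) in
lemma contDiff_kernelFun (j : ℕ) {m : ℕ∞} : ContDiff ℝ m (kernelFun V j) :=
  (kernelBump V j).contDiff_normed

variable (V) in
lemma hasCompactSupport_kernelFun (j : ℕ) : HasCompactSupport (kernelFun V j) :=
  (kernelBump V j).hasCompactSupport_normed

variable (V) in
lemma tsupport_kernelFun (j : ℕ) : tsupport (kernelFun V j) = Metric.closedBall 0 (1 / (j + 1)) :=
  (kernelBump V j).tsupport_normed_eq

lemma kernelFun_nonneg (j : ℕ) (z : V) : 0 ≤ kernelFun V j z := (kernelBump V j).nonneg_normed z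

lemma continuous_kernelFun (j : ℕ) : Continuous (kernelFun V j) :=
  (contDiff_kernelFun V j (m := 0)).continuous

instance (j : ℕ) : IsProbabilityMeasure (kernelMeasure V j) := by
  refine isProbabilityMeasure_iff.2 ?_
  rw [kernelMeasure, withDensity_apply _ MeasurableSet.univ, Measure.restrict_univ,
    ← ofReal_integral_eq_lintegral_ofReal]
  · rw [show ∫ z, kernelFun V j z = 1 from (kernelBump V j).integral_normed, ENNReal.ofReal_one]
  · exact (continuous_kernelFun j).integrable_of_hasCompactSupport (hasCompactSupport_kernelFun V j)
  · exact ae_of_all _ (kernelFun_nonneg j)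

lemma kernelMeasure_compl_ball {j : ℕ} {δ : ℝ} (h : 1 / ((j : ℝ) + 1) < δ) :
    kernelMeasure V j (Metric.ball 0 δ)ᶜ = 0 := by
  rw [kernelMeasure, withDensity_apply _ Metric.isOpen_ball.measurableSet.compl]
  refine setLIntegral_eq_zero Metric.isOpen_ball.measurableSet.compl fun z hz => ?_
  have : z ∉ tsupport (kernelFun V j) := by
    rw [tsupport_kernelFun]
    exact fun h' => hz (Metric.closedBall_subset_ball h h')
  simp [image_eq_zero_of_notMem_tsupport this]

variable (V) in
lemma eventually_kernelMeasure_compl_ball (δ : ℝ) (hδ : 0 < δ) :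
    ∀ᶠ j in atTop, kernelMeasure V j (Metric.ball 0 δ)ᶜ = 0 := by
  filter_upwards [tendsto_one_div_add_atTop_nhds_zero_nat.eventually_lt_const hδ] with j hj
  exact kernelMeasure_compl_ball hj

lemma avg_kernelMeasure (j : ℕ) (f : V → F) (z : V) :
    avg (kernelMeasure V j) f z = ∫ y, kernelFun V j y • f (z - y) := by
  rw [avg, kernelMeasure, integral_withDensity_eq_integral_toReal_smul₀]
  · exact integral_congr_ae (ae_of_all _ fun y => by
      simp [ENNReal.toReal_ofReal (kernelFun_nonneg j y)])
  · exact (continuous_kernelFun j).measurable.ennreal_ofReal.aemeasurable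
  · exact ae_of_all _ fun y => ENNReal.ofReal_lt_top

open scoped Convolution in
lemma avg_kernelMeasure_eq_convolution (j : ℕ) (f : V → ℝ) :
    avg (kernelMeasure V j) f
      = (kernelFun V j) ⋆[ContinuousLinearMap.lsmul ℝ ℝ, volume] f := by
  ext z; rw [avg_kernelMeasure]; rfl

lemma contDiff_avg_kernelMeasure (j : ℕ) {f : V → ℝ} (hf : LocallyIntegrable f volume) {m : ℕ∞} :
    ContDiff ℝ m (avg (kernelMeasure V j) f) := by
  rw [avg_kernelMeasure_eq_convolution]
  exact (hasCompactSupport_kernelFun V j).contDiff_convolution_left _ (contDiff_kernelFun V j) hf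

/-- The derivative falls on the kernel, so integrability of `f` is enough. In this form the right
side can be compared with a weak derivative tested with the kernel translated to `z`. -/
lemma fderiv_avg_kernelMeasure (j : ℕ) {f : V → ℝ} (hf : Integrable f volume) (z e : V) :
    fderiv ℝ (avg (kernelMeasure V j) f) z e = ∫ y, fderiv ℝ (kernelFun V j) (z - y) e * f y := by
  have hk := contDiff_kernelFun V j (m := 1)
  have hc := hasCompactSupport_kernelFun V j
  rw [avg_kernelMeasure_eq_convolution,
    (hc.hasFDerivAt_convolution_left _ hk hf.locallyIntegrable z).fderiv]
  rw [convolution_eq_swap]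
  have hk' := hk.continuous_fderiv one_ne_zero
  obtain ⟨C, hC⟩ := hk'.bounded_above_of_compact_support (hc.fderiv ℝ)
  rw [ContinuousLinearMap.integral_apply]
  · rfl
  · have : Integrable (fun y => f y • fderiv ℝ (kernelFun V j) (z - y)) :=
      hf.smul_bdd C (hk'.comp (continuous_const.sub continuous_id)).aestronglyMeasurable
        (ae_of_all _ fun y => hC _)
    refine this.congr (ae_of_all _ fun y => ?_)
    ext e
    simp [ContinuousLinearMap.precompL_apply, mul_comm]

end Average

end

/-! ### Smooth approximation of weak gradients, and `C¹` test functions. -/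

section

instance (n : ℕ) : (volume : Measure (E n × ℝ)).IsAddHaarMeasure :=
  Measure.prod.instIsAddHaarMeasure volume volume

lemma tendsto_avg_apply {V F : Type*} [NormedAddCommGroup V] [NormedSpace ℝ V]
    [FiniteDimensional ℝ V]
    [MeasureSpace V] [BorelSpace V] [(volume : Measure V).IsAddHaarMeasure]
    [NormedAddCommGroup F] [NormedSpace ℝ F] [CompleteSpace F]
    {ι : Type*} {l : Filter ι} {μ : ι → Measure V}
    [∀ i, IsProbabilityMeasure (μ i)]
    (hμ : ∀ δ > 0, ∀ᶠ i in l, μ i (Metric.ball 0 δ)ᶜ = 0) {f : V → F}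
    (hf : Continuous f) (hc : HasCompactSupport f) (z : V) :
    Tendsto (fun i => avg (μ i) f z) l (𝓝 (f z)) := by
  obtain ⟨C, hC⟩ := hf.bounded_above_of_compact_support hc
  rw [Metric.tendsto_nhds]
  intro ε hε
  obtain ⟨δ, hδ, hδε⟩ := Metric.continuousAt_iff.1 hf.continuousAt (ε / 2) (half_pos hε)
  filter_upwards [hμ δ hδ] with i hi
  rw [dist_eq_norm]
  refine lt_of_le_of_lt (norm_avg_sub_le_of_uniform (μ i) hi (c := ε / 2) ?_ fun y hy => ?_)
    (half_lt_self hε)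
  · exact Integrable.of_bound
      (hf.comp (continuous_const.sub continuous_id)).aestronglyMeasurable
      C (ae_of_all _ fun y => hC _)
  · rw [← dist_eq_norm]
    exact (hδε (by simpa [dist_eq_norm] using hy)).le

lemma norm_avg_le {V F : Type*} [MeasurableSpace V] [Sub V]
    [NormedAddCommGroup F] [NormedSpace ℝ F] (μ : Measure V) [IsProbabilityMeasure μ] {f : V → F}
    {C : ℝ} (hC : ∀ z, ‖f z‖ ≤ C) (z : V) : ‖avg μ f z‖ ≤ C :=
  (norm_integral_le_of_norm_le_const (ae_of_all _ fun y => hC (z - y))).trans (by simp)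

/-! ### Spatial gradients as continuous linear images of the derivative -/

variable {n : ℕ}

/-- The spatial part of a covector on space-time, as a vector. -/
def spacePart : (E n × ℝ →L[ℝ] ℝ) →L[ℝ] E n :=
  LinearMap.mkContinuous
    { toFun := fun ℓ => (InnerProductSpace.toDual ℝ (E n)).symm
        (ℓ.comp (ContinuousLinearMap.inl ℝ (E n) ℝ))
      map_add' := fun x y => by
        refine ext_inner_right ℝ fun e => ?_
        simp [inner_add_left]
      map_smul' := fun c x => by
        refine ext_inner_right ℝ fun e => ?_
        simp [inner_smul_left] } 1 (fun ℓ => by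
      simp only [LinearMap.coe_mk, AddHom.coe_mk, LinearIsometryEquiv.norm_map, one_mul]
      refine (ℓ.opNorm_comp_le _).trans ?_
      exact mul_le_of_le_one_right (norm_nonneg _) (ContinuousLinearMap.norm_inl_le_one ℝ (E n) ℝ))

lemma inner_spacePart (ℓ : E n × ℝ →L[ℝ] ℝ) (e : E n) : inner ℝ (spacePart ℓ) e = ℓ (e, 0) := by
  simp [spacePart]

lemma norm_spacePart_le (ℓ : E n × ℝ →L[ℝ] ℝ) : ‖spacePart ℓ‖ ≤ ‖ℓ‖ := by
  refine (spacePart.le_opNorm ℓ).trans ?_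
  refine mul_le_of_le_one_left (norm_nonneg _) ?_
  exact LinearMap.mkContinuous_norm_le _ zero_le_one _

lemma hasFDerivAt_slice {φ : E n × ℝ → ℝ} {z : E n × ℝ} (h : DifferentiableAt ℝ φ z) :
    HasFDerivAt (fun y => φ (y, z.2)) ((fderiv ℝ φ z).comp (ContinuousLinearMap.inl ℝ (E n) ℝ))
      z.1 :=
  HasFDerivAt.comp (f := fun y : E n => (y, z.2)) z.1 h.hasFDerivAt (hasFDerivAt_prodMk_left z.1 z.2)

lemma spaceGrad_eq {φ : E n × ℝ → ℝ} {z : E n × ℝ} (h : DifferentiableAt ℝ φ z) :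
    spaceGrad φ z = spacePart (fderiv ℝ φ z) := by
  rw [spaceGrad, gradient, (hasFDerivAt_slice h).fderiv]; rfl

lemma timeDeriv_eq {φ : E n × ℝ → ℝ} {z : E n × ℝ} (h : DifferentiableAt ℝ φ z) :
    timeDeriv φ z = fderiv ℝ φ z (0, 1) := by
  have : HasFDerivAt (fun s => φ (z.1, s)) ((fderiv ℝ φ z).comp (ContinuousLinearMap.inr ℝ (E n) ℝ))
      z.2 :=
    HasFDerivAt.comp (f := fun s : ℝ => (z.1, s)) z.2 h.hasFDerivAt (hasFDerivAt_prodMk_right z.1 z.2)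
  rw [timeDeriv, this.hasDerivAt.deriv]; rfl

lemma spaceGrad_eq_comp {φ : E n × ℝ → ℝ} (h : ContDiff ℝ 1 φ) :
    spaceGrad φ = fun z => spacePart (fderiv ℝ φ z) :=
  funext fun z => spaceGrad_eq (h.differentiable one_ne_zero z)

lemma timeDeriv_eq_comp {φ : E n × ℝ → ℝ} (h : ContDiff ℝ 1 φ) :
    timeDeriv φ = fun z => fderiv ℝ φ z (0, 1) :=
  funext fun z => timeDeriv_eq (h.differentiable one_ne_zero z)

lemma continuous_spaceGrad {φ : E n × ℝ → ℝ} (h : ContDiff ℝ 1 φ) : Continuous (spaceGrad φ) := by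
  rw [spaceGrad_eq_comp h]
  exact spacePart.continuous.comp (h.continuous_fderiv one_ne_zero)

lemma continuous_timeDeriv {φ : E n × ℝ → ℝ} (h : ContDiff ℝ 1 φ) : Continuous (timeDeriv φ) := by
  rw [timeDeriv_eq_comp h]
  exact (h.continuous_fderiv one_ne_zero).clm_apply continuous_const

lemma support_spaceGrad_subset {φ : E n × ℝ → ℝ} (h : ContDiff ℝ 1 φ) :
    support (spaceGrad φ) ⊆ tsupport φ := by
  intro z hz
  by_contra h'
  refine hz ?_
  have : fderiv ℝ φ z = 0 := by
    by_contra h0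
    exact h' (support_fderiv_subset ℝ h0)
  simp [spaceGrad_eq (h.differentiable one_ne_zero z), this]

lemma support_timeDeriv_subset {φ : E n × ℝ → ℝ} (h : ContDiff ℝ 1 φ) :
    support (timeDeriv φ) ⊆ tsupport φ := by
  intro z hz
  by_contra h'
  refine hz ?_
  have : fderiv ℝ φ z = 0 := by
    by_contra h0
    exact h' (support_fderiv_subset ℝ h0)
  simp [timeDeriv_eq (h.differentiable one_ne_zero z), this]

/-! ### Smooth approximation of a function with a weak gradient -/

lemma _root_.ContinuousOn.stronglyMeasurable_indicator_of_measurableSet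
    {V : Type*} [TopologicalSpace V] [MeasurableSpace V] [BorelSpace V]
    {v : V → ℝ} {K : Set V} (hv : ContinuousOn v K) (hK : MeasurableSet K) :
    StronglyMeasurable (K.indicator v) := by
  classical
  have := ContinuousOn.measurable_piecewise (f := v) (g := fun _ => (0 : ℝ)) (s := K) hv
    continuousOn_const hK
  exact (show K.piecewise v (fun _ => 0) = K.indicator v from piecewise_eq_indicator) ▸
    this.stronglyMeasurable

/-- The reflected kernel `y ↦ κ(z - y)` is an admissible test function as soon as its ball lies in
`K' ⊆ U`. The sign from the reflection cancels the sign in the definition of the weak gradient, and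
cutting off outside `K'` is invisible from `z`. -/
lemma spaceGrad_avg_kernelMeasure {p : ℝ} {U : Set (E n × ℝ)} {v : E n × ℝ → ℝ}
    {G : E n × ℝ → E n} (hG : IsWeakSpaceGrad p U v G) {K' : Set (E n × ℝ)} (hKU : K' ⊆ U) (hU : MeasurableSet U)
    (hvi : Integrable (K'.indicator v)) {j : ℕ} {z : E n × ℝ}
    (hz : Metric.closedBall z (1 / (j + 1)) ⊆ K') :
    spaceGrad (avg (kernelMeasure (E n × ℝ) j) (K'.indicator v)) z
      = avg (kernelMeasure (E n × ℝ) j) (K'.indicator G) z := by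
  set κ := kernelFun (E n × ℝ) j with hκ
  have hk : ContDiff ℝ 1 κ := contDiff_kernelFun _ j (m := 1)
  have hk' := hk.continuous_fderiv one_ne_zero
  obtain ⟨C, hC⟩ := hk'.bounded_above_of_compact_support
    ((hasCompactSupport_kernelFun (E n × ℝ) j).fderiv ℝ)
  obtain ⟨C', hC'⟩ := hk.continuous.bounded_above_of_compact_support
    (hasCompactSupport_kernelFun (E n × ℝ) j)
  set φ : E n × ℝ → ℝ := fun y => κ (z - y) with hφ
  have hφs : ContDiff ℝ (⊤ : ℕ∞) φ :=
    (contDiff_kernelFun _ j (m := ⊤)).comp (contDiff_const.sub contDiff_id)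
  have hφ1 : ContDiff ℝ 1 φ := hk.comp (contDiff_const.sub contDiff_id)
  have hsupp : support φ ⊆ Metric.closedBall z (1 / (j + 1)) := by
    intro y hy
    have : z - y ∈ tsupport κ := subset_tsupport κ hy
    rw [hκ, tsupport_kernelFun] at this
    simpa [dist_eq_norm, norm_sub_rev] using this
  have htsupp : tsupport φ ⊆ Metric.closedBall z (1 / (j + 1)) :=
    closure_minimal hsupp Metric.isClosed_closedBall
  have htest : IsTest U φ :=
    ⟨hφs, HasCompactSupport.of_support_subset_isCompact (isCompact_closedBall _ _) hsupp,
      htsupp.trans (hz.trans hKU)⟩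
  have hder : ∀ y, fderiv ℝ φ y = -fderiv ℝ κ (z - y) := by
    intro y
    have := (hk.differentiable one_ne_zero (z - y)).hasFDerivAt.comp y
      ((hasFDerivAt_id y).const_sub z)
    refine (this.fderiv : fderiv ℝ φ y = _).trans ?_
    ext e <;> simp
  have hl : ∫ y in U, v y • spaceGrad φ y = ∫ y, K'.indicator v y • spaceGrad φ y := by
    rw [← integral_indicator hU]
    congr 1; ext1 y
    by_cases hy : y ∈ K'
    · simp [hy, hKU hy]
    · have : spaceGrad φ y = 0 := by
        by_contra h0
        exact hy (hz (htsupp (support_spaceGrad_subset hφ1 h0)))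
      by_cases hyU : y ∈ U <;> simp [hyU, this]
  have hr : ∫ y in U, φ y • G y = ∫ y, φ y • K'.indicator G y := by
    rw [← integral_indicator hU]
    congr 1; ext1 y
    by_cases hy : y ∈ K'
    · simp [hy, hKU hy]
    · have : φ y = 0 := by
        by_contra h0
        exact hy (hz (hsupp h0))
      by_cases hyU : y ∈ U <;> simp [hyU, this]
  have hbp := hG.byParts φ htest
  rw [hl, hr] at hbp
  have havg : avg (kernelMeasure (E n × ℝ) j) (K'.indicator G) z
      = ∫ y, φ y • K'.indicator G y := by
    rw [avg_kernelMeasure, ← integral_sub_left_eq_self _ _ z]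
    simp [hφ, hκ]
  have hi1 : Integrable (fun y => K'.indicator v y • spaceGrad φ y) := by
    refine hvi.smul_bdd C (continuous_spaceGrad hφ1).aestronglyMeasurable (ae_of_all _ fun y => ?_)
    rw [spaceGrad_eq (hφ1.differentiable one_ne_zero y), hder]
    exact (norm_spacePart_le _).trans (by rw [norm_neg]; exact hC _)
  have hi2 : ∫ y, φ y • K'.indicator G y = -∫ y, K'.indicator v y • spaceGrad φ y := by
    rw [hbp, neg_neg]
  rw [havg, hi2]
  have hV : ContDiff ℝ 1 (avg (kernelMeasure (E n × ℝ) j) (K'.indicator v)) :=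
    contDiff_avg_kernelMeasure j hvi.locallyIntegrable (m := 1)
  rw [spaceGrad_eq (hV.differentiable one_ne_zero z)]
  refine ext_inner_right ℝ fun e => ?_
  rw [inner_spacePart, fderiv_avg_kernelMeasure j hvi, inner_neg_left, real_inner_comm,
    ← integral_inner hi1, ← integral_neg]
  congr 1; ext1 y
  rw [real_inner_comm, inner_smul_left, spaceGrad_eq (hφ1.differentiable one_ne_zero y),
    inner_spacePart, hder]
  simp [hκ, mul_comm]

lemma eventually_closedBall_subset {V : Type*} [PseudoMetricSpace V] {K K' : Set V} {δ : ℝ}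
    (hδ : 0 < δ) (h : Metric.cthickening δ K ⊆ K') :
    ∀ᶠ j : ℕ in atTop, ∀ z ∈ K, Metric.closedBall z (1 / (j + 1)) ⊆ K' := by
  filter_upwards [tendsto_one_div_add_atTop_nhds_zero_nat.eventually_lt_const hδ] with j hj z hz
  refine ((Metric.closedBall_subset_closedBall hj.le).trans ?_).trans h
  exact Metric.closedBall_subset_cthickening hz δ

/-- A continuous function with a weak gradient is approximated on compact sets, uniformly and with
its gradient in `L^p`, by smooth functions. -/
lemma exists_contDiff_approx {p : ℝ} (hp : 1 ≤ p) {U : Set (E n × ℝ)} (hU : IsOpen U)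
    {v : E n × ℝ → ℝ} {G : E n × ℝ → E n} (hv : ContinuousOn v U) (hGm : StronglyMeasurable G)
    (hG : IsWeakSpaceGrad p U v G) {K : Set (E n × ℝ)} (hK : IsCompact K) (hKU : K ⊆ U) :
    ∃ V : ℕ → E n × ℝ → ℝ, (∀ j, ContDiff ℝ 1 (V j)) ∧ TendstoUniformlyOn V v atTop K ∧
      Tendsto (fun j => eLpNorm (fun z => spaceGrad (V j) z - G z) (ENNReal.ofReal p)
        (volume.restrict K)) atTop (𝓝 0) := by
  obtain ⟨δ, hδ, hδU⟩ := hK.exists_cthickening_subset_open hU hKU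
  set K' := Metric.cthickening δ K with hK'
  have hK'c : IsCompact K' := hK.cthickening
  have hp' : 1 ≤ ENNReal.ofReal p := by simpa using hp
  have hvK' : ContinuousOn v K' := hv.mono hδU
  have hvm : StronglyMeasurable (K'.indicator v) :=
    hvK'.stronglyMeasurable_indicator_of_measurableSet hK'c.measurableSet
  have hvi : Integrable (K'.indicator v) :=
    (integrable_indicator_iff hK'c.measurableSet).2 (hvK'.integrableOn_compact hK'c)
  have hGL : MemLp (K'.indicator G) (ENNReal.ofReal p) volume :=
    (memLp_indicator_iff_restrict hK'c.measurableSet).2 (hG.memLp_grad K' hδU hK'c)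
  refine ⟨fun j => avg (kernelMeasure (E n × ℝ) j) (K'.indicator v),
    fun j => contDiff_avg_kernelMeasure j hvi.locallyIntegrable (m := 1), ?_, ?_⟩
  · obtain ⟨C, hC⟩ := hK'c.exists_bound_of_continuousOn hvK'
    have hC' : ∀ z, ‖K'.indicator v z‖ ≤ max C 0 := by
      intro z
      by_cases hz : z ∈ K'
      · simpa [hz] using Or.inl (hC z hz)
      · simp [hz]
    have huc := hK'c.uniformContinuousOn_of_continuous hvK'
    rw [Metric.tendstoUniformlyOn_iff]
    intro ε hε
    obtain ⟨η, hη, hηε⟩ := Metric.uniformContinuousOn_iff.1 huc (ε / 2) (half_pos hε)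
    filter_upwards [eventually_kernelMeasure_compl_ball (E n × ℝ) (min η δ) (lt_min hη hδ)]
      with j hj z hz
    have hzK' : z ∈ K' := Metric.self_subset_cthickening _ hz
    rw [dist_comm, dist_eq_norm]
    have hvz : v z = K'.indicator v z := by simp [hzK']
    rw [hvz]
    refine lt_of_le_of_lt (norm_avg_sub_le_of_uniform _ hj (c := ε / 2) ?_ fun y hy => ?_)
      (half_lt_self hε)
    · exact Integrable.of_bound
        (hvm.comp_measurable (measurable_const.sub measurable_id)).aestronglyMeasurable
        (max C 0) (ae_of_all _ fun y => hC' _)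
    · have hy' : z - y ∈ K' := by
        refine Metric.closedBall_subset_cthickening hz δ ?_
        simpa [dist_eq_norm] using (hy.trans_le (min_le_right _ _)).le
      rw [indicator_of_mem hy', indicator_of_mem hzK', ← dist_eq_norm]
      refine (hηε _ hy' _ hzK' ?_).le
      simpa [dist_eq_norm] using hy.trans_le (min_le_left _ _)
  -- On `K` the gradient of the average is eventually the average of the gradient, so the `L^p`
  -- convergence of averages applies to the cut-off `G`.
  · refine tendsto_of_tendsto_of_tendsto_of_le_of_le' tendsto_const_nhds
      (tendsto_eLpNorm_avg_sub (eventually_kernelMeasure_compl_ball (E n × ℝ))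
        (hGm.indicator hK'c.measurableSet) hp hGL) (Eventually.of_forall fun _ => zero_le) ?_
    filter_upwards [eventually_closedBall_subset hδ (subset_refl K')] with j hj
    refine le_trans (eLpNorm_congr_ae ?_).le
      (eLpNorm_mono_measure _ (Measure.restrict_le_self (s := K)))
    refine (ae_restrict_iff' hK.measurableSet).2 (ae_of_all _ fun z hz => ?_)
    simp only [spaceGrad_avg_kernelMeasure hG hδU hU.measurableSet hvi (hj z hz)]
    have hz' : z ∈ K' := Metric.self_subset_cthickening K hz
    simp [hz']

/-! ### Test functions of class `C¹` -/

/-- The weak form of `∂ₜ B - div a = 0`, tested with `φ`. -/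
def weakForm (U : Set (E n × ℝ)) (B : E n × ℝ → ℝ) (a : E n × ℝ → E n) (φ : E n × ℝ → ℝ) : ℝ :=
  ∫ z in U, (-B z * timeDeriv φ z + inner ℝ (a z) (spaceGrad φ z))

lemma weakForm_eq_setIntegral {U K : Set (E n × ℝ)} (hU : MeasurableSet U) (hKU : K ⊆ U)
    (B : E n × ℝ → ℝ) (a : E n × ℝ → E n) {φ : E n × ℝ → ℝ} (h : ContDiff ℝ 1 φ)
    (hK : tsupport φ ⊆ K) :
    weakForm U B a φ = ∫ z in K, (-B z * timeDeriv φ z + inner ℝ (a z) (spaceGrad φ z)) := by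
  refine (setIntegral_eq_of_subset_of_forall_sdiff_eq_zero hU hKU fun z hz => ?_)
  have h1 : timeDeriv φ z = 0 := by
    by_contra h0; exact hz.2 (hK (support_timeDeriv_subset h h0))
  have h2 : spaceGrad φ z = 0 := by
    by_contra h0; exact hz.2 (hK (support_spaceGrad_subset h h0))
  simp [h1, h2]

/-- The weak form may be tested with `C¹` functions. -/
lemma weakForm_eq_zero_of_contDiff_one {U : Set (E n × ℝ)} (hU : IsOpen U) {B : E n × ℝ → ℝ}
    {a : E n × ℝ → E n} (hB : ∀ K ⊆ U, IsCompact K → IntegrableOn B K)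
    (ha : ∀ K ⊆ U, IsCompact K → IntegrableOn a K)
    (h : ∀ φ, IsTest U φ → weakForm U B a φ = 0) {φ : E n × ℝ → ℝ} (hφ : ContDiff ℝ 1 φ)
    (hc : HasCompactSupport φ) (hs : tsupport φ ⊆ U) : weakForm U B a φ = 0 := by
  obtain ⟨δ, hδ, hδU⟩ := hc.isCompact.exists_cthickening_subset_open hU hs
  set K' := Metric.cthickening δ (tsupport φ) with hK'
  have hK'c : IsCompact K' := hc.isCompact.cthickening
  set φj : ℕ → E n × ℝ → ℝ := fun j => avg (kernelMeasure (E n × ℝ) j) φ with hφj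
  have hφi : LocallyIntegrable φ := hφ.continuous.locallyIntegrable
  have hsm : ∀ j, ContDiff ℝ 1 (φj j) := fun j => contDiff_avg_kernelMeasure j hφi (m := 1)
  have hsm' : ∀ j, ContDiff ℝ (⊤ : ℕ∞) (φj j) := fun j => contDiff_avg_kernelMeasure j hφi (m := ⊤)
  have hφ' := hφ.continuous_fderiv one_ne_zero
  obtain ⟨C, hC⟩ := hφ'.bounded_above_of_compact_support (hc.fderiv ℝ)
  have hder : ∀ j z, fderiv ℝ (φj j) z = avg (kernelMeasure (E n × ℝ) j) (fderiv ℝ φ) z :=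
    fun j z => (hasFDerivAt_avg hφ hc z).fderiv
  have hlim : ∀ z, Tendsto (fun j => fderiv ℝ (φj j) z) atTop (𝓝 (fderiv ℝ φ z)) := fun z => by
    simp_rw [hder]
    exact tendsto_avg_apply (eventually_kernelMeasure_compl_ball (E n × ℝ)) hφ' (hc.fderiv ℝ) z
  have hbd : ∀ j z, ‖fderiv ℝ (φj j) z‖ ≤ C := fun j z => by
    rw [hder]; exact norm_avg_le _ hC z
  have htime : ∀ j z, |timeDeriv (φj j) z| ≤ C := fun j z => by
    rw [timeDeriv_eq ((hsm j).differentiable one_ne_zero z), ← Real.norm_eq_abs]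
    refine ((fderiv ℝ (φj j) z).le_opNorm _).trans ?_
    simpa using hbd j z
  have hspace : ∀ j z, ‖spaceGrad (φj j) z‖ ≤ C := fun j z => by
    rw [spaceGrad_eq ((hsm j).differentiable one_ne_zero z)]
    exact (norm_spacePart_le _).trans (hbd j z)
  have hsupp : ∀ᶠ j in atTop, tsupport (φj j) ⊆ K' := by
    filter_upwards [eventually_kernelMeasure_compl_ball (E n × ℝ) δ hδ] with j hj
    refine closure_minimal (fun z hz => ?_) Metric.isClosed_cthickening
    by_contra h'
    exact hz (avg_eq_zero_of_support hj (subset_tsupport φ) fun h'' =>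
      h' (Metric.thickening_subset_cthickening _ _ h''))
  have hzero : ∀ᶠ j in atTop,
      ∫ z in K', (-B z * timeDeriv (φj j) z + inner ℝ (a z) (spaceGrad (φj j) z)) = 0 := by
    filter_upwards [hsupp] with j hj
    rw [← weakForm_eq_setIntegral hU.measurableSet hδU B a (hsm j) hj]
    exact h _ ⟨hsm' j, HasCompactSupport.of_support_subset_isCompact hK'c
      ((subset_tsupport _).trans hj), hj.trans hδU⟩
  rw [weakForm_eq_setIntegral hU.measurableSet hδU B a hφ (Metric.self_subset_cthickening _)]
  refine tendsto_nhds_unique (f := fun j => ∫ z in K', (-B z * timeDeriv (φj j) z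
    + inner ℝ (a z) (spaceGrad (φj j) z))) (l := atTop) ?_
    (tendsto_const_nhds.congr' (hzero.mono fun j hj => hj.symm))
  have hBi := hB K' hδU hK'c
  have hai := ha K' hδU hK'c
  -- The derivatives of the mollified test functions are bounded by `C` and converge pointwise, and
  -- their supports eventually lie in `K'`; local integrability of `B` and `a` is then enough.
  refine tendsto_integral_of_dominated_convergence (fun z => ‖B z‖ * C + ‖a z‖ * C) (fun j => ?_)
    ((hBi.norm.mul_const C).add (hai.norm.mul_const C)) (fun j => ?_) ?_
  · exact (hBi.neg.aestronglyMeasurable.mul (continuous_timeDeriv (hsm j)).aestronglyMeasurable).add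
      (hai.aestronglyMeasurable.inner (continuous_spaceGrad (hsm j)).aestronglyMeasurable)
  · refine ae_of_all _ fun z => (norm_add_le _ _).trans (add_le_add ?_ ?_)
    · rw [norm_mul, norm_neg]
      exact mul_le_mul_of_nonneg_left (htime j z) (norm_nonneg _)
    · exact (norm_inner_le_norm _ _).trans (mul_le_mul_of_nonneg_left (hspace j z) (norm_nonneg _))
  · refine ae_of_all _ fun z => ?_
    have h1 : Tendsto (fun j => timeDeriv (φj j) z) atTop (𝓝 (timeDeriv φ z)) := by
      rw [timeDeriv_eq (hφ.differentiable one_ne_zero z)]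
      simp_rw [fun j => timeDeriv_eq ((hsm j).differentiable one_ne_zero z)]
      exact ((ContinuousLinearMap.apply ℝ ℝ ((0 : E n), (1 : ℝ))).continuous.tendsto _).comp
        (hlim z)
    have h2 : Tendsto (fun j => spaceGrad (φj j) z) atTop (𝓝 (spaceGrad φ z)) := by
      rw [spaceGrad_eq (hφ.differentiable one_ne_zero z)]
      simp_rw [fun j => spaceGrad_eq ((hsm j).differentiable one_ne_zero z)]
      exact (spacePart.continuous.tendsto _).comp (hlim z)
    exact (h1.const_mul _).add (tendsto_const_nhds.inner h2)

end

/-! ### Steklov averages and the equation tested with non-smooth functions. -/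

section

variable {n : ℕ}

/-! ### Pairings of dual Lebesgue functions -/

section Pairing

variable {α W : Type*} [MeasurableSpace α] {μ : Measure α} [NormedAddCommGroup W]
  [InnerProductSpace ℝ W]

lemma eLpNorm_inner_le {p p' : ℝ≥0∞} [p'.HolderConjugate p] {a f : α → W}
    (ha : AEStronglyMeasurable a μ) (hf : AEStronglyMeasurable f μ) :
    eLpNorm (fun z => (inner ℝ (a z) (f z) : ℝ)) 1 μ ≤ eLpNorm a p' μ * eLpNorm f p μ := by
  have := eLpNorm_le_eLpNorm_mul_eLpNorm'_of_norm (p := p') (q := p) (r := 1) ha hf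
    (fun x y => (inner ℝ x y : ℝ)) 1
    (ae_of_all _ fun z => by simpa using norm_inner_le_norm (𝕜 := ℝ) (a z) (f z))
  simpa using this

lemma integrable_inner_of_memLp {p p' : ℝ≥0∞} [p'.HolderConjugate p] {a f : α → W}
    (ha : MemLp a p' μ) (hf : MemLp f p μ) :
    Integrable (fun z => (inner ℝ (a z) (f z) : ℝ)) μ := by
  rw [← memLp_one_iff_integrable]
  exact ⟨ha.1.inner hf.1, (eLpNorm_inner_le (p := p) ha.1 hf.1).trans_lt
    (ENNReal.mul_lt_top ha.2 hf.2)⟩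

lemma tendsto_integral_inner {p p' : ℝ≥0∞} [p'.HolderConjugate p]
    {ι : Type*} {l : Filter ι} {a : α → W}
    {f : ι → α → W} {f₀ : α → W} (ha : MemLp a p' μ) (hf : ∀ i, AEStronglyMeasurable (f i) μ)
    (hf₀ : MemLp f₀ p μ) (h : Tendsto (fun i => eLpNorm (f i - f₀) p μ) l (𝓝 0)) :
    Tendsto (fun i => ∫ z, (inner ℝ (a z) (f i z) : ℝ) ∂μ) l (𝓝 (∫ z, inner ℝ (a z) (f₀ z) ∂μ)) := by
  have hfi : ∀ᶠ i in l, MemLp (f i) p μ := by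
    filter_upwards [h.eventually_lt_const (zero_lt_one)] with i hi
    have h1 : MemLp (f i - f₀) p μ := ⟨(hf i).sub hf₀.1, hi.trans ENNReal.one_lt_top⟩
    simpa using h1.add hf₀
  rw [tendsto_iff_edist_tendsto_0]
  refine tendsto_of_tendsto_of_tendsto_of_le_of_le' tendsto_const_nhds
    (h := fun i => eLpNorm a p' μ * eLpNorm (f i - f₀) p μ) ?_
    (Eventually.of_forall fun _ => zero_le) ?_
  · simpa using ENNReal.Tendsto.const_mul h (Or.inr ha.2.ne)
  · filter_upwards [hfi] with i hi
    rw [edist_eq_enorm_sub, ← integral_sub (integrable_inner_of_memLp ha hi)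
      (integrable_inner_of_memLp ha hf₀)]
    refine (enorm_integral_le_lintegral_enorm _).trans ?_
    rw [← eLpNorm_one_eq_lintegral_enorm]
    have := eLpNorm_inner_le (p := p) (p' := p') ha.1 ((hf i).sub hf₀.1)
    simpa [inner_sub_right] using this

end Pairing

/-! ### Steklov averages -/

/-- The uniform distribution on the time segment from `(0, -h)` to `(0, 0)`. -/
def steklovMeasure (n : ℕ) (h : ℝ) : Measure (E n × ℝ) :=
  (volume.restrict (Icc (0 : ℝ) 1)).map fun s => ((0 : E n), -(h * s))

lemma measurable_steklov (h : ℝ) : Measurable fun s : ℝ => ((0 : E n), -(h * s)) := by fun_prop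

instance (h : ℝ) : IsProbabilityMeasure (steklovMeasure n h) := by
  have : IsProbabilityMeasure (volume.restrict (Icc (0 : ℝ) 1)) := ⟨by simp⟩
  exact Measure.isProbabilityMeasure_map (measurable_steklov h).aemeasurable

lemma avg_steklovMeasure {F : Type*} [NormedAddCommGroup F] [NormedSpace ℝ F] (h : ℝ)
    {f : E n × ℝ → F} (hf : StronglyMeasurable f) (z : E n × ℝ) :
    avg (steklovMeasure n h) f z = ∫ s in Icc (0 : ℝ) 1, f (z.1, z.2 + h * s) := by
  rw [avg, steklovMeasure, integral_map (measurable_steklov h).aemeasurable]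
  · congr 1; ext1 s; congr 1
    ext <;> simp
  · exact (hf.comp_measurable (measurable_const.sub measurable_id)).aestronglyMeasurable

lemma steklovMeasure_compl_ball {h δ : ℝ} (hδ : |h| < δ) :
    steklovMeasure n h (Metric.ball 0 δ)ᶜ = 0 := by
  rw [steklovMeasure, Measure.map_apply (measurable_steklov h)
    Metric.isOpen_ball.measurableSet.compl, Measure.restrict_apply
    (measurable_steklov h Metric.isOpen_ball.measurableSet.compl)]
  convert measure_empty (μ := (volume : Measure ℝ))
  rw [← disjoint_iff_inter_eq_empty, Set.disjoint_left]
  intro s hs hs'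
  refine hs ?_
  have h1 : |h * s| ≤ |h| := by
    rw [abs_mul]
    exact mul_le_of_le_one_right (abs_nonneg _) (by rw [abs_of_nonneg hs'.1]; exact hs'.2)
  simp only [mem_ball_zero_iff, Prod.norm_def, norm_zero, norm_neg, Real.norm_eq_abs]
  exact max_lt ((abs_nonneg _).trans_lt hδ) (h1.trans_lt hδ)

lemma eventually_steklovMeasure_compl_ball (n : ℕ) (δ : ℝ) (hδ : 0 < δ) :
    ∀ᶠ h in 𝓝[>] (0 : ℝ), steklovMeasure n h (Metric.ball 0 δ)ᶜ = 0 := by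
  filter_upwards [Ioo_mem_nhdsGT hδ] with h hh
  exact steklovMeasure_compl_ball (by rw [abs_of_pos hh.1]; exact hh.2)

/-- The fundamental theorem of calculus along the time segment. The time derivative of the test
function becomes a difference quotient, which survives the passage to functions without a time
derivative. -/
lemma timeDeriv_avg_steklovMeasure {h : ℝ} (hh : h ≠ 0) {f : E n × ℝ → ℝ} (hf : ContDiff ℝ 1 f)
    (hc : HasCompactSupport f) (z : E n × ℝ) :
    timeDeriv (avg (steklovMeasure n h) f) z = h⁻¹ * (f (z.1, z.2 + h) - f z) := by
  have hf' := hf.continuous_fderiv one_ne_zero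
  have hi : Integrable (fun s => fderiv ℝ f (z.1, z.2 + h * s)) (volume.restrict (Icc (0 : ℝ) 1)) :=
    Continuous.integrableOn_Icc (hf'.comp (by fun_prop))
  rw [timeDeriv_eq ((contDiff_avg hf hc).differentiable one_ne_zero z),
    (hasFDerivAt_avg hf hc z).fderiv, avg_steklovMeasure h hf'.stronglyMeasurable,
    ContinuousLinearMap.integral_apply hi, integral_Icc_eq_integral_Ioc,
    ← intervalIntegral.integral_of_le zero_le_one]
  have hd : ∀ s ∈ uIcc (0 : ℝ) 1, HasDerivAt (fun s => h⁻¹ * f (z.1, z.2 + h * s))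
      (fderiv ℝ f (z.1, z.2 + h * s) (0, 1)) s := by
    intro s _
    have h1 : HasDerivAt (fun s : ℝ => (z.1, z.2 + h * s)) ((0 : E n), h) s := by
      refine (hasDerivAt_const s z.1).prodMk ?_
      simpa using ((hasDerivAt_id s).const_mul h).const_add z.2
    have h2 := ((hf.differentiable one_ne_zero (z.1, z.2 + h * s)).hasFDerivAt.comp_hasDerivAt s
      h1).const_mul h⁻¹
    have h3 : ((0 : E n), h) = h • ((0 : E n), (1 : ℝ)) := by ext <;> simp
    rw [h3, map_smul, smul_eq_mul, ← mul_assoc, inv_mul_cancel₀ hh, one_mul] at h2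
    exact h2
  rw [intervalIntegral.integral_eq_sub_of_hasDerivAt hd]
  · simp [mul_sub]
  · exact ((hf'.comp (by fun_prop : Continuous fun s : ℝ => (z.1, z.2 + h * s))).clm_apply
      continuous_const).intervalIntegrable _ _

lemma spaceGrad_avg {μ : Measure (E n × ℝ)} [IsFiniteMeasure μ] {f : E n × ℝ → ℝ}
    (hf : ContDiff ℝ 1 f) (hc : HasCompactSupport f) (z : E n × ℝ) :
    spaceGrad (avg μ f) z = avg μ (spaceGrad f) z := by
  have hf' := hf.continuous_fderiv one_ne_zero
  obtain ⟨C, hC⟩ := hf'.bounded_above_of_compact_support (hc.fderiv ℝ)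
  rw [spaceGrad_eq ((contDiff_avg hf hc).differentiable one_ne_zero z),
    (hasFDerivAt_avg hf hc z).fderiv, spaceGrad_eq_comp hf]
  refine (spacePart.integral_comp_comm ?_).symm
  exact Integrable.of_bound (hf'.comp (continuous_const.sub continuous_id)).aestronglyMeasurable C
    (ae_of_all _ fun y => hC _)

/-! ### Limits of `C¹` functions with compact support -/

/-- `ψ` is a bounded pointwise limit of `C¹` functions supported in the compact set `K`, whose
spatial gradients converge to `Γ` in `L^p`. -/
structure HasC1Approx (p : ℝ) (K : Set (E n × ℝ)) (ψ : E n × ℝ → ℝ) (Γ : E n × ℝ → E n) :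
    Prop where
  isCompact : IsCompact K
  stronglyMeasurable : StronglyMeasurable Γ
  support_grad : support Γ ⊆ K
  exists_seq : ∃ Ψ : ℕ → E n × ℝ → ℝ, (∀ j, ContDiff ℝ 1 (Ψ j)) ∧ (∀ j, support (Ψ j) ⊆ K) ∧
    (∃ C, ∀ j z, ‖Ψ j z‖ ≤ C) ∧ (∀ z, Tendsto (fun j => Ψ j z) atTop (𝓝 (ψ z))) ∧
    Tendsto (fun j => eLpNorm (spaceGrad (Ψ j) - Γ) (ENNReal.ofReal p) volume) atTop (𝓝 0)

namespace HasC1Approx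

variable {p : ℝ} {K : Set (E n × ℝ)} {ψ : E n × ℝ → ℝ} {Γ : E n × ℝ → E n}

lemma memLp (h : HasC1Approx p K ψ Γ) : MemLp Γ (ENNReal.ofReal p) volume := by
  obtain ⟨Ψ, h1, h2, -, -, h5⟩ := h.exists_seq
  obtain ⟨j, hj⟩ := (h5.eventually_lt_const zero_lt_one).exists
  have hc : HasCompactSupport (spaceGrad (Ψ j)) :=
    HasCompactSupport.of_support_subset_isCompact h.isCompact
      ((support_spaceGrad_subset (h1 j)).trans (closure_minimal (h2 j) h.isCompact.isClosed))
  have hm : MemLp (spaceGrad (Ψ j)) (ENNReal.ofReal p) volume :=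
    (continuous_spaceGrad (h1 j)).memLp_of_hasCompactSupport hc
  have hd : MemLp (spaceGrad (Ψ j) - Γ) (ENNReal.ofReal p) volume :=
    ⟨hm.1.sub h.stronglyMeasurable.aestronglyMeasurable, hj.trans ENNReal.one_lt_top⟩
  simpa using hm.sub hd

lemma measurable (h : HasC1Approx p K ψ Γ) : StronglyMeasurable ψ := by
  obtain ⟨Ψ, h1, -, -, h4, -⟩ := h.exists_seq
  exact stronglyMeasurable_of_tendsto atTop (fun j => (h1 j).continuous.stronglyMeasurable)
    (tendsto_pi_nhds.2 h4)

lemma exists_bound (h : HasC1Approx p K ψ Γ) : ∃ C, ∀ z, ‖ψ z‖ ≤ C := by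
  obtain ⟨Ψ, -, -, ⟨C, hC⟩, h4, -⟩ := h.exists_seq
  exact ⟨C, fun z => le_of_tendsto (h4 z).norm (Eventually.of_forall fun j => hC j z)⟩

lemma support_subset (h : HasC1Approx p K ψ Γ) : support ψ ⊆ K := by
  obtain ⟨Ψ, -, h2, -, h4, -⟩ := h.exists_seq
  intro z hz
  by_contra hK
  refine hz (tendsto_nhds_unique (h4 z) ?_)
  have : ∀ j, Ψ j z = 0 := fun j => by
    by_contra h0; exact hK (h2 j h0)
  simp [this]

end HasC1Approx

section Weak

variable {p p' : ℝ} {U K : Set (E n × ℝ)} {B ψ : E n × ℝ → ℝ} {a Γ : E n × ℝ → E n}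

/-- The weak form, tested with a Steklov average of a limit of `C¹` functions. -/
lemma integral_steklov_eq (hpp : p'.HolderConjugate p) (hU : IsOpen U)
    (hB : IntegrableOn B U)
    (ha : ∀ K ⊆ U, IsCompact K → MemLp a (ENNReal.ofReal p') (volume.restrict K))
    (hweak : ∀ φ, IsTest U φ → weakForm U B a φ = 0)
    (h : HasC1Approx p K ψ Γ) {δ s : ℝ} (hs : 0 < s) (hsδ : s < δ)
    (hδU : Metric.cthickening δ K ⊆ U) :
    ∫ z in U, B z * (s⁻¹ * (ψ (z.1, z.2 + s) - ψ z))
      = ∫ z in Metric.cthickening δ K, inner ℝ (a z) (avg (steklovMeasure n s) Γ z) := by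
  have hconj := hpp.ennrealOfReal
  have hp1' : 1 ≤ ENNReal.ofReal p' := by simpa using hpp.lt.le
  have ha1 : ∀ K ⊆ U, IsCompact K → IntegrableOn a K := fun K hK hKc => by
    have : IsFiniteMeasure (volume.restrict K) := ⟨by simpa using hKc.measure_lt_top⟩
    exact (ha K hK hKc).integrable hp1'
  obtain ⟨Ψ, h1, h2, ⟨C, hC⟩, h4, h5⟩ := h.exists_seq
  have hc : ∀ j, HasCompactSupport (Ψ j) := fun j =>
    HasCompactSupport.of_support_subset_isCompact h.isCompact (h2 j)
  set K' := Metric.cthickening δ K with hK'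
  have hK'c : IsCompact K' := h.isCompact.cthickening
  have hball : steklovMeasure n s (Metric.ball 0 δ)ᶜ = 0 :=
    steklovMeasure_compl_ball (by rwa [abs_of_pos hs])
  have hsm : ∀ j, ContDiff ℝ 1 (avg (steklovMeasure n s) (Ψ j)) := fun j => contDiff_avg (h1 j) (hc j)
  have hsupp : ∀ j, tsupport (avg (steklovMeasure n s) (Ψ j)) ⊆ K' := fun j => by
    refine closure_minimal (fun z hz => ?_) Metric.isClosed_cthickening
    by_contra h'
    exact hz (avg_eq_zero_of_support hball (h2 j) fun h'' =>
      h' (Metric.thickening_subset_cthickening _ _ h''))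
  -- For each approximant the Steklov average is an admissible `C¹` test function, because `s < δ`
  -- keeps its support in the thickening.
  have hident : ∀ j, ∫ z in U, B z * (s⁻¹ * (Ψ j (z.1, z.2 + s) - Ψ j z))
      = ∫ z in K', inner ℝ (a z) (avg (steklovMeasure n s) (spaceGrad (Ψ j)) z) := by
    intro j
    have hz := weakForm_eq_zero_of_contDiff_one hU (fun K hK _ => hB.mono_set hK) ha1 hweak (hsm j)
      (hasCompactSupport_avg hball (hc j)) ((hsupp j).trans hδU)
    have e1 : ∫ z in U, B z * (s⁻¹ * (Ψ j (z.1, z.2 + s) - Ψ j z))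
        = ∫ z in K', B z * timeDeriv (avg (steklovMeasure n s) (Ψ j)) z := by
      rw [← setIntegral_eq_of_subset_of_forall_sdiff_eq_zero hU.measurableSet hδU]
      · simp_rw [timeDeriv_avg_steklovMeasure hs.ne' (h1 j) (hc j)]
      · intro z hz
        have : timeDeriv (avg (steklovMeasure n s) (Ψ j)) z = 0 := by
          by_contra h0; exact hz.2 (hsupp j (support_timeDeriv_subset (hsm j) h0))
        simp [this]
    rw [weakForm_eq_setIntegral hU.measurableSet hδU B a (hsm j) (hsupp j), integral_add] at hz
    · rw [e1]
      simp_rw [← spaceGrad_avg (h1 j) (hc j)]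
      simp only [neg_mul, integral_neg] at hz
      linarith
    · obtain ⟨C₁, hC₁⟩ := (continuous_timeDeriv (hsm j)).bounded_above_of_compact_support
        (HasCompactSupport.of_support_subset_isCompact hK'c
          ((support_timeDeriv_subset (hsm j)).trans (hsupp j)))
      exact (hB.mono_set hδU).neg.mul_bdd
        (continuous_timeDeriv (hsm j)).aestronglyMeasurable (ae_of_all _ hC₁)
    · refine integrable_inner_of_memLp (p := ENNReal.ofReal p) (ha K' hδU hK'c) ?_
      refine MemLp.restrict _ ?_
      exact (continuous_spaceGrad (hsm j)).memLp_of_hasCompactSupport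
        (HasCompactSupport.of_support_subset_isCompact hK'c
          ((support_spaceGrad_subset (hsm j)).trans (hsupp j)))
  -- With `s` fixed, no convergence of time derivatives is needed: bounded pointwise convergence
  -- handles this side, and the other uses that averaging contracts the `L^p` norm of the gradients.
  have hL : Tendsto (fun j => ∫ z in U, B z * (s⁻¹ * (Ψ j (z.1, z.2 + s) - Ψ j z))) atTop
      (𝓝 (∫ z in U, B z * (s⁻¹ * (ψ (z.1, z.2 + s) - ψ z)))) := by
    refine tendsto_integral_of_dominated_convergence (fun z => ‖B z‖ * (s⁻¹ * (C + C)))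
      (fun j => ?_) (hB.norm.mul_const _) (fun j => ae_of_all _ fun z => ?_)
      (ae_of_all _ fun z => ?_)
    · refine hB.aestronglyMeasurable.mul (Continuous.aestronglyMeasurable ?_)
      have := (h1 j).continuous
      fun_prop
    · rw [norm_mul, norm_mul, Real.norm_of_nonneg (inv_nonneg.2 hs.le)]
      refine mul_le_mul_of_nonneg_left (mul_le_mul_of_nonneg_left ?_ (by positivity))
        (norm_nonneg _)
      exact (norm_sub_le _ _).trans (add_le_add (hC _ _) (hC _ _))
    · exact (((h4 _).sub (h4 _)).const_mul _).const_mul _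
  have hR : Tendsto (fun j => ∫ z in K', (inner ℝ (a z)
      (avg (steklovMeasure n s) (spaceGrad (Ψ j)) z) : ℝ)) atTop
      (𝓝 (∫ z in K', inner ℝ (a z) (avg (steklovMeasure n s) Γ z))) := by
    have hΓ := h.memLp
    have hm : ∀ j, StronglyMeasurable (spaceGrad (Ψ j)) := fun j =>
      (continuous_spaceGrad (h1 j)).stronglyMeasurable
    have hml : ∀ j, MemLp (spaceGrad (Ψ j)) (ENNReal.ofReal p) volume := fun j =>
      (continuous_spaceGrad (h1 j)).memLp_of_hasCompactSupport
        (HasCompactSupport.of_support_subset_isCompact h.isCompact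
        ((support_spaceGrad_subset (h1 j)).trans (closure_minimal (h2 j) h.isCompact.isClosed)))
    refine tendsto_integral_inner (p := ENNReal.ofReal p) (ha K' hδU hK'c)
      (fun j => (stronglyMeasurable_avg (hm j)).aestronglyMeasurable) ?_ ?_
    · refine MemLp.restrict _ ⟨(stronglyMeasurable_avg h.stronglyMeasurable).aestronglyMeasurable,
        ?_⟩
      exact (eLpNorm_avg_le _ h.stronglyMeasurable hpp.symm.lt.le).trans_lt hΓ.2
    · refine tendsto_of_tendsto_of_tendsto_of_le_of_le tendsto_const_nhds h5
        (fun _ => zero_le) fun j => ?_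
      refine (eLpNorm_mono_measure _ Measure.restrict_le_self).trans ?_
      refine le_trans (eLpNorm_congr_ae ?_).le
        (eLpNorm_avg_le (steklovMeasure n s) ((hm j).sub h.stronglyMeasurable) hpp.symm.lt.le)
      filter_upwards [ae_integrable_translate (steklovMeasure n s) (hm j) hpp.symm.lt.le (hml j),
        ae_integrable_translate (steklovMeasure n s) h.stronglyMeasurable hpp.symm.lt.le hΓ]
        with z hz1 hz2
      exact (integral_sub hz1 hz2).symm
  simp_rw [hident] at hL
  exact tendsto_nhds_unique hL hR

/-- The flux term is the limit of the backward difference quotients of `B`. -/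
lemma tendsto_integral_diffQuot (hpp : p'.HolderConjugate p) (hU : IsOpen U)
    (hB : IntegrableOn B U)
    (ha : ∀ K ⊆ U, IsCompact K → MemLp a (ENNReal.ofReal p') (volume.restrict K))
    (hweak : ∀ φ, IsTest U φ → weakForm U B a φ = 0)
    (h : HasC1Approx p K ψ Γ) (hKU : K ⊆ U) :
    Tendsto (fun s => ∫ z, ψ z * (s⁻¹ * (U.indicator B (z.1, z.2 - s) - U.indicator B z)))
      (𝓝[>] 0) (𝓝 (∫ z in U, inner ℝ (a z) (Γ z))) := by
  have hconj := hpp.ennrealOfReal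
  obtain ⟨δ, hδ, hδU⟩ := h.isCompact.exists_cthickening_subset_open hU hKU
  set K' := Metric.cthickening δ K with hK'
  have hK'c : IsCompact K' := h.isCompact.cthickening
  have hΓ := h.memLp
  have hlim : Tendsto (fun s => ∫ z in K', (inner ℝ (a z) (avg (steklovMeasure n s) Γ z) : ℝ))
      (𝓝[>] 0) (𝓝 (∫ z in K', inner ℝ (a z) (Γ z))) := by
    refine tendsto_integral_inner (p := ENNReal.ofReal p) (ha K' hδU hK'c)
      (fun j => (stronglyMeasurable_avg h.stronglyMeasurable).aestronglyMeasurable)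
      (hΓ.restrict _) ?_
    refine tendsto_of_tendsto_of_tendsto_of_le_of_le tendsto_const_nhds
      (tendsto_eLpNorm_avg_sub (eventually_steklovMeasure_compl_ball n) h.stronglyMeasurable
        hpp.symm.lt.le hΓ) (fun _ => zero_le) fun s => ?_
    exact eLpNorm_mono_measure _ Measure.restrict_le_self
  have hset : ∫ z in U, (inner ℝ (a z) (Γ z) : ℝ) = ∫ z in K', inner ℝ (a z) (Γ z) := by
    refine setIntegral_eq_of_subset_of_forall_sdiff_eq_zero hU.measurableSet hδU fun z hz => ?_
    have : Γ z = 0 := by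
      by_contra h0; exact hz.2 (Metric.self_subset_cthickening _ (h.support_grad h0))
    simp [this]
  rw [hset]
  refine hlim.congr' ?_
  filter_upwards [Ioo_mem_nhdsGT hδ] with s hs
  rw [← integral_steklov_eq hpp hU hB ha hweak h hs.1 hs.2 hδU]
  obtain ⟨C, hC⟩ := h.exists_bound
  have hBi : Integrable (U.indicator B) := (integrable_indicator_iff hU.measurableSet).2 hB
  have hm : StronglyMeasurable (fun z : E n × ℝ => ψ (z.1, z.2 + s)) :=
    h.measurable.comp_measurable (by fun_prop)
  have hshift : Integrable (fun z : E n × ℝ => U.indicator B (z.1, z.2 - s)) := by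
    have := hBi.comp_sub_right ((0 : E n), s)
    refine this.congr (ae_of_all _ fun z => ?_)
    have : z - ((0 : E n), s) = (z.1, z.2 - s) := by ext <;> simp
    simp only [this]
  have e1 : ∫ z in U, B z * (s⁻¹ * (ψ (z.1, z.2 + s) - ψ z))
      = ∫ z, s⁻¹ * (U.indicator B z * ψ (z.1, z.2 + s) - U.indicator B z * ψ z) := by
    rw [← integral_indicator hU.measurableSet]
    congr 1; ext1 z
    by_cases hz : z ∈ U
    · simp only [indicator_of_mem hz]; ring
    · simp [hz]
  -- Translation in time moves the forward shift of `ψ` to a backward shift of `B`, extended by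
  -- zero.
  have e2 : ∫ z, U.indicator B z * ψ (z.1, z.2 + s)
      = ∫ z : E n × ℝ, U.indicator B (z.1, z.2 - s) * ψ z := by
    rw [← integral_sub_right_eq_self _ ((0 : E n), s)]
    congr 1; ext1 z
    have : z - ((0 : E n), s) = (z.1, z.2 - s) := by ext <;> simp
    rw [this]
    simp
  rw [e1, integral_const_mul, integral_sub, e2, ← integral_sub, ← integral_const_mul]
  · congr 1; ext1 z; ring
  · exact hshift.mul_bdd h.measurable.aestronglyMeasurable (ae_of_all _ hC)
  · exact hBi.mul_bdd h.measurable.aestronglyMeasurable (ae_of_all _ hC)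
  · exact hBi.mul_bdd hm.aestronglyMeasurable (ae_of_all _ fun z => hC _)
  · exact hBi.mul_bdd h.measurable.aestronglyMeasurable (ae_of_all _ hC)

end Weak

end

/-! ### Truncations of the solution as admissible test functions. -/

section

variable {n : ℕ}

/-! ### Composition and localization -/

lemma tendsto_eLpNorm_smul_of_uniform {α W : Type*} [MeasurableSpace α] {μ : Measure α}
    [NormedAddCommGroup W] [NormedSpace ℝ W] {p : ℝ≥0∞} {g : ℕ → α → ℝ} {w : α → W}
    {K : Set α} (hK : MeasurableSet K)
    (hg : ∀ ε > 0, ∀ᶠ j in atTop, ∀ z ∈ K, |g j z| ≤ ε) (hw : MemLp w p (μ.restrict K)) :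
    Tendsto (fun j => eLpNorm (fun z => g j z • w z) p (μ.restrict K)) atTop (𝓝 0) := by
  rw [ENNReal.tendsto_nhds_zero]
  intro ε hε
  by_cases hεt : ε = ∞
  · simp [hεt]
  have h3 : Tendsto (fun c : ℝ => ENNReal.ofReal c * eLpNorm w p (μ.restrict K)) (𝓝[>] 0)
      (𝓝 (ENNReal.ofReal 0 * eLpNorm w p (μ.restrict K))) :=
    (ENNReal.Tendsto.mul_const (ENNReal.continuous_ofReal.tendsto 0) (Or.inr hw.2.ne)).mono_left
      nhdsWithin_le_nhds
  rw [ENNReal.ofReal_zero, zero_mul, ENNReal.tendsto_nhds_zero] at h3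
  obtain ⟨c, hc, hc0⟩ := ((h3 ε hε).and self_mem_nhdsWithin).exists
  filter_upwards [hg c hc0] with j hj
  refine le_trans ?_ hc
  refine eLpNorm_le_mul_eLpNorm_of_ae_le_mul ((ae_restrict_iff' hK).2 (ae_of_all _ fun z hz => ?_)) p
  rw [norm_smul]
  exact mul_le_mul_of_nonneg_right (hj z hz) (norm_nonneg _)

lemma tendstoUniformlyOn_comp_of_continuous {α : Type*} {V : ℕ → α → ℝ} {v : α → ℝ} {K : Set α}
    (hV : TendstoUniformlyOn V v atTop K) {C : ℝ} (hC : ∀ z ∈ K, |v z| ≤ C) {f : ℝ → ℝ}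
    (hf : Continuous f) :
    TendstoUniformlyOn (fun j z => f (V j z)) (fun z => f (v z)) atTop K := by
  -- The continuity of `f` is uniform only on compact intervals; the approximants eventually take
  -- values in an interval larger by one than the range of `v`.
  refine UniformContinuousOn.comp_tendstoUniformlyOn_eventually (s := Icc (-(C + 1)) (C + 1))
    ?_ ?_ (isCompact_Icc.uniformContinuousOn_of_continuous hf.continuousOn) hV
  · filter_upwards [Metric.tendstoUniformlyOn_iff.1 hV 1 one_pos] with j hj z hz
    have h1 := abs_le.1 (hC z hz)
    have h2 := abs_lt.1 (hj z hz)
    constructor <;> linarith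
  · intro z hz
    have h1 := abs_le.1 (hC z hz)
    constructor <;> linarith

open scoped Manifold in
lemma exists_cutoff {V : Type*} [NormedAddCommGroup V] [NormedSpace ℝ V] [FiniteDimensional ℝ V]
    {K U : Set V} (hK : IsCompact K) (hU : IsOpen U) (hKU : K ⊆ U) :
    ∃ (θ : V → ℝ) (K' : Set V), IsCompact K' ∧ K ⊆ K' ∧ K' ⊆ U ∧ ContDiff ℝ (⊤ : ℕ∞) θ ∧
      (∀ z ∈ K, θ =ᶠ[𝓝 z] fun _ => 1) ∧ (∀ z, z ∉ K' → θ z = 0) ∧ ∀ z, θ z ∈ Icc (0 : ℝ) 1 := by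
  obtain ⟨δ, hδ, hδU⟩ := hK.exists_cthickening_subset_open hU hKU
  have hsub : K ⊆ interior (Metric.cthickening δ K) :=
    (Metric.self_subset_thickening hδ K).trans (Metric.thickening_subset_interior_cthickening δ K)
  obtain ⟨θ, h1, h2, h3⟩ := exists_contMDiffMap_one_nhds_of_subset_interior (n := (⊤ : ℕ∞)) 𝓘(ℝ, V)
    hK.isClosed hsub
  refine ⟨θ, Metric.cthickening δ K, hK.cthickening, Metric.self_subset_cthickening K, hδU,
    θ.contMDiff.contDiff, fun z hz => ?_, h2, h3⟩
  exact (Filter.eventually_of_mem (nhds_le_nhdsSet hz h1) fun x hx => hx)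

lemma spaceGrad_mul {φ χ : E n × ℝ → ℝ} (hφ : ContDiff ℝ 1 φ) (hχ : ContDiff ℝ 1 χ)
    (z : E n × ℝ) :
    spaceGrad (fun z => φ z * χ z) z = φ z • spaceGrad χ z + χ z • spaceGrad φ z := by
  have h1 := hφ.differentiable one_ne_zero z
  have h2 := hχ.differentiable one_ne_zero z
  rw [spaceGrad_eq (h1.fun_mul h2), spaceGrad_eq h1, spaceGrad_eq h2, fderiv_fun_mul h1 h2]
  simp

lemma contDiff_one_of_hasDerivAt {F f : ℝ → ℝ} (hF : ∀ s, HasDerivAt F (f s) s)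
    (hf : Continuous f) : ContDiff ℝ 1 F := by
  refine contDiff_one_iff_deriv.2 ⟨fun s => (hF s).differentiableAt, ?_⟩
  rwa [show deriv F = f from funext fun s => (hF s).deriv]

lemma spaceGrad_comp {φ : E n × ℝ → ℝ} (hφ : ContDiff ℝ 1 φ) {F f : ℝ → ℝ}
    (hF : ∀ s, HasDerivAt F (f s) s) (z : E n × ℝ) :
    spaceGrad (fun z => F (φ z)) z = f (φ z) • spaceGrad φ z := by
  have h1 := hφ.differentiable one_ne_zero z
  have h2 : HasFDerivAt (fun z => F (φ z)) (f (φ z) • fderiv ℝ φ z) z :=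
    (hF (φ z)).comp_hasFDerivAt z h1.hasFDerivAt
  rw [spaceGrad_eq h2.differentiableAt, spaceGrad_eq h1]
  refine (congrArg spacePart h2.fderiv).trans ?_
  simp

lemma deriv_eq_zero_of_lt {F f : ℝ → ℝ} (hF : ∀ s, HasDerivAt F (f s) s) {k : ℝ}
    (hF0 : ∀ s ≤ k, F s = 0) {s : ℝ} (hs : s < k) : f s = 0 := by
  have : F =ᶠ[𝓝 s] fun _ => 0 := by
    filter_upwards [Iio_mem_nhds hs] with x hx using hF0 x (le_of_lt hx)
  exact (hF s).unique ((hasDerivAt_const s (0 : ℝ)).congr_of_eventuallyEq this)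

/-- The truncation `F(v)`, multiplied by a cutoff function `c`, is a limit of `C¹` functions with
compact support if `{v ≥ k₁}` is compact in `U` on the support of `c`. -/
lemma exists_hasC1Approx {p : ℝ} (hp : 1 ≤ p) {U : Set (E n × ℝ)} (hU : IsOpen U)
    {v : E n × ℝ → ℝ} {G : E n × ℝ → E n} (hv : ContinuousOn v U) (hGm : StronglyMeasurable G)
    (hG : IsWeakSpaceGrad p U v G) {F f : ℝ → ℝ} (hF : ∀ s, HasDerivAt F (f s) s)
    (hf : Continuous f) {k k₁ : ℝ} (hk : k₁ < k) (hF0 : ∀ s ≤ k, F s = 0) {c : E n × ℝ → ℝ}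
    (hc : ContDiff ℝ 1 c) {K₁ : Set (E n × ℝ)} (hK₁ : IsCompact K₁) (hK₁U : K₁ ⊆ U)
    (hcK : ∀ z ∈ U, z ∈ tsupport c → k₁ ≤ v z → z ∈ K₁) :
    ∃ K ⊆ U, HasC1Approx p K (U.indicator fun z => F (v z) * c z)
      (U.indicator fun z => (c z * f (v z)) • G z + F (v z) • spaceGrad c z) := by
  have hp' : 1 ≤ ENNReal.ofReal p := by simpa using hp
  have hFc : Continuous F := continuous_iff_continuousAt.2 fun s => (hF s).continuousAt
  have hf0 : ∀ s < k, f s = 0 := fun s hs => deriv_eq_zero_of_lt hF hF0 hs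
  obtain ⟨θ, K, hK, hK₁K, hKU, hθ, hθ1, hθ0, hθI⟩ := exists_cutoff hK₁ hU hK₁U
  obtain ⟨V, hV1, hVv, hVG⟩ := exists_contDiff_approx hp hU hv hGm hG hK hKU
  have hθ' : ContDiff ℝ 1 θ := hθ.of_le (by exact_mod_cast le_top)
  have hvK := hv.mono hKU
  obtain ⟨C, hC⟩ := hK.exists_bound_of_continuousOn hvK
  -- The gap between `k₁` and `k` is spent here: once `V j` is this close to `v`, a nonzero `F (V j
  -- z)` forces `v z > k₁`.
  obtain ⟨j₀, hj₀⟩ := eventually_atTop.1 (Metric.tendstoUniformlyOn_iff.1 hVv (k - k₁) (by linarith))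
  have hclose : ∀ j ≥ j₀, ∀ z ∈ K, |v z - V j z| < k - k₁ := fun j hj z hz => hj₀ j hj z hz
  have hmem : ∀ z ∈ U, z ∈ tsupport c → k ≤ v z → z ∈ K₁ := fun z hz h1 h2 =>
    hcK z hz h1 (hk.le.trans h2)
  have hθone : ∀ z ∈ K₁, θ z = 1 := fun z hz => (hθ1 z hz).eq_of_nhds
  have hθgrad : ∀ z ∈ K₁, spaceGrad θ z = 0 := fun z hz => by
    rw [spaceGrad_eq (hθ'.differentiable one_ne_zero z), (hθ1 z hz).fderiv_eq]
    simp
  have hFV : ∀ j, ContDiff ℝ 1 fun z => F (V j z) := fun j =>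
    (contDiff_one_of_hasDerivAt hF hf).comp (hV1 j)
  have hψθ : ∀ z ∈ U, F (v z) * c z = θ z * (F (v z) * c z) := fun z hz => by
    by_cases h0 : F (v z) * c z = 0
    · simp [h0]
    · rw [hθone z (hmem z hz (subset_tsupport c (right_ne_zero_of_mul h0)) ?_), one_mul]
      by_contra h1
      exact left_ne_zero_of_mul h0 (hF0 _ (not_le.1 h1).le)
  have hΓθ : ∀ z ∈ U, (c z * f (v z)) • G z + F (v z) • spaceGrad c z
      = θ z • ((c z * f (v z)) • G z + F (v z) • spaceGrad c z) := fun z hz => by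
    by_cases h1 : z ∈ tsupport c
    · by_cases h2 : k ≤ v z
      · rw [hθone z (hmem z hz h1 h2), one_smul]
      · simp [hf0 _ (not_le.1 h2), hF0 _ (not_le.1 h2).le]
    · have h3 : spaceGrad c z = 0 := by
        by_contra h0; exact h1 (support_spaceGrad_subset hc h0)
      simp [image_eq_zero_of_notMem_tsupport h1, h3]
  -- The gradient of `θ` never contributes: a point of `K` where `F (V j z) * c z` is nonzero lies
  -- in `K₁`, near which `θ` is constant.
  have hgrad : ∀ j ≥ j₀, ∀ z, spaceGrad (fun z => θ z * (F (V j z) * c z)) z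
      = θ z • ((c z * f (V j z)) • spaceGrad (V j) z + F (V j z) • spaceGrad c z) := by
    intro j hj z
    rw [spaceGrad_mul hθ' ((hFV j).mul hc), spaceGrad_mul (hFV j) hc, spaceGrad_comp (hV1 j) hF]
    have : (F (V j z) * c z) • spaceGrad θ z = 0 := by
      by_cases hz : z ∈ K
      · by_cases h0 : F (V j z) * c z = 0
        · simp [h0]
        · rw [hθgrad z, smul_zero]
          have h1 : k < V j z := by
            by_contra h1
            exact left_ne_zero_of_mul h0 (hF0 _ (not_lt.1 h1))
          refine hcK z (hKU hz) (subset_tsupport c (right_ne_zero_of_mul h0)) ?_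
          have := (abs_lt.1 (hclose j hj z hz)).1
          linarith
      · by_cases h1 : spaceGrad θ z = 0
        · simp [h1]
        · refine absurd (closure_minimal (fun y hy => ?_) hK.isClosed
            (support_spaceGrad_subset hθ' h1)) hz
          by_contra hy'
          exact hy (hθ0 y hy')
    rw [this, add_zero, smul_smul (c z), add_comm]
  have hFu := tendstoUniformlyOn_comp_of_continuous hVv hC hFc
  have hfu := tendstoUniformlyOn_comp_of_continuous hVv hC hf
  have hmvf : AEStronglyMeasurable (fun z => f (v z)) (volume.restrict K) :=
    (hf.comp_continuousOn hvK).aestronglyMeasurable hK.measurableSet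
  have hmvF : AEStronglyMeasurable (fun z => F (v z)) (volume.restrict K) :=
    (hFc.comp_continuousOn hvK).aestronglyMeasurable hK.measurableSet
  have hsgc := continuous_spaceGrad hc
  refine ⟨K, hKU, hK, ?_, ?_, fun j z => θ z * (F (V (j + j₀) z) * c z),
    fun j => hθ'.mul ((hFV _).mul hc), ?_, ?_, ?_, ?_⟩
  · have h1 : StronglyMeasurable (U.indicator fun z => c z * f (v z)) :=
      (hc.continuous.continuousOn.mul
        (hf.comp_continuousOn hv)).stronglyMeasurable_indicator_of_measurableSet hU.measurableSet
    have h2 : StronglyMeasurable (U.indicator fun z => F (v z)) :=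
      (hFc.comp_continuousOn hv).stronglyMeasurable_indicator_of_measurableSet hU.measurableSet
    convert (h1.smul hGm).add (h2.smul hsgc.stronglyMeasurable) using 1
    ext1 z
    by_cases hz : z ∈ U <;> simp [hz]
  · intro z hz
    by_contra hzK
    refine hz ?_
    by_cases hzU : z ∈ U
    · rw [indicator_of_mem hzU, hΓθ z hzU, hθ0 z hzK, zero_smul]
    · simp [hzU]
  · intro j z hz
    by_contra hzK
    exact hz (by simp [hθ0 z hzK])
  · obtain ⟨CF, hCF⟩ := (isCompact_Icc (a := -(C + (k - k₁))) (b := C + (k - k₁))).exists_bound_of_continuousOn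
      hFc.continuousOn
    obtain ⟨Cc, hCc⟩ := hK.exists_bound_of_continuousOn hc.continuous.continuousOn
    refine ⟨|CF| * |Cc|, fun j z => ?_⟩
    by_cases hz : z ∈ K
    · rw [norm_mul, norm_mul]
      have h1 := abs_le.1 (hC z hz)
      have h2 := abs_lt.1 (hclose (j + j₀) (by omega) z hz)
      have h3 := hCF (V (j + j₀) z) ⟨by linarith, by linarith⟩
      have h4 : ‖θ z‖ ≤ 1 := by
        rw [Real.norm_of_nonneg (hθI z).1]; exact (hθI z).2
      calc ‖θ z‖ * (‖F (V (j + j₀) z)‖ * ‖c z‖) ≤ 1 * (|CF| * |Cc|) := by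
            gcongr
            · exact h3.trans (le_abs_self _)
            · exact (hCc z hz).trans (le_abs_self _)
        _ = _ := one_mul _
    · simp only [hθ0 z hz, zero_mul, norm_zero]; positivity
  · intro z
    by_cases hz : z ∈ K
    · rw [indicator_of_mem (hKU hz), hψθ z (hKU hz)]
      exact (((tendsto_add_atTop_iff_nat j₀).2 (hFu.tendsto_at hz)).mul_const _).const_mul _
    · have : (U.indicator fun z => F (v z) * c z) z = 0 := by
        by_cases hzU : z ∈ U
        · rw [indicator_of_mem hzU, hψθ z hzU, hθ0 z hz, zero_mul]
        · simp [hzU]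
      simp [this, hθ0 z hz]
  · have hGK := hG.memLp_grad K hKU hK
    have hfin : IsFiniteMeasure (volume.restrict K) := ⟨by simpa using hK.measure_lt_top⟩
    obtain ⟨Cc, hCc⟩ := hK.exists_bound_of_continuousOn hc.continuous.continuousOn
    have huni : ∀ (g : ℝ → ℝ), Continuous g →
        ∀ ε > 0, ∀ᶠ j in atTop, ∀ z ∈ K, |θ z * (g (V (j + j₀) z) - g (v z))| ≤ ε := by
      intro g hg ε hε
      have h1 := Metric.tendstoUniformlyOn_iff.1 (tendstoUniformlyOn_comp_of_continuous hVv hC hg)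
        ε hε
      filter_upwards [(tendsto_add_atTop_nat j₀).eventually h1] with j hj z hz
      rw [abs_mul, abs_of_nonneg (hθI z).1, ← Real.dist_eq, dist_comm]
      exact (mul_le_of_le_one_left dist_nonneg (hθI z).2).trans (hj z hz).le
    obtain ⟨Cf, hCf⟩ := (isCompact_Icc (a := -(C + (k - k₁))) (b := C + (k - k₁))).exists_bound_of_continuousOn
      hf.continuousOn
    have hT1 : Tendsto (fun j => eLpNorm (fun z => (θ z * (c z * f (V (j + j₀) z))) •
        (spaceGrad (V (j + j₀)) z - G z)) (ENNReal.ofReal p) (volume.restrict K)) atTop (𝓝 0) := by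
      have h0 : Tendsto (fun j => ENNReal.ofReal (|Cc| * |Cf|) *
          eLpNorm (fun z => spaceGrad (V (j + j₀)) z - G z) (ENNReal.ofReal p) (volume.restrict K))
          atTop (𝓝 0) := by
        have := ENNReal.Tendsto.const_mul (a := ENNReal.ofReal (|Cc| * |Cf|))
          ((tendsto_add_atTop_iff_nat j₀).2 hVG) (Or.inr ENNReal.ofReal_ne_top)
        simpa using this
      refine tendsto_of_tendsto_of_tendsto_of_le_of_le tendsto_const_nhds h0 (fun _ => zero_le)
        fun j => ?_
      refine eLpNorm_le_mul_eLpNorm_of_ae_le_mul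
        ((ae_restrict_iff' hK.measurableSet).2 (ae_of_all _ fun z hz => ?_)) _
      rw [norm_smul, norm_mul, norm_mul]
      have h1 := abs_le.1 (hC z hz)
      have h2 := abs_lt.1 (hclose (j + j₀) (by omega) z hz)
      have h3 := hCf (V (j + j₀) z) ⟨by linarith, by linarith⟩
      have h4 : ‖θ z‖ ≤ 1 := by
        rw [Real.norm_of_nonneg (hθI z).1]; exact (hθI z).2
      refine mul_le_mul_of_nonneg_right ?_ (norm_nonneg _)
      calc ‖θ z‖ * (‖c z‖ * ‖f (V (j + j₀) z)‖) ≤ 1 * (|Cc| * |Cf|) := by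
            gcongr
            · exact (hCc z hz).trans (le_abs_self _)
            · exact h3.trans (le_abs_self _)
        _ = _ := one_mul _
    have hT2 := tendsto_eLpNorm_smul_of_uniform hK.measurableSet (huni f hf)
      (w := fun z => c z • G z) (p := ENNReal.ofReal p) (μ := volume) (by
        have hcb : MemLp c ∞ (volume.restrict K) := memLp_top_of_bound
          hc.continuous.aestronglyMeasurable Cc
          ((ae_restrict_iff' hK.measurableSet).2 (ae_of_all _ hCc))
        exact hGK.smul hcb)
    have hT3 := tendsto_eLpNorm_smul_of_uniform hK.measurableSet (huni F hFc)
      (w := spaceGrad c) (p := ENNReal.ofReal p) (μ := volume)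
      (by
        obtain ⟨Cs, hCs⟩ := hK.exists_bound_of_continuousOn hsgc.continuousOn
        exact MemLp.of_bound hsgc.aestronglyMeasurable Cs
          ((ae_restrict_iff' hK.measurableSet).2 (ae_of_all _ hCs)))
    have hsum := (hT1.add hT2).add hT3
    simp only [add_zero] at hsum
    refine tendsto_of_tendsto_of_tendsto_of_le_of_le tendsto_const_nhds hsum (fun _ => zero_le)
      fun j => ?_
    have hVj := (hV1 (j + j₀)).continuous
    have hsV := continuous_spaceGrad (hV1 (j + j₀))
    -- The error splits into a bounded factor times the gradient error and two uniformly small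
    -- factors times fixed `L^p` functions.
    have heq : spaceGrad (fun z => θ z * (F (V (j + j₀) z) * c z)) -
        (U.indicator fun z => (c z * f (v z)) • G z + F (v z) • spaceGrad c z)
        = K.indicator (((fun z => (θ z * (c z * f (V (j + j₀) z))) •
            (spaceGrad (V (j + j₀)) z - G z))
          + (fun z => (θ z * (f (V (j + j₀) z) - f (v z))) • (c z • G z)))
          + (fun z => (θ z * (F (V (j + j₀) z) - F (v z))) • spaceGrad c z)) := by
      ext1 z
      rw [Pi.sub_apply, hgrad (j + j₀) (by omega) z]
      by_cases hz : z ∈ K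
      · rw [indicator_of_mem (hKU hz), indicator_of_mem hz, hΓθ z (hKU hz)]
        simp only [Pi.add_apply]
        module
      · rw [indicator_of_notMem hz]
        by_cases hzU : z ∈ U
        · rw [indicator_of_mem hzU, hΓθ z hzU]; simp [hθ0 z hz]
        · simp [hzU, hθ0 z hz]
    rw [heq, eLpNorm_indicator_eq_eLpNorm_restrict hK.measurableSet]
    have hθc := hθ'.continuous.aestronglyMeasurable (μ := volume.restrict K)
    have hcc := hc.continuous.aestronglyMeasurable (μ := volume.restrict K)
    have m1 : AEStronglyMeasurable (fun z => (θ z * (c z * f (V (j + j₀) z))) •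
        (spaceGrad (V (j + j₀)) z - G z)) (volume.restrict K) :=
      (hθc.mul (hcc.mul (hf.comp hVj).aestronglyMeasurable)).smul
        (hsV.aestronglyMeasurable.sub hGm.aestronglyMeasurable)
    have m2 : AEStronglyMeasurable (fun z => (θ z * (f (V (j + j₀) z) - f (v z))) • (c z • G z))
        (volume.restrict K) :=
      (hθc.mul ((hf.comp hVj).aestronglyMeasurable.sub hmvf)).smul
        (hcc.smul hGm.aestronglyMeasurable)
    have m3 : AEStronglyMeasurable (fun z => (θ z * (F (V (j + j₀) z) - F (v z))) • spaceGrad c z)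
        (volume.restrict K) :=
      (hθc.mul ((hFc.comp hVj).aestronglyMeasurable.sub hmvF)).smul hsgc.aestronglyMeasurable
    refine (eLpNorm_add_le (m1.add m2) m3 hp').trans (add_le_add_left ?_ _)
    exact eLpNorm_add_le m1 m2 hp'

end

/-! ### The energy of a truncation and the one-sided chain rule in time. -/

section

variable {n : ℕ}

/-! ### The primitive `∫ f(σ) (β(s) - β(σ)) dσ` -/

/-- The primitive of `F dβ`, where `F` is the primitive of `f` that vanishes at `k`. -/
def jumpPrimitive (f β : ℝ → ℝ) (k s : ℝ) : ℝ := ∫ σ in k..s, f σ * (β s - β σ)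

section Primitive

variable {f β : ℝ → ℝ}

lemma intervalIntegrable_mul_monotone (hf : Continuous f) (hβ : Monotone β) (c a b : ℝ) :
    IntervalIntegrable (fun σ => f σ * (c - β σ)) volume a b :=
  (intervalIntegrable_const.sub hβ.intervalIntegrable).continuousOn_mul hf.continuousOn

/-- The factor `β a - β σ` changes sign together with the orientation of the integral, so `a` and
`b` need not be ordered. -/
lemma integral_mul_sub_nonneg (hf0 : ∀ s, 0 ≤ f s) (hβ : Monotone β) (a b : ℝ) :
    0 ≤ ∫ σ in b..a, f σ * (β a - β σ) := by
  rcases le_total b a with h | h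
  · refine intervalIntegral.integral_nonneg h fun σ hσ => ?_
    exact mul_nonneg (hf0 σ) (sub_nonneg.2 (hβ hσ.2))
  · rw [intervalIntegral.integral_symm, ← intervalIntegral.integral_neg]
    refine intervalIntegral.integral_nonneg h fun σ hσ => ?_
    have := mul_nonneg (hf0 σ) (sub_nonneg.2 (hβ hσ.1))
    linarith

lemma jumpPrimitive_nonneg (hf0 : ∀ s, 0 ≤ f s) (hβ : Monotone β) (k s : ℝ) :
    0 ≤ jumpPrimitive f β k s := integral_mul_sub_nonneg hf0 hβ s k

variable {F : ℝ → ℝ}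

lemma integral_eq_primitive (hF : ∀ s, HasDerivAt F (f s) s) (hf : Continuous f) (a b : ℝ) :
    ∫ σ in a..b, f σ = F b - F a :=
  intervalIntegral.integral_eq_sub_of_hasDerivAt (fun s _ => hF s) (hf.intervalIntegrable _ _)

/-- The chain rule `F(v) ∂ₜβ(v) = ∂ₜ ∫ F dβ` as a convexity inequality: the difference of the two
sides is `∫ σ in b..a, f σ * (β a - β σ)`, which is nonnegative. Only monotonicity of `β` enters, so
the steepness of the regularized jump plays no role. -/
lemma mul_sub_le_jumpPrimitive_sub (hF : ∀ s, HasDerivAt F (f s) s) (hf : Continuous f)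
    (hf0 : ∀ s, 0 ≤ f s) (hβ : Monotone β) {k : ℝ} (hFk : F k = 0) (a b : ℝ) :
    F b * (β a - β b) ≤ jumpPrimitive f β k a - jumpPrimitive f β k b := by
  have h1 := integral_mul_sub_nonneg hf0 hβ a b
  have hadd := intervalIntegral.integral_add_adjacent_intervals
    (intervalIntegrable_mul_monotone hf hβ (β a) k b)
    (intervalIntegrable_mul_monotone hf hβ (β a) b a)
  have h2 : ∫ σ in k..b, f σ * (β a - β σ)
      = (∫ σ in k..b, f σ * (β b - β σ)) + F b * (β a - β b) := by
    have h3 : ∫ σ in k..b, f σ * (β a - β b) = F b * (β a - β b) := by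
      rw [intervalIntegral.integral_mul_const, integral_eq_primitive hF hf, hFk, sub_zero]
    rw [← h3, ← intervalIntegral.integral_add (intervalIntegrable_mul_monotone hf hβ _ _ _)
      ((by fun_prop : Continuous fun σ => f σ * (β a - β b)).intervalIntegrable _ _)]
    congr 1; ext1 σ; ring
  unfold jumpPrimitive
  linarith

lemma jumpPrimitive_self (k : ℝ) : jumpPrimitive f β k k = 0 := by
  simp [jumpPrimitive]

lemma jumpPrimitive_le (hF : ∀ s, HasDerivAt F (f s) s) (hf : Continuous f)
    (hf0 : ∀ s, 0 ≤ f s) (hβ : Monotone β) {k : ℝ} (hFk : F k = 0) (b : ℝ) :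
    jumpPrimitive f β k b ≤ F b * (β b - β k) := by
  have := mul_sub_le_jumpPrimitive_sub hF hf hf0 hβ hFk k b
  rw [jumpPrimitive_self] at this
  linarith

lemma monotone_of_hasDerivAt_nonneg (hF : ∀ s, HasDerivAt F (f s) s) (hf0 : ∀ s, 0 ≤ f s) :
    Monotone F :=
  monotone_of_deriv_nonneg (fun s => (hF s).differentiableAt) fun s => by
    rw [(hF s).deriv]; exact hf0 s

/-- Expanding the product leaves `F β`, measurable because `β` is monotone, and a continuous
primitive. -/
lemma measurable_jumpPrimitive (hF : ∀ s, HasDerivAt F (f s) s) (hf : Continuous f)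
    (hβ : Monotone β) {k : ℝ} (hFk : F k = 0) : Measurable (jumpPrimitive f β k) := by
  have hFc : Continuous F := continuous_iff_continuousAt.2 fun s => (hF s).continuousAt
  have hi : ∀ a b, IntervalIntegrable (fun σ => f σ * β σ) volume a b := fun a b =>
    hβ.intervalIntegrable.continuousOn_mul hf.continuousOn
  have h : jumpPrimitive f β k = fun s => F s * β s - ∫ σ in k..s, f σ * β σ := by
    ext1 s
    have h3 : ∫ σ in k..s, f σ * β s = F s * β s := by
      rw [intervalIntegral.integral_mul_const, integral_eq_primitive hF hf, hFk, sub_zero]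
    rw [← h3, ← intervalIntegral.integral_sub
      ((by fun_prop : Continuous fun σ => f σ * β s).intervalIntegrable _ _) (hi _ _)]
    simp only [jumpPrimitive, mul_sub]
  rw [h]
  exact (hFc.measurable.mul hβ.measurable).sub
    (intervalIntegral.continuous_primitive hi k).measurable

/-- The energy is linear in `β` and nonnegative for the increasing function `β - id`. This is how
the jump disappears from the estimates. -/
lemma jumpPrimitive_id_le (hf : Continuous f) (hf0 : ∀ s, 0 ≤ f s)
    (hβ : Monotone fun s => β s - s) (hβ' : Monotone β) (k s : ℝ) :
    jumpPrimitive f id k s ≤ jumpPrimitive f β k s := by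
  have h1 := integral_mul_sub_nonneg hf0 hβ s k
  have h2 : ∫ σ in k..s, f σ * (β s - s - (β σ - σ))
      = jumpPrimitive f β k s - jumpPrimitive f id k s := by
    rw [jumpPrimitive, jumpPrimitive, ← intervalIntegral.integral_sub
      (intervalIntegrable_mul_monotone hf hβ' _ _ _)
      (intervalIntegrable_mul_monotone hf monotone_id _ _ _)]
    congr 1; ext1 σ; simp only [id]; ring
  rw [h2] at h1; linarith

lemma continuous_jumpPrimitive_id (hF : ∀ s, HasDerivAt F (f s) s) (hf : Continuous f)
    {k : ℝ} (hFk : F k = 0) : Continuous (jumpPrimitive f id k) := by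
  have hFc : Continuous F := continuous_iff_continuousAt.2 fun s => (hF s).continuousAt
  have h : jumpPrimitive f id k = fun s => F s * s - ∫ σ in k..s, f σ * σ := by
    ext1 s
    have h3 : ∫ σ in k..s, f σ * s = F s * s := by
      rw [intervalIntegral.integral_mul_const, integral_eq_primitive hF hf, hFk, sub_zero]
    rw [← h3, ← intervalIntegral.integral_sub
      ((by fun_prop : Continuous fun σ => f σ * s).intervalIntegrable _ _)
      ((by fun_prop : Continuous fun σ => f σ * σ).intervalIntegrable _ _)]
    simp only [jumpPrimitive, mul_sub, id]
  rw [h]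
  exact (hFc.mul continuous_id).sub (intervalIntegral.continuous_primitive
    (fun a b => (hf.mul continuous_id).intervalIntegrable a b) k)

lemma monotoneOn_jumpPrimitive_id (hF : ∀ s, HasDerivAt F (f s) s) (hf : Continuous f)
    (hf0 : ∀ s, 0 ≤ f s) {k : ℝ} (hFk : F k = 0) : MonotoneOn (jumpPrimitive f id k) (Ici k) := by
  intro a ha b hb hab
  have := mul_sub_le_jumpPrimitive_sub hF hf hf0 monotone_id hFk b a
  have h2 : 0 ≤ F a := hFk ▸ monotone_of_hasDerivAt_nonneg hF hf0 ha
  have h3 := mul_nonneg h2 (sub_nonneg.2 hab)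
  simp only [id] at this
  linarith

end Primitive

/-! ### The one-sided energy inequality -/

lemma abs_sub_le_of_deriv_bound {χ χ' : ℝ → ℝ} (hχ : ∀ t, HasDerivAt χ (χ' t) t) {L : ℝ}
    (hL : ∀ t, |χ' t| ≤ L) (a b : ℝ) : |χ b - χ a| ≤ L * |b - a| := by
  have := Convex.norm_image_sub_le_of_norm_hasDerivWithin_le (s := univ) (f := χ) (f' := χ')
    (x := a) (y := b) (C := L) (fun x _ => (hχ x).hasDerivWithinAt) (fun x _ => hL x)
    convex_univ (mem_univ _) (mem_univ _)
  simpa using this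

/-- Testing the equation with `F(v) η χ`: the flux term is controlled by the energy. -/
lemma integral_flux_le {p p' : ℝ} (hpp : p'.HolderConjugate p) {U K : Set (E n × ℝ)}
    {v : E n × ℝ → ℝ} {a Γ : E n × ℝ → E n} {β : ℝ → ℝ} (hβ : Monotone β)
    (hU : IsOpen U) (hUf : volume U ≠ ∞) (hv : ContinuousOn v U) {C : ℝ} (hC : ∀ z ∈ U, |v z| ≤ C)
    (ha : ∀ K ⊆ U, IsCompact K → MemLp a (ENNReal.ofReal p') (volume.restrict K))
    (hweak : ∀ φ, IsTest U φ → weakForm U (fun z => β (v z)) a φ = 0)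
    {F f : ℝ → ℝ} (hF : ∀ s, HasDerivAt F (f s) s) (hf : Continuous f) (hf0 : ∀ s, 0 ≤ f s)
    {k : ℝ} (hFk : F k = 0) {η : E n → ℝ} (hη : Continuous η) (hη0 : ∀ x, η x ∈ Icc (0 : ℝ) 1)
    {χ χ' : ℝ → ℝ} (hχ : ∀ t, HasDerivAt χ (χ' t) t) {L : ℝ}
    (hL : ∀ t, |χ' t| ≤ L) (hχ0 : ∀ t, χ t ∈ Icc (0 : ℝ) 1) (hFv : ∀ s, 0 ≤ F s) (hKU : K ⊆ U)
    (h : HasC1Approx p K (U.indicator fun z => F (v z) * (η z.1 * χ z.2)) Γ) :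
    ∫ z in U, inner ℝ (a z) (Γ z)
      ≤ ∫ z in U, jumpPrimitive f β k (v z) * η z.1 * χ' z.2 := by
  have hUfin : IsFiniteMeasure (volume.restrict U) := ⟨by simpa using hUf.lt_top⟩
  have hvm : AEMeasurable v (volume.restrict U) := hv.aemeasurable hU.measurableSet
  have hFm := monotone_of_hasDerivAt_nonneg hF hf0
  have hB : IntegrableOn (fun z => β (v z)) U := by
    refine Integrable.of_bound (hβ.measurable.comp_aemeasurable hvm).aestronglyMeasurable
      (max |β C| |β (-C)|) ((ae_restrict_iff' hU.measurableSet).2 (ae_of_all _ fun z hz => ?_))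
    have h1 := abs_le.1 (hC z hz)
    have h2 := hβ h1.1
    have h3 := hβ h1.2
    rw [Real.norm_eq_abs, abs_le]
    have h4 := le_abs_self (β C)
    have h5 := neg_abs_le (β (-C))
    constructor
    · have := le_max_right |β C| |β (-C)|; linarith
    · have := le_max_left |β C| |β (-C)|; linarith
  have hlim := tendsto_integral_diffQuot hpp hU hB ha hweak h hKU
  set P : E n × ℝ → ℝ := U.indicator fun z => jumpPrimitive f β k (v z) * η z.1 with hP
  have hP0 : ∀ z, 0 ≤ P z := fun z => indicator_nonneg (fun z _ =>
    mul_nonneg (jumpPrimitive_nonneg hf0 hβ k _) (hη0 _).1) z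
  set CP := F C * (β (max C k) - β k) with hCP
  have hPi : Integrable P := by
    rw [hP, integrable_indicator_iff hU.measurableSet]
    have hm : AEStronglyMeasurable (fun z : E n × ℝ => jumpPrimitive f β k (v z) * η z.1)
        (volume.restrict U) :=
      ((measurable_jumpPrimitive hF hf hβ hFk).comp_aemeasurable hvm).aestronglyMeasurable.mul
        (hη.comp continuous_fst).aestronglyMeasurable
    refine Integrable.of_bound hm CP
      ((ae_restrict_iff' hU.measurableSet).2 (ae_of_all _ fun z hz => ?_))
    have h1 := jumpPrimitive_nonneg hf0 hβ k (v z)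
    rw [norm_mul, Real.norm_of_nonneg h1, Real.norm_of_nonneg (hη0 _).1]
    refine (mul_le_of_le_one_right h1 (hη0 _).2).trans
      ((jumpPrimitive_le hF hf hf0 hβ hFk (v z)).trans ?_)
    have h2 := abs_le.1 (hC z hz)
    have h3 : β k ≤ β (max C k) := hβ (le_max_right _ _)
    rcases le_total (β k) (β (v z)) with h4 | h4
    · exact mul_le_mul (hFm h2.2) (sub_le_sub_right (hβ (h2.2.trans (le_max_left _ _))) _)
        (sub_nonneg.2 h4) (hFv C)
    · exact (mul_nonpos_of_nonneg_of_nonpos (hFv _) (sub_nonpos.2 h4)).trans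
        (mul_nonneg (hFv C) (sub_nonneg.2 h3))
  have hχcont : Continuous χ := continuous_iff_continuousAt.2 fun t => (hχ t).continuousAt
  have hlim2 : Tendsto (fun s : ℝ => ∫ z, P z * (s⁻¹ * (χ (z.2 + s) - χ z.2))) (𝓝[>] 0)
      (𝓝 (∫ z, P z * χ' z.2)) := by
    refine tendsto_integral_filter_of_dominated_convergence (fun z => P z * L) ?_ ?_
      (hPi.mul_const L) (ae_of_all _ fun z => ?_)
    · refine Eventually.of_forall fun s => hPi.aestronglyMeasurable.mul ?_
      exact Continuous.aestronglyMeasurable (by fun_prop)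
    · filter_upwards [self_mem_nhdsWithin] with s hs
      refine ae_of_all _ fun z => ?_
      have hs' : 0 < s := hs
      rw [norm_mul, Real.norm_of_nonneg (hP0 z), norm_mul, Real.norm_of_nonneg (inv_nonneg.2 hs'.le)]
      refine mul_le_mul_of_nonneg_left ?_ (hP0 z)
      have h1 := abs_sub_le_of_deriv_bound hχ hL z.2 (z.2 + s)
      rw [add_sub_cancel_left, abs_of_pos hs'] at h1
      rw [inv_mul_le_iff₀ hs', mul_comm s]
      exact h1
    · refine Tendsto.const_mul _ ?_
      have h1 := ((hχ z.2).tendsto_slope_zero_right)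
      simpa using h1
  have heq : ∫ z, P z * χ' z.2 = ∫ z in U, jumpPrimitive f β k (v z) * η z.1 * χ' z.2 := by
    rw [← integral_indicator hU.measurableSet]
    congr 1; ext1 z
    by_cases hz : z ∈ U <;> simp [hP, hz]
  rw [← heq]
  refine le_of_tendsto_of_tendsto hlim hlim2 ?_
  obtain ⟨δ, hδ, hδU⟩ := h.isCompact.exists_cthickening_subset_open hU hKU
  filter_upwards [Ioo_mem_nhdsGT hδ] with s hs
  obtain ⟨Cψ, hCψ⟩ := h.exists_bound
  set ψ := U.indicator fun z : E n × ℝ => F (v z) * (η z.1 * χ z.2) with hψ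
  set Bh := U.indicator fun z => β (v z) with hBh
  have hBi : Integrable Bh := (integrable_indicator_iff hU.measurableSet).2 hB
  have hshift : ∀ {g : E n × ℝ → ℝ}, Integrable g →
      Integrable fun z : E n × ℝ => g (z.1, z.2 - s) := by
    intro g hg
    have := hg.comp_sub_right ((0 : E n), s)
    refine this.congr (ae_of_all _ fun z => ?_)
    have : z - ((0 : E n), s) = (z.1, z.2 - s) := by ext <;> simp
    simp only [this]
  have hχb : ∀ t, ‖χ t‖ ≤ 1 := fun t => by
    rw [Real.norm_of_nonneg (hχ0 t).1]; exact (hχ0 t).2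
  have hχm : AEStronglyMeasurable (fun z : E n × ℝ => χ z.2) volume :=
    (hχcont.comp continuous_snd).aestronglyMeasurable
  have hχsm : AEStronglyMeasurable (fun z : E n × ℝ => χ (z.2 + s)) volume :=
    (hχcont.comp (by fun_prop : Continuous fun z : E n × ℝ => z.2 + s)).aestronglyMeasurable
  -- Discrete integration by parts in time; there are no boundary terms because `P` is extended by
  -- zero.
  have e2 : ∫ z : E n × ℝ, P z * χ (z.2 + s) = ∫ z : E n × ℝ, P (z.1, z.2 - s) * χ z.2 := by
    rw [← integral_sub_right_eq_self _ ((0 : E n), s)]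
    congr 1; ext1 z
    have : z - ((0 : E n), s) = (z.1, z.2 - s) := by ext <;> simp
    rw [this]
    simp
  have e3 : ∫ z, P z * (s⁻¹ * (χ (z.2 + s) - χ z.2))
      = ∫ z, s⁻¹ * (χ z.2 * (P (z.1, z.2 - s) - P z)) := by
    have e4 : ∫ z, P z * (s⁻¹ * (χ (z.2 + s) - χ z.2))
        = ∫ z, s⁻¹ * (P z * χ (z.2 + s) - P z * χ z.2) := by
      congr 1; ext1 z; ring
    rw [e4, integral_const_mul, integral_sub, e2, ← integral_sub, ← integral_const_mul]
    · congr 1; ext1 z; ring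
    · exact (hshift hPi).mul_bdd hχm (ae_of_all _ fun z => hχb _)
    · exact hPi.mul_bdd hχm (ae_of_all _ fun z => hχb _)
    · exact hPi.mul_bdd hχsm (ae_of_all _ fun z => hχb _)
    · exact hPi.mul_bdd hχm (ae_of_all _ fun z => hχb _)
  rw [e3]
  refine integral_mono ?_ ?_ fun z => ?_
  · exact (((hshift hBi).sub hBi).const_mul s⁻¹).bdd_mul h.measurable.aestronglyMeasurable
      (ae_of_all _ hCψ)
  · exact (((hshift hPi).sub hPi).bdd_mul hχm (ae_of_all _ fun z => hχb _)).const_mul _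
  · have hs' : 0 ≤ s⁻¹ := inv_nonneg.2 hs.1.le
    -- Where `ψ` is nonzero, `s < δ` keeps the earlier point in `U` and the convexity inequality
    -- applies. Where `ψ` vanishes, either `P z = 0` and the right side is nonnegative, or `χ`
    -- vanishes.
    have key : ψ z * (Bh (z.1, z.2 - s) - Bh z) ≤ χ z.2 * (P (z.1, z.2 - s) - P z) := by
      by_cases hψz : ψ z = 0
      · rw [hψz, zero_mul]
        by_cases hPz : P z = 0
        · rw [hPz, sub_zero]; exact mul_nonneg (hχ0 _).1 (hP0 _)
        · have hzU : z ∈ U := by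
            by_contra hzU; exact hPz (by simp [hP, hzU])
          rw [hψ, indicator_of_mem hzU] at hψz
          rw [hP, indicator_of_mem hzU] at hPz
          have h1 : F (v z) ≠ 0 := by
            intro h0
            refine left_ne_zero_of_mul hPz (le_antisymm ?_ (jumpPrimitive_nonneg hf0 hβ _ _))
            have := jumpPrimitive_le hF hf hf0 hβ hFk (v z)
            rwa [h0, zero_mul] at this
          have h2 : χ z.2 = 0 := by
            by_contra h0
            exact mul_ne_zero h1 (mul_ne_zero (right_ne_zero_of_mul hPz) h0) hψz
          rw [h2, zero_mul]
      · have hzK : z ∈ K := h.support_subset hψz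
        have hzU : z ∈ U := hKU hzK
        have hzU' : (z.1, z.2 - s) ∈ U := by
          refine hδU (Metric.closedBall_subset_cthickening hzK δ ?_)
          rw [Metric.mem_closedBall, Prod.dist_eq]
          simp [hδ.le, abs_of_pos hs.1, hs.2.le]
        have hcv := mul_sub_le_jumpPrimitive_sub hF hf hf0 hβ hFk (v (z.1, z.2 - s)) (v z)
        simp only [hψ, hBh, hP, indicator_of_mem hzU, indicator_of_mem hzU']
        have h3 := mul_le_mul_of_nonneg_left hcv (mul_nonneg (hη0 z.1).1 (hχ0 z.2).1)
        calc _ = η z.1 * χ z.2 * (F (v z) * (β (v (z.1, z.2 - s)) - β (v z))) := by ring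
          _ ≤ _ := h3
          _ = _ := by ring
    calc ψ z * (s⁻¹ * (Bh (z.1, z.2 - s) - Bh z))
        = s⁻¹ * (ψ z * (Bh (z.1, z.2 - s) - Bh z)) := by ring
      _ ≤ _ := mul_le_mul_of_nonneg_left key hs'

end

/-! ### The Caccioppoli inequality up to the initial and lateral boundary. -/

section

variable {n : ℕ}

/-! ### The Caccioppoli inequality -/

/-- A bounded solution in `D × (0, τ)` of `∂ₜ β(v) - div a = 0`, with `p`-growth and `p`-coercivity,
whose superlevel sets above `k₀` stay away from the parabolic boundary inside `B_r(x₀)`. -/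
structure SolutionData (p Λ : ℝ) (D : Set (E n)) (τ : ℝ) (x₀ : E n) (r k₀ M : ℝ) (β : ℝ → ℝ)
    (v : E n × ℝ → ℝ) (G a : E n × ℝ → E n) : Prop where
  isOpen : IsOpen D
  finite : volume D ≠ ∞
  cont : ContinuousOn v (D ×ˢ Ioo 0 τ)
  bdd : ∃ C, ∀ z ∈ D ×ˢ Ioo 0 τ, |v z| ≤ C
  le_sup : ∀ z ∈ D ×ˢ Ioo 0 τ, v z ≤ M
  grad : IsWeakSpaceGrad p (D ×ˢ Ioo 0 τ) v G
  grad_meas : StronglyMeasurable G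
  flux_meas : AEStronglyMeasurable a (volume.restrict (D ×ˢ Ioo 0 τ))
  growth : ∀ᵐ z ∂(volume.restrict (D ×ˢ Ioo 0 τ)), ‖a z‖ ≤ Λ * ‖G z‖ ^ (p - 1)
  coercive : ∀ᵐ z ∂(volume.restrict (D ×ˢ Ioo 0 τ)), Λ⁻¹ * ‖G z‖ ^ p ≤ inner ℝ (a z) (G z)
  weak : ∀ φ, IsTest (D ×ˢ Ioo 0 τ) φ → weakForm (D ×ˢ Ioo 0 τ) (fun z => β (v z)) a φ = 0
  mono : Monotone fun s => β s - s
  compact_superlevel : ∀ S ⊆ Metric.ball x₀ r, IsCompact S → ∀ t₂ < τ, ∀ k₁ > k₀,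
    ∃ K₁ ⊆ D ×ˢ Ioo 0 τ, IsCompact K₁ ∧
      ∀ z ∈ D ×ˢ Ioo 0 τ, z.1 ∈ S → z.2 ≤ t₂ → k₁ ≤ v z → z ∈ K₁

/-- The absorption step of the Caccioppoli inequality. -/
lemma young_absorb {p Λ N L X F f ζ : ℝ} {m : ℕ} (hp : 2 ≤ p) (hΛ : 1 ≤ Λ) (hN : 0 ≤ N)
    (hL : 0 ≤ L) (hX : 0 ≤ X) (hF : 0 ≤ F) (hf : 0 ≤ f) (hζ : ζ ∈ Icc (0 : ℝ) 1) (hm : p ≤ m)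
    (h : F ^ p ≤ N * f ^ (p - 1)) :
    F * (Λ * X ^ (p - 1)) * (m * ζ ^ (m - 1) * L)
      ≤ (2 * Λ)⁻¹ * (f * X ^ p * ζ ^ m) + (Λ * m) ^ p * (2 * Λ) ^ (p - 1) * N * L ^ p := by
  set y := F * (Λ * X ^ (p - 1)) * (m * ζ ^ (m - 1) * L) with hy
  set Y := f * X ^ p * ζ ^ m with hY
  have hΛ0 : 0 < Λ := by linarith
  have hm0 : (0 : ℝ) ≤ m := m.cast_nonneg
  have hm1 : 1 ≤ m := by
    have : (1 : ℝ) ≤ m := by linarith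
    exact_mod_cast this
  have hζ0 := hζ.1
  have hY0 : 0 ≤ Y := by positivity
  have hy0 : 0 ≤ y := by positivity
  have hR : 0 ≤ (Λ * m) ^ p * (2 * Λ) ^ (p - 1) * N * L ^ p := by positivity
  -- A dichotomy in place of Young's inequality: either the energy term already dominates `y`, or `Y
  -- ≤ 2 * Λ * y`, and then a power of `y` cancels from the bound for `y ^ p`.
  by_cases hle : y ≤ (2 * Λ)⁻¹ * Y
  · linarith
  push Not at hle
  have hypos : 0 < y := lt_of_le_of_lt (by positivity) hle
  have hYy : Y ≤ 2 * Λ * y := by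
    have := (mul_lt_mul_of_pos_left hle (by positivity : 0 < 2 * Λ)).le
    rwa [← mul_assoc, mul_inv_cancel₀ (by positivity), one_mul] at this
  have hkey : y ^ p ≤ (Λ * m) ^ p * L ^ p * N * Y ^ (p - 1) := by
    have e1 : y = (F * (X ^ (p - 1) * ζ ^ (m - 1))) * (Λ * m * L) := by rw [hy]; ring
    have e2 : y ^ p = F ^ p * (X ^ (p - 1) * ζ ^ (m - 1)) ^ p * ((Λ * m) ^ p * L ^ p) := by
      rw [e1, Real.mul_rpow (by positivity) (by positivity), Real.mul_rpow hF (by positivity),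
        Real.mul_rpow (by positivity) hL]
    -- Since `0 ≤ ζ ≤ 1`, the powers of `ζ` compare if `(m - 1) p ≥ m (p - 1)`, that is, if `p ≤ m`.
    -- This is why the cutoff is raised to the power `m`.
    have e3 : (X ^ (p - 1) * ζ ^ (m - 1)) ^ p ≤ (X ^ p * ζ ^ m) ^ (p - 1) := by
      rw [Real.mul_rpow (by positivity) (by positivity), Real.mul_rpow (by positivity) (by positivity),
        ← Real.rpow_mul hX, ← Real.rpow_mul hX, mul_comm (p - 1) p]
      refine mul_le_mul_of_nonneg_left ?_ (by positivity)
      rw [← Real.rpow_natCast, ← Real.rpow_natCast, ← Real.rpow_mul hζ0, ← Real.rpow_mul hζ0]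
      refine Real.rpow_le_rpow_of_exponent_ge_of_imp hζ0 hζ.2 ?_ ?_
      · rw [Nat.cast_sub hm1]; push_cast; nlinarith
      · intro _ h0
        have : ((m - 1 : ℕ) : ℝ) * p ≠ 0 := by
          rw [Nat.cast_sub hm1]; exact mul_ne_zero (by push_cast; linarith) (by linarith)
        exact absurd h0 this
    rw [e2]
    calc F ^ p * (X ^ (p - 1) * ζ ^ (m - 1)) ^ p * ((Λ * m) ^ p * L ^ p)
        ≤ (N * f ^ (p - 1)) * (X ^ p * ζ ^ m) ^ (p - 1) * ((Λ * m) ^ p * L ^ p) := by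
          gcongr
      _ = _ := by
          rw [hY, mul_assoc f, Real.mul_rpow hf (by positivity)]; ring
  have hlast : y ≤ (Λ * m) ^ p * (2 * Λ) ^ (p - 1) * N * L ^ p := by
    have h1 : y ^ p = y * y ^ (p - 1) := by
      rw [← Real.rpow_one_add' hy0 (by linarith)]; congr 1; ring
    have h2 : Y ^ (p - 1) ≤ (2 * Λ) ^ (p - 1) * y ^ (p - 1) := by
      rw [← Real.mul_rpow (by positivity) hy0]
      exact Real.rpow_le_rpow hY0 hYy (by linarith)
    have h3 : 0 < y ^ (p - 1) := Real.rpow_pos_of_pos hypos _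
    refine le_of_mul_le_mul_right ?_ h3
    rw [← h1]
    refine hkey.trans ?_
    calc (Λ * m) ^ p * L ^ p * N * Y ^ (p - 1)
        ≤ (Λ * m) ^ p * L ^ p * N * ((2 * Λ) ^ (p - 1) * y ^ (p - 1)) := by gcongr
      _ = _ := by ring
  have : 0 ≤ (2 * Λ)⁻¹ * Y := by positivity
  linarith

/-- Smooth cutoff functions in time. -/
lemma exists_timeCutoff (t₁ : ℝ) {δ : ℝ} (hδ : 0 < δ) :
    ∃ χ χ' : ℝ → ℝ, (∀ t, HasDerivAt χ (χ' t) t) ∧ Continuous χ' ∧ (∃ L, ∀ t, |χ' t| ≤ L) ∧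
      (∀ t, χ t ∈ Icc (0 : ℝ) 1) ∧ (∀ t ≤ t₁, χ t = 1) ∧ (∀ t ≥ t₁ + δ, χ t = 0) ∧
      (∀ t, χ' t ≤ 0) ∧ ∀ t ∉ Icc t₁ (t₁ + δ), χ' t = 0 := by
  set χ : ℝ → ℝ := fun t => 1 - Real.smoothTransition ((t - t₁) / δ) with hχ
  have hcd : ContDiff ℝ 1 χ := contDiff_const.sub
    (Real.smoothTransition.contDiff.comp ((contDiff_id.sub contDiff_const).div_const δ))
  have hd : ∀ t, HasDerivAt χ (deriv χ t) t := fun t =>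
    (hcd.differentiable one_ne_zero t).hasDerivAt
  have h1 : ∀ t ≤ t₁, χ t = 1 := fun t ht => by
    simp only [hχ]
    rw [Real.smoothTransition.zero_of_nonpos (div_nonpos_of_nonpos_of_nonneg (by linarith) hδ.le),
      sub_zero]
  have h0 : ∀ t ≥ t₁ + δ, χ t = 0 := fun t ht => by
    simp only [hχ]
    rw [Real.smoothTransition.one_of_one_le ((one_le_div hδ).2 (by linarith)), sub_self]
  have hanti : Antitone χ := fun s t hst => by
    simp only [hχ]
    have : Real.smoothTransition ((s - t₁) / δ) ≤ Real.smoothTransition ((t - t₁) / δ) :=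
      Real.smoothTransition.monotone (by gcongr)
    linarith
  have hz : ∀ t ∉ Icc t₁ (t₁ + δ), deriv χ t = 0 := by
    intro t ht
    rw [mem_Icc, not_and_or, not_le, not_le] at ht
    rcases ht with ht | ht
    · have : χ =ᶠ[𝓝 t] fun _ => 1 := by
        filter_upwards [Iio_mem_nhds ht] with s hs using h1 s (le_of_lt hs)
      rw [this.deriv_eq]; simp
    · have : χ =ᶠ[𝓝 t] fun _ => 0 := by
        filter_upwards [Ioi_mem_nhds ht] with s hs using h0 s (le_of_lt hs)
      rw [this.deriv_eq]; simp
  have hc' : Continuous (deriv χ) := hcd.continuous_deriv le_rfl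
  obtain ⟨L, hL⟩ := hc'.bounded_above_of_compact_support
    (HasCompactSupport.of_support_subset_isCompact isCompact_Icc fun t ht => by
      by_contra h; exact ht (hz t h))
  refine ⟨χ, deriv χ, hd, hc', ⟨L, hL⟩, fun t => ⟨?_, ?_⟩, h1, h0, fun t => hanti.deriv_nonpos, hz⟩
  · simp only [hχ]; linarith [Real.smoothTransition.le_one ((t - t₁) / δ)]
  · simp only [hχ]; linarith [Real.smoothTransition.nonneg ((t - t₁) / δ)]

section Cutoff

variable {ζ : E n → ℝ} {χ χ' : ℝ → ℝ} {m : ℕ}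

lemma contDiff_spaceTimeCutoff (hζ : ContDiff ℝ 1 ζ) (hχ : ∀ t, HasDerivAt χ (χ' t) t)
    (hχc : Continuous χ') : ContDiff ℝ 1 fun z : E n × ℝ => ζ z.1 ^ m * χ z.2 :=
  ((hζ.comp contDiff_fst).pow m).mul ((contDiff_one_of_hasDerivAt hχ hχc).comp contDiff_snd)

lemma tsupport_spaceTimeCutoff_subset (hm : m ≠ 0) {t₂ : ℝ} (ht : ∀ t ≥ t₂, χ t = 0) :
    tsupport (fun z : E n × ℝ => ζ z.1 ^ m * χ z.2) ⊆ {z | z.1 ∈ tsupport ζ ∧ z.2 ≤ t₂} := by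
  refine closure_minimal (fun z hz => ⟨?_, ?_⟩) ?_
  · refine subset_tsupport ζ fun h0 => hz ?_
    simp [h0, hm]
  · by_contra h
    refine hz ?_
    simp [ht z.2 (not_le.1 h).le]
  · exact ((isClosed_tsupport ζ).preimage continuous_fst).inter
      (isClosed_le continuous_snd continuous_const)

lemma norm_spaceGrad_cutoff_le (hζ : ContDiff ℝ 1 ζ) (hζ01 : ∀ x, ζ x ∈ Icc (0 : ℝ) 1)
    (hχ0 : ∀ t, χ t ∈ Icc (0 : ℝ) 1) {L : ℝ} (hL : ∀ x, ‖fderiv ℝ ζ x‖ ≤ L) (z : E n × ℝ) :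
    ‖spaceGrad (fun z : E n × ℝ => ζ z.1 ^ m * χ z.2) z‖ ≤ χ z.2 * (m * ζ z.1 ^ (m - 1) * L) := by
  have h1 := (((hζ.differentiable one_ne_zero z.1).hasFDerivAt).pow m).mul_const (χ z.2)
  have h2 : spaceGrad (fun z : E n × ℝ => ζ z.1 ^ m * χ z.2) z
      = gradient (fun y => ζ y ^ m * χ z.2) z.1 := rfl
  rw [h2, gradient, LinearIsometryEquiv.norm_map, h1.fderiv, norm_smul, norm_smul,
    Real.norm_of_nonneg (hχ0 _).1]
  refine mul_le_mul_of_nonneg_left ?_ (hχ0 _).1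
  have h3 : (0 : ℝ) ≤ m * ζ z.1 ^ (m - 1) := mul_nonneg m.cast_nonneg (pow_nonneg (hζ01 _).1 _)
  rw [nsmul_eq_mul, Real.norm_of_nonneg h3]
  exact mul_le_mul_of_nonneg_left (hL _) h3

end Cutoff

namespace SolutionData

variable {p Λ : ℝ} {D : Set (E n)} {τ : ℝ} {x₀ : E n} {r k₀ M : ℝ} {β : ℝ → ℝ}
    {v : E n × ℝ → ℝ} {G a : E n × ℝ → E n}

lemma isOpen_cylinder (S : SolutionData p Λ D τ x₀ r k₀ M β v G a) : IsOpen (D ×ˢ Ioo 0 τ) :=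
  S.isOpen.prod isOpen_Ioo

lemma volume_cylinder (S : SolutionData p Λ D τ x₀ r k₀ M β v G a) :
    volume (D ×ˢ Ioo 0 τ) ≠ ∞ := by
  rw [Measure.volume_eq_prod, Measure.prod_prod]
  exact ENNReal.mul_ne_top S.finite (by simp)

/-- The growth condition bounds the flux by `‖G‖ ^ (p - 1)`, whose integrability exponent is
conjugate to `p`. -/
lemma memLp_flux (S : SolutionData p Λ D τ x₀ r k₀ M β v G a) (hp : 2 ≤ p)
    {K : Set (E n × ℝ)} (hKU : K ⊆ D ×ˢ Ioo 0 τ) (hK : IsCompact K) :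
    MemLp a (ENNReal.ofReal p.conjExponent) (volume.restrict K) := by
  have h1 := (S.grad.memLp_grad K hKU hK).norm_rpow_div (ENNReal.ofReal (p - 1))
  rw [ENNReal.toReal_ofReal (by linarith), ← ENNReal.ofReal_div_of_pos (by linarith)] at h1
  refine h1.of_le_mul (c := Λ) (S.flux_meas.mono_measure (Measure.restrict_mono hKU le_rfl)) ?_
  filter_upwards [ae_mono (Measure.restrict_mono hKU le_rfl) S.growth] with z hz
  rwa [Real.norm_of_nonneg (by positivity)]

lemma monotone (S : SolutionData p Λ D τ x₀ r k₀ M β v G a) : Monotone β := by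
  have := S.mono.add monotone_id
  simpa [Pi.add_def] using this

variable {F f ζ χ χ'}

/-- The integrand vanishes off a compact subset of the cylinder, so local integrability of the
gradient gives integrability up to the parabolic boundary. -/
lemma integrableOn_energy (S : SolutionData p Λ D τ x₀ r k₀ M β v G a) (hp : 2 ≤ p)
    (hf : Continuous f) {k : ℝ} (hk : k₀ < k) (hfk : ∀ s < k, f s = 0)
    {c : E n × ℝ → ℝ} (hc : Continuous c) {S' : Set (E n)} (hS' : IsCompact S')
    (hSr : S' ⊆ Metric.ball x₀ r) {t₂ : ℝ} (ht₂ : t₂ < τ)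
    (hcs : ∀ z, c z ≠ 0 → z.1 ∈ S' ∧ z.2 ≤ t₂) :
    IntegrableOn (fun z => f (v z) * ‖G z‖ ^ p * c z) (D ×ˢ Ioo 0 τ) := by
  obtain ⟨K₁, hK₁U, hK₁, hK⟩ := S.compact_superlevel S' hSr hS' t₂ ht₂ k hk
  have hp0 : ENNReal.ofReal p ≠ 0 := by simp; linarith
  have h1 := (S.grad.memLp_grad K₁ hK₁U hK₁).integrable_norm_rpow hp0 ENNReal.ofReal_ne_top
  rw [ENNReal.toReal_ofReal (by linarith)] at h1
  have hcv : ContinuousOn (fun z => f (v z) * c z) K₁ :=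
    (hf.comp_continuousOn (S.cont.mono hK₁U)).mul hc.continuousOn
  obtain ⟨C, hC⟩ := hK₁.exists_bound_of_continuousOn hcv
  have h2 : IntegrableOn (fun z => f (v z) * ‖G z‖ ^ p * c z) K₁ := by
    refine (h1.mul_bdd (hcv.aestronglyMeasurable hK₁.measurableSet)
      ((ae_restrict_iff' hK₁.measurableSet).2 (ae_of_all _ hC))).congr (ae_of_all _ fun z => ?_)
    simp only; ring
  refine h2.of_forall_sdiff_eq_zero S.isOpen_cylinder.measurableSet fun z hz => ?_
  by_contra h0
  have h3 := hcs z (right_ne_zero_of_mul h0)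
  refine hz.2 (hK z hz.1 h3.1 h3.2 ?_)
  by_contra h4
  exact h0 (by simp [hfk _ (not_le.1 h4)])

/-- **Caccioppoli inequality** with a time-independent cutoff function on the initial cylinder. -/
lemma caccioppoli (S : SolutionData p Λ D τ x₀ r k₀ M β v G a) (hp : 2 ≤ p) (hΛ : 1 ≤ Λ)
    (hF : ∀ s, HasDerivAt F (f s) s) (hf : Continuous f) (hf0 : ∀ s, 0 ≤ f s)
    {k : ℝ} (hk : k₀ < k) (hFk : ∀ s ≤ k, F s = 0) {N : ℝ} (hN0 : 0 ≤ N)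
    (hN : ∀ s ≤ M, F s ^ p ≤ N * f s ^ (p - 1))
    (hζ : ContDiff ℝ 1 ζ) (hζ01 : ∀ x, ζ x ∈ Icc (0 : ℝ) 1) (hζc : HasCompactSupport ζ)
    (hζr : tsupport ζ ⊆ Metric.ball x₀ r)
    {L : ℝ} (hL : ∀ x, ‖fderiv ℝ ζ x‖ ≤ L) {m : ℕ} (hm : p ≤ m)
    (hχ : ∀ t, HasDerivAt χ (χ' t) t) (hχc : Continuous χ') (hχL : ∃ L, ∀ t, |χ' t| ≤ L)
    (hχ0 : ∀ t, χ t ∈ Icc (0 : ℝ) 1) {t₂ : ℝ} (ht₂ : t₂ < τ) (hχt : ∀ t ≥ t₂, χ t = 0)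
    (hχ' : ∀ t, χ' t ≤ 0) {W : Set (E n × ℝ)} (hW : MeasurableSet W) (hWU : W ⊆ D ×ˢ Ioo 0 τ)
    (hWs : ∀ z ∈ D ×ˢ Ioo 0 τ, k < v z → z.1 ∈ tsupport ζ → z ∈ W) :
    -(∫ z in D ×ˢ Ioo 0 τ, jumpPrimitive f id k (v z) * ζ z.1 ^ m * χ' z.2)
        + (2 * Λ)⁻¹ * ∫ z in D ×ˢ Ioo 0 τ, f (v z) * ‖G z‖ ^ p * (ζ z.1 ^ m * χ z.2)
      ≤ (Λ * m) ^ p * (2 * Λ) ^ (p - 1) * N * L ^ p * volume.real W := by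
  set U := D ×ˢ Ioo 0 τ with hU
  have hUo : IsOpen U := S.isOpen_cylinder
  have hm0 : m ≠ 0 := by
    rintro rfl
    simp only [Nat.cast_zero] at hm; linarith
  have hL0 : 0 ≤ L := (norm_nonneg _).trans (hL 0)
  have hFm := monotone_of_hasDerivAt_nonneg hF hf0
  have hFv : ∀ s, 0 ≤ F s := fun s => by
    rcases le_total s k with h | h
    · rw [hFk s h]
    · rw [← hFk k le_rfl]; exact hFm h
  have hfk : ∀ s < k, f s = 0 := fun s hs => deriv_eq_zero_of_lt hF hFk hs
  obtain ⟨L', hL'⟩ := hχL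
  obtain ⟨C, hC⟩ := S.bdd
  set c : E n × ℝ → ℝ := fun z => ζ z.1 ^ m * χ z.2 with hc
  have hcd : ContDiff ℝ 1 c := contDiff_spaceTimeCutoff hζ hχ hχc
  have hcs : tsupport c ⊆ {z | z.1 ∈ tsupport ζ ∧ z.2 ≤ t₂} :=
    tsupport_spaceTimeCutoff_subset hm0 hχt
  have hc0 : ∀ z, 0 ≤ c z := fun z => mul_nonneg (pow_nonneg (hζ01 _).1 _) (hχ0 _).1
  -- An intermediate level leaves room for the approximation, and compactness of `{v ≥ k₁}` over the
  -- support of `c` makes `F(v) c` admissible although `c` need not vanish at `t = 0` or on `∂Ω`.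
  obtain ⟨k₁, hk₀₁, hk₁⟩ := exists_between hk
  obtain ⟨K₁, hK₁U, hK₁, hK⟩ := S.compact_superlevel _ hζr hζc t₂ ht₂ k₁ hk₀₁
  obtain ⟨K, hKU, hap⟩ := exists_hasC1Approx (by linarith : 1 ≤ p) hUo S.cont S.grad_meas S.grad hF
    hf hk₁ hFk hcd hK₁ hK₁U fun z hz h1 h2 => hK z hz (hcs h1).1 (hcs h1).2 h2
  have hpp : p.conjExponent.HolderConjugate p :=
    (Real.HolderConjugate.conjExponent (by linarith)).symm
  have hconj := hpp.ennrealOfReal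
  have hflux := integral_flux_le hpp S.monotone hUo S.volume_cylinder S.cont hC
    (fun K h1 h2 => S.memLp_flux hp h1 h2) S.weak hF hf hf0 (hFk k le_rfl)
    (η := fun x => ζ x ^ m) (hζ.continuous.pow m)
    (fun x => ⟨pow_nonneg (hζ01 x).1 _, pow_le_one₀ (hζ01 x).1 (hζ01 x).2⟩) hχ hL' hχ0 hFv hKU hap
  set Γ := U.indicator fun z => (c z * f (v z)) • G z + F (v z) • spaceGrad c z with hΓ
  have hvm : AEMeasurable v (volume.restrict U) := S.cont.aemeasurable hUo.measurableSet
  have hUfin : IsFiniteMeasure (volume.restrict U) := ⟨by simpa using S.volume_cylinder.lt_top⟩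
  -- the energy of `id` is at most the energy of `β`
  have hbd : ∀ {γ : ℝ → ℝ}, Monotone γ →
      IntegrableOn (fun z => jumpPrimitive f γ k (v z) * ζ z.1 ^ m * χ' z.2) U := by
    intro γ hγ
    have hmz : AEStronglyMeasurable (fun z : E n × ℝ => ζ z.1 ^ m) (volume.restrict U) :=
      ((hζ.continuous.comp continuous_fst).pow m).aestronglyMeasurable
    have hmc : AEStronglyMeasurable (fun z : E n × ℝ => χ' z.2) (volume.restrict U) :=
      (hχc.comp continuous_snd).aestronglyMeasurable
    refine Integrable.of_bound ((((measurable_jumpPrimitive hF hf hγ (hFk k le_rfl)).comp_aemeasurable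
      hvm).aestronglyMeasurable.mul hmz).mul hmc) (F C * (γ (max C k) - γ k) * 1 * L')
      ((ae_restrict_iff' hUo.measurableSet).2 (ae_of_all _ fun z hz => ?_))
    have h1 := jumpPrimitive_nonneg hf0 hγ k (v z)
    have h2 := abs_le.1 (hC z hz)
    have h3 : γ k ≤ γ (max C k) := hγ (le_max_right _ _)
    have h5 : jumpPrimitive f γ k (v z) ≤ F C * (γ (max C k) - γ k) := by
      refine (jumpPrimitive_le hF hf hf0 hγ (hFk k le_rfl) (v z)).trans ?_
      rcases le_total (γ k) (γ (v z)) with h4 | h4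
      · exact mul_le_mul (hFm h2.2) (sub_le_sub_right (hγ (h2.2.trans (le_max_left _ _))) _)
          (sub_nonneg.2 h4) (hFv C)
      · exact (mul_nonpos_of_nonneg_of_nonpos (hFv _) (sub_nonpos.2 h4)).trans
          (mul_nonneg (hFv C) (sub_nonneg.2 h3))
    have h6 : 0 ≤ ζ z.1 ^ m := pow_nonneg (hζ01 _).1 _
    rw [norm_mul, norm_mul, Real.norm_of_nonneg h1, Real.norm_of_nonneg h6]
    have h7 : ζ z.1 ^ m ≤ 1 := pow_le_one₀ (hζ01 _).1 (hζ01 _).2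
    exact mul_le_mul (mul_le_mul h5 h7 h6 (h1.trans h5)) (hL' _) (norm_nonneg _)
      (mul_nonneg (h1.trans h5) zero_le_one)
  have hid : ∫ z in U, jumpPrimitive f β k (v z) * ζ z.1 ^ m * χ' z.2
      ≤ ∫ z in U, jumpPrimitive f id k (v z) * ζ z.1 ^ m * χ' z.2 := by
    refine setIntegral_mono (hbd S.monotone) (hbd monotone_id) fun z => ?_
    refine mul_le_mul_of_nonpos_right (mul_le_mul_of_nonneg_right ?_ (pow_nonneg (hζ01 _).1 _))
      (hχ' _)
    exact jumpPrimitive_id_le hf hf0 S.mono S.monotone k (v z)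
  -- pointwise lower bound of the flux term
  set R := (Λ * m) ^ p * (2 * Λ) ^ (p - 1) * N * L ^ p with hR
  have hΛ0 : 0 < Λ := by linarith
  have hR0 : 0 ≤ R := by positivity
  have hpt : ∀ᵐ z ∂(volume.restrict U),
      (2 * Λ)⁻¹ * (f (v z) * ‖G z‖ ^ p * c z) - W.indicator (fun _ => R) z ≤ inner ℝ (a z) (Γ z) := by
    filter_upwards [S.growth, S.coercive, ae_restrict_mem hUo.measurableSet] with z hg hco hz
    rw [hΓ, indicator_of_mem hz, inner_add_right, inner_smul_right, inner_smul_right]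
    have e1 : c z * f (v z) * (Λ⁻¹ * ‖G z‖ ^ p) ≤ c z * f (v z) * inner ℝ (a z) (G z) :=
      mul_le_mul_of_nonneg_left hco (mul_nonneg (hc0 z) (hf0 _))
    have hW0 : 0 ≤ W.indicator (fun _ => R) z := indicator_nonneg (fun _ _ => hR0) z
    have hY0 : 0 ≤ f (v z) * ‖G z‖ ^ p * c z :=
      mul_nonneg (mul_nonneg (hf0 _) (by positivity)) (hc0 z)
    -- One half of the coercive term is kept; the other absorbs the term with the gradient of the
    -- cutoff.
    have e2 : (2 * Λ)⁻¹ * (f (v z) * ‖G z‖ ^ p * c z) + (2 * Λ)⁻¹ * (f (v z) * ‖G z‖ ^ p * c z)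
        = c z * f (v z) * (Λ⁻¹ * ‖G z‖ ^ p) := by
      rw [mul_inv]; ring
    suffices h : -(F (v z) * inner ℝ (a z) (spaceGrad c z))
        ≤ (2 * Λ)⁻¹ * (f (v z) * ‖G z‖ ^ p * c z) + W.indicator (fun _ => R) z by linarith
    have hY1 : 0 ≤ (2 * Λ)⁻¹ * (f (v z) * ‖G z‖ ^ p * c z) := mul_nonneg (by positivity) hY0
    by_cases h1 : k < v z ∧ z.1 ∈ tsupport ζ
    · rw [indicator_of_mem (hWs z hz h1.1 h1.2)]
      have h2 : -(inner ℝ (a z) (spaceGrad c z) : ℝ)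
          ≤ Λ * ‖G z‖ ^ (p - 1) * (χ z.2 * (m * ζ z.1 ^ (m - 1) * L)) := by
        refine (neg_le_abs _).trans ((abs_real_inner_le_norm _ _).trans ?_)
        exact mul_le_mul hg (norm_spaceGrad_cutoff_le hζ hζ01 hχ0 hL z) (norm_nonneg _)
          (by positivity)
      have h3 := young_absorb (X := ‖G z‖) hp hΛ hN0 hL0 (norm_nonneg _) (hFv (v z)) (hf0 (v z))
        (hζ01 z.1) hm (hN _ (S.le_sup z hz))
      calc -(F (v z) * inner ℝ (a z) (spaceGrad c z))
          = F (v z) * -inner ℝ (a z) (spaceGrad c z) := by ring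
        _ ≤ F (v z) * (Λ * ‖G z‖ ^ (p - 1) * (χ z.2 * (m * ζ z.1 ^ (m - 1) * L))) :=
            mul_le_mul_of_nonneg_left h2 (hFv _)
        _ = χ z.2 * (F (v z) * (Λ * ‖G z‖ ^ (p - 1)) * (m * ζ z.1 ^ (m - 1) * L)) := by ring
        _ ≤ χ z.2 * ((2 * Λ)⁻¹ * (f (v z) * ‖G z‖ ^ p * ζ z.1 ^ m) + R) :=
            mul_le_mul_of_nonneg_left h3 (hχ0 _).1
        _ = (2 * Λ)⁻¹ * (f (v z) * ‖G z‖ ^ p * c z) + χ z.2 * R := by rw [hc]; ring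
        _ ≤ _ := by
            have := mul_le_of_le_one_left hR0 (hχ0 z.2).2
            linarith
    · have h2 : F (v z) * inner ℝ (a z) (spaceGrad c z) = 0 := by
        rw [not_and_or, not_lt] at h1
        rcases h1 with h1 | h1
        · rw [hFk _ h1, zero_mul]
        · have : spaceGrad c z = 0 := by
            by_contra h0
            exact h1 (hcs (support_spaceGrad_subset hcd h0)).1
          simp [this]
      rw [h2, neg_zero]; positivity
  have hei := S.integrableOn_energy hp hf hk hfk hcd.continuous hζc hζr ht₂
    fun z hz => hcs (subset_tsupport c hz)
  have hWi : IntegrableOn (W.indicator fun _ => R) U :=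
    (integrable_const (μ := volume.restrict U) R).indicator hW
  have hfi : IntegrableOn (fun z => (inner ℝ (a z) (Γ z) : ℝ)) U := by
    have h1 : IntegrableOn (fun z => (inner ℝ (a z) (Γ z) : ℝ)) K :=
      integrable_inner_of_memLp (p := ENNReal.ofReal p) (S.memLp_flux hp hKU hap.isCompact)
        (hap.memLp.restrict K)
    refine h1.of_forall_sdiff_eq_zero hUo.measurableSet fun z hz => ?_
    have : Γ z = 0 := by
      by_contra h0; exact hz.2 (hap.support_grad h0)
    simp [this]
  have hint := integral_mono_ae ((hei.const_mul _).sub hWi) hfi hpt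
  rw [integral_sub' (hei.const_mul _) hWi, integral_const_mul, setIntegral_indicator hW,
    setIntegral_const, smul_eq_mul, inter_eq_right.2 hWU] at hint
  rw [mul_comm R]
  linarith

end SolutionData

end

/-! ### The Sobolev inequality on time slices and the energy of a single slice. -/

section

variable {n : ℕ}

/-! ### The Sobolev inequality on time slices -/

/-- The constant of the Sobolev inequality `W^{1,1} ⊂ L^{n/(n-1)}`. -/
def sobolevConst (n : ℕ) : ℝ≥0 :=
  eLpNormLESNormFDerivOneConst (volume : Measure (E n)) (NNReal.conjExponent n)

/-- The embedding of `W^{1,1}` into `L^{n/(n-1)}`, followed by Hölder on `A`. The gain `1/n` in the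
measure of `A` drives the De Giorgi iteration. -/
lemma setLIntegral_le_sobolev_slice (hn : 2 ≤ n) {u : E n → ℝ} (hu : ContDiff ℝ 1 u)
    (hc : HasCompactSupport u) (A : Set (E n)) :
    ∫⁻ x in A, ‖u x‖ₑ
      ≤ sobolevConst n * volume A ^ (1 / (n : ℝ)) * ∫⁻ x, ‖fderiv ℝ u x‖ₑ := by
  have hn1 : (1 : ℝ≥0) < n := by exact_mod_cast (by omega : 1 < n)
  have hq : NNReal.HolderConjugate (n : ℝ≥0) (NNReal.conjExponent n) :=
    NNReal.HolderConjugate.conjExponent hn1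
  set q := NNReal.conjExponent (n : ℝ≥0) with hqd
  have hq' : NNReal.HolderConjugate (Module.finrank ℝ (E n)) q := by
    simpa using hq
  have h1 := eLpNorm_le_eLpNorm_fderiv_one (volume : Measure (E n)) hu hc hq'
  have h2 : eLpNorm u 1 (volume.restrict A) ≤ eLpNorm u q (volume.restrict A) *
      (volume.restrict A) univ ^ (1 / (1 : ℝ≥0∞).toReal - 1 / (q : ℝ≥0∞).toReal) :=
    eLpNorm_le_eLpNorm_mul_rpow_measure_univ (by exact_mod_cast hq.symm.lt.le)
      hu.continuous.aestronglyMeasurable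
  have hexp : 1 / (1 : ℝ≥0∞).toReal - 1 / (q : ℝ≥0∞).toReal = 1 / (n : ℝ) := by
    have := hq.coe.inv_add_inv_eq_one
    simp only [ENNReal.toReal_one, ENNReal.coe_toReal, one_div, inv_one]
    have h3 : ((n : ℝ≥0) : ℝ) = n := by simp
    rw [h3] at this
    linarith
  rw [hexp, Measure.restrict_apply_univ, eLpNorm_one_eq_lintegral_enorm] at h2
  rw [eLpNorm_one_eq_lintegral_enorm] at h1
  calc ∫⁻ x in A, ‖u x‖ₑ ≤ eLpNorm u q (volume.restrict A) * volume A ^ (1 / (n : ℝ)) := h2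
    _ ≤ (sobolevConst n * ∫⁻ x, ‖fderiv ℝ u x‖ₑ) * volume A ^ (1 / (n : ℝ)) := by
        gcongr
        exact (eLpNorm_mono_measure _ Measure.restrict_le_self).trans h1
    _ = _ := by ring

/-- Tonelli in time: the uniform bound on the slices of `A` replaces a parabolic embedding, and only
the spatial gradient is needed. -/
lemma setLIntegral_le_sobolev_of_contDiff (hn : 2 ≤ n) {Ψ : E n × ℝ → ℝ} (hΨ : ContDiff ℝ 1 Ψ)
    (hc : HasCompactSupport Ψ) {A : Set (E n × ℝ)} (hA : MeasurableSet A) {S : ℝ≥0∞}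
    (hS : ∀ t, volume {x | (x, t) ∈ A} ≤ S) :
    ∫⁻ z in A, ‖Ψ z‖ₑ ≤ sobolevConst n * S ^ (1 / (n : ℝ)) * ∫⁻ z, ‖spaceGrad Ψ z‖ₑ := by
  have hm1 : Measurable (A.indicator fun z => ‖Ψ z‖ₑ) :=
    (hΨ.continuous.measurable.enorm).indicator hA
  have hm2 : Measurable fun z => ‖spaceGrad Ψ z‖ₑ := (continuous_spaceGrad hΨ).measurable.enorm
  rw [← lintegral_indicator hA, Measure.volume_eq_prod, lintegral_prod_symm' _ hm1,
    lintegral_prod_symm' _ hm2, ← lintegral_const_mul _ hm2.lintegral_prod_left']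
  refine lintegral_mono fun t => ?_
  have hslice : ContDiff ℝ 1 fun x => Ψ (x, t) := hΨ.comp (contDiff_id.prodMk contDiff_const)
  have hcs : HasCompactSupport fun x => Ψ (x, t) := by
    refine HasCompactSupport.intro (hc.isCompact.image continuous_fst) fun x hx => ?_
    exact image_eq_zero_of_notMem_tsupport fun h => hx ⟨_, h, rfl⟩
  have h1 := setLIntegral_le_sobolev_slice hn hslice hcs {x | (x, t) ∈ A}
  have hAt : MeasurableSet {x | (x, t) ∈ A} := hA.preimage (by fun_prop)
  rw [← lintegral_indicator hAt] at h1
  have h2 : ∀ x, ‖spaceGrad Ψ (x, t)‖ₑ = ‖fderiv ℝ (fun y => Ψ (y, t)) x‖ₑ := fun x => by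
    rw [spaceGrad, gradient, LinearIsometryEquiv.enorm_map]
  simp_rw [h2]
  refine le_trans (le_of_eq ?_) (h1.trans ?_)
  · congr 1
  · gcongr
    exact hS t

/-- The Sobolev inequality for limits of `C¹` functions, on a set with small time slices. -/
lemma HasC1Approx.setLIntegral_le_sobolev (hn : 2 ≤ n) {p : ℝ} (hp : 1 ≤ p) {K : Set (E n × ℝ)}
    {ψ : E n × ℝ → ℝ} {Γ : E n × ℝ → E n} (h : HasC1Approx p K ψ Γ) {A : Set (E n × ℝ)}
    (hA : MeasurableSet A) {S : ℝ≥0∞} (hSt : S ≠ ∞) (hS : ∀ t, volume {x | (x, t) ∈ A} ≤ S) :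
    ∫⁻ z in A, ‖ψ z‖ₑ ≤ sobolevConst n * S ^ (1 / (n : ℝ)) * ∫⁻ z, ‖Γ z‖ₑ := by
  obtain ⟨Ψ, h1, h2, -, h4, h5⟩ := h.exists_seq
  have hp' : 1 ≤ ENNReal.ofReal p := by simpa using hp
  have hc : ∀ j, HasCompactSupport (Ψ j) := fun j =>
    HasCompactSupport.of_support_subset_isCompact h.isCompact (h2 j)
  have hK : MeasurableSet K := h.isCompact.measurableSet
  have hm : ∀ j, StronglyMeasurable (spaceGrad (Ψ j) - Γ) := fun j =>
    (continuous_spaceGrad (h1 j)).stronglyMeasurable.sub h.stronglyMeasurable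
  have hsupp : ∀ j, support (spaceGrad (Ψ j) - Γ) ⊆ K := fun j z hz => by
    by_contra hzK
    have e1 : Γ z = 0 := by
      by_contra h0; exact hzK (h.support_grad h0)
    have e2 : spaceGrad (Ψ j) z = 0 := by
      by_contra h0
      exact hzK (closure_minimal (h2 j) h.isCompact.isClosed (support_spaceGrad_subset (h1 j) h0))
    exact hz (by simp [e1, e2])
  have hL1 : Tendsto (fun j => ∫⁻ z, ‖(spaceGrad (Ψ j) - Γ) z‖ₑ) atTop (𝓝 0) := by
    set V := volume K ^ (1 / (1 : ℝ≥0∞).toReal - 1 / (ENNReal.ofReal p).toReal) with hV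
    have hVt : V ≠ ∞ := by
      refine (ENNReal.rpow_lt_top_of_nonneg ?_ h.isCompact.measure_ne_top).ne
      rw [ENNReal.toReal_ofReal (by linarith)]
      simp only [ENNReal.toReal_one, one_div, inv_one, sub_nonneg]
      exact inv_le_one_of_one_le₀ hp
    have h6 : Tendsto (fun j => eLpNorm (spaceGrad (Ψ j) - Γ) (ENNReal.ofReal p) volume * V) atTop
        (𝓝 0) := by
      simpa using ENNReal.Tendsto.mul_const h5 (Or.inr hVt)
    refine tendsto_of_tendsto_of_tendsto_of_le_of_le tendsto_const_nhds h6 (fun _ => zero_le)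
      fun j => ?_
    have h7 : ∫⁻ z, ‖(spaceGrad (Ψ j) - Γ) z‖ₑ = ∫⁻ z in K, ‖(spaceGrad (Ψ j) - Γ) z‖ₑ := by
      refine (setLIntegral_eq_of_support_subset ?_).symm
      exact fun z hz => hsupp j (by simpa using hz)
    simp only [h7, ← eLpNorm_one_eq_lintegral_enorm]
    have h8 := eLpNorm_le_eLpNorm_mul_rpow_measure_univ (μ := volume.restrict K) hp'
      (hm j).aestronglyMeasurable
    rw [Measure.restrict_apply_univ] at h8
    refine h8.trans ?_
    gcongr
    exact Measure.restrict_le_self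
  have hlim : Tendsto (fun j => sobolevConst n * S ^ (1 / (n : ℝ)) *
      ((∫⁻ z, ‖Γ z‖ₑ) + ∫⁻ z, ‖(spaceGrad (Ψ j) - Γ) z‖ₑ)) atTop
      (𝓝 (sobolevConst n * S ^ (1 / (n : ℝ)) * ∫⁻ z, ‖Γ z‖ₑ)) := by
    refine ENNReal.Tendsto.const_mul ?_ (Or.inr ?_)
    · simpa using tendsto_const_nhds.add hL1
    · exact ENNReal.mul_ne_top ENNReal.coe_ne_top
        (ENNReal.rpow_lt_top_of_nonneg (by positivity) hSt).ne
  -- Fatou's lemma needs only pointwise convergence of the functions; the gradients converge in `L¹`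
  -- because they live in one compact set.
  have hfatou : ∫⁻ z in A, ‖ψ z‖ₑ ≤ liminf (fun j => ∫⁻ z in A, ‖Ψ j z‖ₑ) atTop := by
    have e1 : ∀ z, ‖ψ z‖ₑ = liminf (fun j => ‖Ψ j z‖ₑ) atTop := fun z =>
      ((h4 z).enorm.liminf_eq).symm
    simp_rw [e1]
    exact lintegral_liminf_le fun j => (h1 j).continuous.measurable.enorm
  refine hfatou.trans ?_
  rw [← hlim.liminf_eq]
  refine liminf_le_liminf (Eventually.of_forall fun j => ?_)
  refine (setLIntegral_le_sobolev_of_contDiff hn (h1 j) (hc j) hA hS).trans ?_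
  gcongr
  rw [← lintegral_add_left h.stronglyMeasurable.enorm]
  refine lintegral_mono fun z => ?_
  have : spaceGrad (Ψ j) z = Γ z + (spaceGrad (Ψ j) - Γ) z := by simp
  conv_lhs => rw [this]
  exact enorm_add_le _ _

/-! ### Consequences of the Caccioppoli inequality -/

namespace SolutionData

variable {p Λ : ℝ} {D : Set (E n)} {τ : ℝ} {x₀ : E n} {r k₀ M : ℝ} {β : ℝ → ℝ}
    {v : E n × ℝ → ℝ} {G a : E n × ℝ → E n} {F f : ℝ → ℝ} {ζ : E n → ℝ}

/-- The energy of a time slice is controlled if it is controlled in the mean against all smooth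
cutoffs in time. -/
lemma setIntegral_slice_le (S : SolutionData p Λ D τ x₀ r k₀ M β v G a) {J : ℝ → ℝ}
    (hJ : Continuous J) (hζ : Continuous ζ) (hζ01 : ∀ x, ζ x ∈ Icc (0 : ℝ) 1) {R : ℝ}
    (h : ∀ χ χ' : ℝ → ℝ, (∀ t, HasDerivAt χ (χ' t) t) → Continuous χ' → (∃ L, ∀ t, |χ' t| ≤ L) →
      (∀ t, χ t ∈ Icc (0 : ℝ) 1) → (∃ t₂ < τ, ∀ t ≥ t₂, χ t = 0) → (∀ t, χ' t ≤ 0) →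
      -(∫ z in D ×ˢ Ioo 0 τ, J (v z) * ζ z.1 * χ' z.2) ≤ R)
    {t₁ : ℝ} (ht₁ : t₁ ∈ Ioo 0 τ) : ∫ x in D, J (v (x, t₁)) * ζ x ≤ R := by
  obtain ⟨C, hC⟩ := S.bdd
  obtain ⟨CJ, hCJ⟩ := (isCompact_Icc (a := -C) (b := C)).exists_bound_of_continuousOn hJ.continuousOn
  have hD : MeasurableSet D := S.isOpen.measurableSet
  have hDfin : IsFiniteMeasure (volume.restrict D) := ⟨by simpa using S.finite.lt_top⟩
  have hUfin : IsFiniteMeasure (volume.restrict (D ×ˢ Ioo 0 τ)) :=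
    ⟨by simpa using S.volume_cylinder.lt_top⟩
  have hbd : ∀ z ∈ D ×ˢ Ioo 0 τ, ‖J (v z) * ζ z.1‖ ≤ CJ := fun z hz => by
    rw [norm_mul, Real.norm_of_nonneg (hζ01 _).1]
    exact (mul_le_of_le_one_right (norm_nonneg _) (hζ01 _).2).trans
      (hCJ _ (abs_le.1 (hC z hz)))
  set I : ℝ → ℝ := fun t => ∫ x in D, J (v (x, t)) * ζ x with hI
  have hcont : ContinuousAt I t₁ := by
    refine continuousAt_of_dominated (bound := fun _ => CJ) ?_ ?_ (integrable_const _) ?_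
    · filter_upwards [isOpen_Ioo.mem_nhds ht₁] with t ht
      refine ContinuousOn.aestronglyMeasurable ?_ hD
      refine ContinuousOn.mul (hJ.comp_continuousOn ?_) hζ.continuousOn
      exact S.cont.comp (by fun_prop) fun x hx => ⟨hx, ht⟩
    · filter_upwards [isOpen_Ioo.mem_nhds ht₁] with t ht
      exact (ae_restrict_iff' hD).2 (ae_of_all _ fun x hx => hbd (x, t) ⟨hx, ht⟩)
    · refine (ae_restrict_iff' hD).2 (ae_of_all _ fun x hx => ?_)
      have h1 : ContinuousAt v (x, t₁) :=
        S.cont.continuousAt (S.isOpen_cylinder.mem_nhds ⟨hx, ht₁⟩)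
      have h2 : ContinuousAt (fun t => v (x, t)) t₁ :=
        ContinuousAt.comp (f := fun t : ℝ => (x, t)) h1 (by fun_prop)
      exact (hJ.continuousAt.comp h2).mul continuousAt_const
  -- If the slice integral exceeded `R` at `t₁`, continuity would keep it above some `R' > R` on a
  -- short interval. A cutoff descending from one to zero there has `∫ χ' = -1`, so its mean would
  -- be at least `R'`.
  by_contra! hlt
  obtain ⟨R', hR, hR'⟩ := exists_between hlt
  obtain ⟨δ₀, hδ₀, hδI⟩ := Metric.eventually_nhds_iff.1 (hcont.eventually_const_lt hR')
  set δ := min (δ₀ / 2) ((τ - t₁) / 2) with hδ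
  have hδ0 : 0 < δ := lt_min (half_pos hδ₀) (by linarith [ht₁.2])
  have hδτ : t₁ + δ < τ := by
    have : δ ≤ (τ - t₁) / 2 := min_le_right _ _
    linarith [ht₁.2]
  obtain ⟨χ, χ', hχ, hχc, hχL, hχ0, hχ1, hχt, hχ', hχz⟩ := exists_timeCutoff t₁ hδ0
  have hmain := h χ χ' hχ hχc hχL hχ0 ⟨t₁ + δ, hδτ, hχt⟩ hχ'
  obtain ⟨L, hL⟩ := hχL
  have hint : Integrable (fun z : E n × ℝ => J (v z) * ζ z.1 * χ' z.2)
      ((volume.restrict D).prod (volume.restrict (Ioo 0 τ))) := by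
    rw [Measure.prod_restrict, ← Measure.volume_eq_prod]
    refine Integrable.of_bound (ContinuousOn.aestronglyMeasurable ?_
      S.isOpen_cylinder.measurableSet) (CJ * L)
      ((ae_restrict_iff' S.isOpen_cylinder.measurableSet).2 (ae_of_all _ fun z hz => ?_))
    · exact ((hJ.comp_continuousOn S.cont).mul (hζ.comp continuous_fst).continuousOn).mul
        (hχc.comp continuous_snd).continuousOn
    · rw [norm_mul]
      exact mul_le_mul (hbd z hz) (hL _) (norm_nonneg _) ((norm_nonneg _).trans (hbd z hz))
  have hfub : ∫ z in D ×ˢ Ioo 0 τ, J (v z) * ζ z.1 * χ' z.2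
      = ∫ t in Ioo 0 τ, I t * χ' t := by
    rw [Measure.volume_eq_prod, ← Measure.prod_restrict, integral_prod_symm _ hint]
    simp only [integral_mul_const, hI]
  have hIi : Integrable (fun t => I t * χ' t) (volume.restrict (Ioo 0 τ)) := by
    have := hint.integral_prod_right
    simpa only [integral_mul_const] using this
  have hχi : Integrable χ' (volume.restrict (Ioo 0 τ)) :=
    Integrable.of_bound hχc.aestronglyMeasurable L (ae_of_all _ hL)
  have htot : ∫ t in Ioo 0 τ, χ' t = -1 := by
    have h0τ : (0 : ℝ) ≤ τ := (ht₁.1.trans ht₁.2).le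
    rw [← integral_Ioc_eq_integral_Ioo, ← intervalIntegral.integral_of_le h0τ,
      intervalIntegral.integral_eq_sub_of_hasDerivAt (fun t _ => hχ t)
        (hχc.intervalIntegrable _ _), hχ1 0 ht₁.1.le, hχt τ hδτ.le]
    norm_num
  have hle : ∫ t in Ioo 0 τ, I t * χ' t ≤ ∫ t in Ioo 0 τ, R' * χ' t := by
    refine integral_mono hIi (hχi.const_mul _) fun t => ?_
    by_cases ht : t ∈ Icc t₁ (t₁ + δ)
    · refine mul_le_mul_of_nonpos_right (hδI ?_).le (hχ' t)
      rw [Real.dist_eq, abs_of_nonneg (by linarith [ht.1])]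
      have : δ ≤ δ₀ / 2 := min_le_left _ _
      linarith [ht.2]
    · simp [hχz t ht]
  rw [integral_const_mul, htot] at hle
  rw [hfub] at hmain
  linarith

end SolutionData

end

/-! ### Spatial cutoffs and the measure of superlevel sets. -/

section

variable {n : ℕ}

/-! ### Cutoff functions in space -/

lemma exists_bound_deriv_smoothTransition :
    ∃ C : ℝ, 0 < C ∧ (∀ t, |deriv Real.smoothTransition t| ≤ C) := by
  have hc : Continuous (deriv Real.smoothTransition) :=
    (Real.smoothTransition.contDiff (n := 1)).continuous_deriv le_rfl
  obtain ⟨L, hL⟩ := hc.bounded_above_of_compact_support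
    (HasCompactSupport.of_support_subset_isCompact (isCompact_Icc (a := (0 : ℝ)) (b := 1))
      fun t ht => by
        by_contra h
        refine ht ?_
        rw [mem_Icc, not_and_or, not_le, not_le] at h
        rcases h with h | h
        · have : Real.smoothTransition =ᶠ[𝓝 t] fun _ => 0 := by
            filter_upwards [Iio_mem_nhds h] with s hs
            exact Real.smoothTransition.zero_of_nonpos (le_of_lt hs)
          rw [this.deriv_eq]; simp
        · have : Real.smoothTransition =ᶠ[𝓝 t] fun _ => 1 := by
            filter_upwards [Ioi_mem_nhds h] with s hs
            exact Real.smoothTransition.one_of_one_le (le_of_lt hs)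
          rw [this.deriv_eq]; simp)
  exact ⟨max L 1, by positivity, fun t => (hL t).trans (le_max_left _ _)⟩

/-- `ζ` is a cutoff function between two concentric balls, with gradient bounded by `L`. -/
structure IsSpaceCutoff (x₀ : E n) (ρ' ρ L : ℝ) (ζ : E n → ℝ) : Prop where
  contDiff : ContDiff ℝ 1 ζ
  mem_Icc : ∀ x, ζ x ∈ Icc (0 : ℝ) 1
  eq_one : ∀ x ∈ Metric.closedBall x₀ ρ', ζ x = 1
  tsupport_subset : tsupport ζ ⊆ Metric.closedBall x₀ ρ
  norm_fderiv_le : ∀ x, ‖fderiv ℝ ζ x‖ ≤ L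

/-- A smooth step applied to the squared distance, so that the centre causes no trouble. The
factorization `ρ² - ρ'² = (ρ - ρ')(ρ + ρ')` against the gradient bound `2ρ` yields a constant
independent of the radii and of `n`. -/
lemma exists_isSpaceCutoff : ∃ C : ℝ, 0 < C ∧ ∀ (n : ℕ) (x₀ : E n) (ρ' ρ : ℝ), 0 < ρ' → ρ' < ρ →
    ∃ ζ, IsSpaceCutoff x₀ ρ' ρ (C / (ρ - ρ')) ζ := by
  obtain ⟨C, hC0, hC⟩ := exists_bound_deriv_smoothTransition
  refine ⟨2 * C, by positivity, fun n x₀ ρ' ρ h0 hρ => ?_⟩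
  set A := ρ ^ 2 - ρ' ^ 2 with hA
  have hA' : A = (ρ - ρ') * (ρ + ρ') := by rw [hA]; ring
  have hA0 : 0 < A := by rw [hA']; exact mul_pos (by linarith) (by linarith)
  set w : E n → ℝ := fun x => (ρ ^ 2 - ‖x - x₀‖ ^ 2) / A with hw
  have hwd : ContDiff ℝ 1 w :=
    (contDiff_const.sub ((contDiff_id.sub contDiff_const).norm_sq ℝ)).div_const A
  have hst : ContDiff ℝ 1 Real.smoothTransition := Real.smoothTransition.contDiff
  have hsupp : support (fun x => Real.smoothTransition (w x)) ⊆ Metric.closedBall x₀ ρ := by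
    intro x hx
    by_contra h
    rw [Metric.mem_closedBall, dist_eq_norm, not_le] at h
    refine hx (Real.smoothTransition.zero_of_nonpos (div_nonpos_of_nonpos_of_nonneg ?_ hA0.le))
    nlinarith
  have hts : tsupport (fun x => Real.smoothTransition (w x)) ⊆ Metric.closedBall x₀ ρ :=
    closure_minimal hsupp Metric.isClosed_closedBall
  refine ⟨fun x => Real.smoothTransition (w x), hst.comp hwd,
    fun x => ⟨Real.smoothTransition.nonneg _, Real.smoothTransition.le_one _⟩, fun x hx => ?_, hts,
    fun x => ?_⟩
  · rw [Metric.mem_closedBall, dist_eq_norm] at hx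
    refine Real.smoothTransition.one_of_one_le ((one_le_div hA0).2 ?_)
    have := norm_nonneg (x - x₀)
    nlinarith
  · by_cases hx : x ∈ Metric.closedBall x₀ ρ
    · rw [Metric.mem_closedBall, dist_eq_norm] at hx
      have h1 : HasFDerivAt w (A⁻¹ • -((2 : ℕ) • innerSL ℝ (x - x₀))) x := by
        have h2 : HasFDerivAt (fun y : E n => ‖y - x₀‖ ^ 2) ((2 : ℕ) • innerSL ℝ (x - x₀)) x := by
          have := ((hasFDerivAt_id (𝕜 := ℝ) x).sub_const x₀).norm_sq
          simpa using this
        have h3 := (h2.const_sub (ρ ^ 2)).const_mul A⁻¹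
        refine h3.congr_of_eventuallyEq (Eventually.of_forall fun y => ?_)
        simp only [hw]; rw [div_eq_inv_mul]
      have h4 := ((hst.differentiable one_ne_zero (w x)).hasDerivAt).comp_hasFDerivAt x h1
      have h5 : fderiv ℝ (fun x => Real.smoothTransition (w x)) x
          = deriv Real.smoothTransition (w x) • (A⁻¹ • -((2 : ℕ) • innerSL ℝ (x - x₀))) := h4.fderiv
      rw [h5, norm_smul, norm_smul, norm_neg, Real.norm_of_nonneg (inv_pos.2 hA0).le]
      have h6 : ‖((2 : ℕ) • innerSL ℝ (x - x₀) : E n →L[ℝ] ℝ)‖ ≤ 2 * ρ := by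
        rw [← Nat.cast_smul_eq_nsmul ℝ, norm_smul, innerSL_apply_norm]
        simp only [Nat.cast_ofNat, Real.norm_ofNat]
        linarith
      calc ‖deriv Real.smoothTransition (w x)‖ * (A⁻¹ * ‖((2 : ℕ) • innerSL ℝ (x - x₀) : E n →L[ℝ] ℝ)‖)
          ≤ C * (A⁻¹ * (2 * ρ)) := by
            gcongr
            exact hC _
        _ ≤ C * (2 / (ρ - ρ')) := by
            gcongr
            have h7 : 0 < ρ - ρ' := by linarith
            have h8 : 0 < ρ + ρ' := by linarith
            rw [hA', inv_mul_eq_div, div_le_div_iff₀ (by positivity) h7]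
            nlinarith
        _ = 2 * C / (ρ - ρ') := by ring
    · have h1 : fderiv ℝ (fun x => Real.smoothTransition (w x)) x = 0 := by
        by_contra h0
        exact hx (hts (support_fderiv_subset ℝ h0))
      rw [h1, norm_zero]
      have : 0 < ρ - ρ' := by linarith
      positivity

namespace IsSpaceCutoff

variable {x₀ : E n} {ρ' ρ L : ℝ} {ζ : E n → ℝ}

lemma hasCompactSupport (h : IsSpaceCutoff x₀ ρ' ρ L ζ) : HasCompactSupport ζ :=
  (isCompact_closedBall x₀ ρ).of_isClosed_subset (isClosed_tsupport ζ) h.tsupport_subset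

lemma tsupport_subset_ball (h : IsSpaceCutoff x₀ ρ' ρ L ζ) {r : ℝ} (hr : ρ < r) :
    tsupport ζ ⊆ Metric.ball x₀ r :=
  h.tsupport_subset.trans (Metric.closedBall_subset_ball hr)

lemma nonneg (h : IsSpaceCutoff x₀ ρ' ρ L ζ) : 0 ≤ L := (norm_nonneg _).trans (h.norm_fderiv_le 0)

end IsSpaceCutoff

/-! ### Superlevel sets -/

/-- The part of `D × (0, τ)` over the closed ball of radius `ρ` where `v > k`. -/
def superlevel (D : Set (E n)) (τ : ℝ) (v : E n × ℝ → ℝ) (x₀ : E n) (ρ k : ℝ) : Set (E n × ℝ) :=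
  {z | z ∈ D ×ˢ Ioo 0 τ ∧ z.1 ∈ Metric.closedBall x₀ ρ ∧ k < v z}

/-- The factor in front of the measure in the Caccioppoli inequality. -/
def energyConst (p Λ : ℝ) (m : ℕ) : ℝ := (Λ * m) ^ p * (2 * Λ) ^ (p - 1)

namespace SolutionData

variable {p Λ : ℝ} {D : Set (E n)} {τ : ℝ} {x₀ : E n} {r k₀ M : ℝ} {β : ℝ → ℝ}
    {v : E n × ℝ → ℝ} {G a : E n × ℝ → E n} {F f : ℝ → ℝ} {ζ : E n → ℝ} {ρ' ρ L k k' N : ℝ}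
    {m : ℕ}

lemma measurableSet_superlevel (S : SolutionData p Λ D τ x₀ r k₀ M β v G a) (ρ k : ℝ) :
    MeasurableSet (superlevel D τ v x₀ ρ k) := by
  have h1 : IsOpen (D ×ˢ Ioo 0 τ ∩ v ⁻¹' Ioi k) :=
    S.cont.isOpen_inter_preimage S.isOpen_cylinder isOpen_Ioi
  have h2 : MeasurableSet {z : E n × ℝ | z.1 ∈ Metric.closedBall x₀ ρ} :=
    (Metric.isClosed_closedBall.preimage continuous_fst).measurableSet
  convert h1.measurableSet.inter h2 using 1
  ext z; simp only [superlevel, mem_ofPred_eq, mem_inter_iff, mem_preimage, mem_Ioi]; tauto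

lemma volume_superlevel_ne_top (S : SolutionData p Λ D τ x₀ r k₀ M β v G a) (ρ k : ℝ) :
    volume (superlevel D τ v x₀ ρ k) ≠ ∞ :=
  measure_ne_top_of_subset (fun _ hz => hz.1) S.volume_cylinder

/-- Measure of the superlevel set on a time slice. -/
lemma mul_volume_slice_le (S : SolutionData p Λ D τ x₀ r k₀ M β v G a) (hp : 2 ≤ p) (hΛ : 1 ≤ Λ)
    (hF : ∀ s, HasDerivAt F (f s) s) (hf : Continuous f) (hf0 : ∀ s, 0 ≤ f s)
    (hk : k₀ < k) (hFk : ∀ s ≤ k, F s = 0) (hN0 : 0 ≤ N)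
    (hN : ∀ s ≤ M, F s ^ p ≤ N * f s ^ (p - 1)) (hζ : IsSpaceCutoff x₀ ρ' ρ L ζ) (hρ : ρ < r)
    (hm : p ≤ m) (hkk : k ≤ k') (t : ℝ) :
    jumpPrimitive f id k k' * volume.real {x | (x, t) ∈ superlevel D τ v x₀ ρ' k'}
      ≤ energyConst p Λ m * N * L ^ p * volume.real (superlevel D τ v x₀ ρ k) := by
  have hR0 : 0 ≤ energyConst p Λ m * N * L ^ p := by
    have := hζ.nonneg
    rw [energyConst]; positivity
  by_cases ht : t ∈ Ioo 0 τ
  swap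
  · have : {x | (x, t) ∈ superlevel D τ v x₀ ρ' k'} = ∅ :=
      eq_empty_of_forall_notMem fun x hx => ht hx.1.2
    rw [this]; simp; positivity
  have hDm : MeasurableSet D := S.isOpen.measurableSet
  have hJc := continuous_jumpPrimitive_id hF hf (hFk k le_rfl)
  have hJ0 := jumpPrimitive_nonneg hf0 monotone_id k
  have hmain := S.setIntegral_slice_le (J := jumpPrimitive f id k) (ζ := fun x => ζ x ^ m)
    (R := energyConst p Λ m * N * L ^ p * volume.real (superlevel D τ v x₀ ρ k)) hJc
    (hζ.contDiff.continuous.pow m)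
    (fun x => ⟨pow_nonneg (hζ.mem_Icc x).1 _, pow_le_one₀ (hζ.mem_Icc x).1 (hζ.mem_Icc x).2⟩)
    (fun χ χ' hχ hχc hχL hχ0 ⟨t₂, ht₂, hχt⟩ hχ' => by
      have h1 := S.caccioppoli hp hΛ hF hf hf0 hk hFk hN0 hN hζ.contDiff hζ.mem_Icc
        hζ.hasCompactSupport (hζ.tsupport_subset_ball hρ) hζ.norm_fderiv_le hm hχ hχc hχL hχ0 ht₂
        hχt hχ' (S.measurableSet_superlevel ρ k) (fun z hz => hz.1)
        fun z hz h2 h3 => ⟨hz, hζ.tsupport_subset h3, h2⟩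
      have h2 : 0 ≤ (2 * Λ)⁻¹ *
          ∫ z in D ×ˢ Ioo 0 τ, f (v z) * ‖G z‖ ^ p * (ζ z.1 ^ m * χ z.2) :=
        mul_nonneg (by positivity) (integral_nonneg fun z => mul_nonneg
          (mul_nonneg (hf0 _) (by positivity))
          (mul_nonneg (pow_nonneg (hζ.mem_Icc _).1 _) (hχ0 _).1))
      rw [energyConst]
      linarith) ht
  refine le_trans ?_ hmain
  set A := {x | (x, t) ∈ superlevel D τ v x₀ ρ' k'} with hA
  have hAm : MeasurableSet A := (S.measurableSet_superlevel ρ' k').preimage (by fun_prop)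
  have hAD : A ⊆ D := fun x hx => hx.1.1
  obtain ⟨C, hC⟩ := S.bdd
  obtain ⟨CJ, hCJ⟩ := (isCompact_Icc (a := -C) (b := C)).exists_bound_of_continuousOn hJc.continuousOn
  have hDfin : IsFiniteMeasure (volume.restrict D) := ⟨by simpa using S.finite.lt_top⟩
  have hi : IntegrableOn (fun x => jumpPrimitive f id k (v (x, t)) * ζ x ^ m) D := by
    refine Integrable.of_bound (ContinuousOn.aestronglyMeasurable ?_ hDm) CJ
      ((ae_restrict_iff' hDm).2 (ae_of_all _ fun x hx => ?_))
    · refine ContinuousOn.mul (hJc.comp_continuousOn ?_)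
        (hζ.contDiff.continuous.pow m).continuousOn
      exact S.cont.comp (by fun_prop) fun x hx => ⟨hx, ht⟩
    · rw [norm_mul, Real.norm_of_nonneg (pow_nonneg (hζ.mem_Icc x).1 m)]
      exact (mul_le_of_le_one_right (norm_nonneg _)
        (pow_le_one₀ (hζ.mem_Icc x).1 (hζ.mem_Icc x).2)).trans
        (hCJ _ (abs_le.1 (hC (x, t) ⟨hx, ht⟩)))
  -- Chebyshev's inequality: `ζ = 1` on the smaller ball, and the energy is increasing above `k`.
  calc jumpPrimitive f id k k' * volume.real A
      = ∫ x in A, jumpPrimitive f id k k' := by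
        rw [setIntegral_const, smul_eq_mul, mul_comm]
    _ ≤ ∫ x in A, jumpPrimitive f id k (v (x, t)) * ζ x ^ m := by
        have hAfin : volume A ≠ ∞ := measure_ne_top_of_subset hAD S.finite
        refine setIntegral_mono_on (integrableOn_const hAfin) (hi.mono_set hAD) hAm
          fun x hx => ?_
        rw [hζ.eq_one x hx.2.1, one_pow, mul_one]
        exact monotoneOn_jumpPrimitive_id hF hf hf0 (hFk k le_rfl) hkk
          (hkk.trans hx.2.2.le) hx.2.2.le
    _ ≤ _ := by
        refine setIntegral_mono_set hi (ae_of_all _ fun x => ?_) (LE.le.eventuallyLE hAD)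
        exact mul_nonneg (hJ0 _) (pow_nonneg (hζ.mem_Icc x).1 _)

/-- Measure of the superlevel set on the whole cylinder. -/
lemma mul_volume_superlevel_le (S : SolutionData p Λ D τ x₀ r k₀ M β v G a) (hp : 2 ≤ p)
    (hΛ : 1 ≤ Λ) (hτ : 0 ≤ τ) (hF : ∀ s, HasDerivAt F (f s) s) (hf : Continuous f)
    (hf0 : ∀ s, 0 ≤ f s) (hk : k₀ < k) (hFk : ∀ s ≤ k, F s = 0) (hN0 : 0 ≤ N)
    (hN : ∀ s ≤ M, F s ^ p ≤ N * f s ^ (p - 1)) (hζ : IsSpaceCutoff x₀ ρ' ρ L ζ) (hρ : ρ < r)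
    (hm : p ≤ m) (hkk : k ≤ k') :
    jumpPrimitive f id k k' * volume.real (superlevel D τ v x₀ ρ' k')
      ≤ τ * (energyConst p Λ m * N * L ^ p * volume.real (superlevel D τ v x₀ ρ k)) := by
  set A := superlevel D τ v x₀ ρ' k' with hA
  set R := energyConst p Λ m * N * L ^ p * volume.real (superlevel D τ v x₀ ρ k) with hR
  have hJ0 := jumpPrimitive_nonneg hf0 monotone_id k k'
  have hslice := fun t => S.mul_volume_slice_le hp hΛ hF hf hf0 hk hFk hN0 hN hζ hρ hm hkk t
  have hAm := S.measurableSet_superlevel ρ' k'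
  have hR0 : 0 ≤ R := le_trans (by positivity) (hslice 0)
  have hfinD : volume D ≠ ∞ := S.finite
  have h1 : ENNReal.ofReal (jumpPrimitive f id k k') * volume A
      ≤ ENNReal.ofReal R * ENNReal.ofReal τ := by
    rw [Measure.volume_eq_prod, Measure.prod_apply_symm hAm,
      ← lintegral_const_mul _ (measurable_measure_prodMk_right hAm)]
    calc ∫⁻ t, ENNReal.ofReal (jumpPrimitive f id k k') * volume ((fun x => (x, t)) ⁻¹' A)
        ≤ ∫⁻ t, (Ioo 0 τ).indicator (fun _ => ENNReal.ofReal R) t := by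
          refine lintegral_mono fun t => ?_
          by_cases ht : t ∈ Ioo 0 τ
          · rw [indicator_of_mem ht]
            have hfin : volume ((fun x => (x, t)) ⁻¹' A) ≠ ∞ :=
              measure_ne_top_of_subset (fun x hx => hx.1.1) hfinD
            rw [← ENNReal.ofReal_toReal hfin, ← ENNReal.ofReal_mul hJ0]
            exact ENNReal.ofReal_le_ofReal (hslice t)
          · have : (fun x => (x, t)) ⁻¹' A = ∅ :=
              eq_empty_of_forall_notMem fun x hx => ht hx.1.2
            simp [this]
      _ = _ := by
          rw [lintegral_indicator measurableSet_Ioo, setLIntegral_const, Real.volume_Ioo, sub_zero]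
  have h2 := ENNReal.toReal_mono (ENNReal.mul_ne_top ENNReal.ofReal_ne_top ENNReal.ofReal_ne_top) h1
  rw [ENNReal.toReal_mul, ENNReal.toReal_mul, ENNReal.toReal_ofReal hJ0, ENNReal.toReal_ofReal hR0,
    ENNReal.toReal_ofReal hτ] at h2
  rw [mul_comm τ]
  exact h2

end SolutionData

end

/-! ### From the Caccioppoli and Sobolev inequalities to a measure estimate. -/

section

variable {n : ℕ}

/-- The first term dominates for `x ≥ l`, the second for `x ≤ l`. It converts the `L^p` energy into
the `L¹` gradient norm of the Sobolev inequality, with a free scale `l`. -/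
lemma le_rpow_mul_rpow_add {p l x : ℝ} (hp : 1 ≤ p) (hl : 0 < l) (hx : 0 ≤ x) :
    x ≤ l ^ (1 - p) * x ^ p + l := by
  rcases le_total x l with h | h
  · have : 0 ≤ l ^ (1 - p) * x ^ p := by positivity
    linarith
  · have hx0 : 0 < x := hl.trans_le h
    have h1 : x ^ (1 - p) ≤ l ^ (1 - p) :=
      Real.rpow_le_rpow_of_nonpos hl h (by linarith)
    have h2 : x ^ (1 - p) * x ^ p = x := by
      rw [← Real.rpow_add hx0]; simp
    have h3 : x ^ (1 - p) * x ^ p ≤ l ^ (1 - p) * x ^ p :=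
      mul_le_mul_of_nonneg_right h1 (by positivity)
    linarith

namespace SolutionData

variable {p Λ : ℝ} {D : Set (E n)} {τ : ℝ} {x₀ : E n} {r k₀ M : ℝ} {β : ℝ → ℝ}
    {v : E n × ℝ → ℝ} {G a : E n × ℝ → E n} {F f : ℝ → ℝ} {ζ : E n → ℝ} {ρ' ρ L k k' N : ℝ}
    {m : ℕ}

/-- The gradient term of the Sobolev inequality, estimated by the Caccioppoli inequality. -/
lemma lintegral_grad_truncation_le (S : SolutionData p Λ D τ x₀ r k₀ M β v G a) (hp : 2 ≤ p)
    (hΛ : 1 ≤ Λ) (hF : ∀ s, HasDerivAt F (f s) s) (hf : Continuous f) (hf0 : ∀ s, 0 ≤ f s)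
    (hk : k₀ < k) (hFk : ∀ s ≤ k, F s = 0) (hN0 : 0 ≤ N)
    (hN : ∀ s ≤ M, F s ^ p ≤ N * f s ^ (p - 1)) (hζ : IsSpaceCutoff x₀ ρ' ρ L ζ) (hρ : ρ < r)
    (hm : p ≤ m) {χ χ' : ℝ → ℝ} (hχ : ∀ t, HasDerivAt χ (χ' t) t) (hχc : Continuous χ')
    (hχL : ∃ L, ∀ t, |χ' t| ≤ L) (hχ0 : ∀ t, χ t ∈ Icc (0 : ℝ) 1) {t₂ : ℝ} (ht₂ : t₂ < τ)
    (hχt : ∀ t ≥ t₂, χ t = 0) (hχ' : ∀ t, χ' t ≤ 0) {fm Fm : ℝ} (hfm : ∀ s ≤ M, f s ≤ fm)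
    (hFm : ∀ s ≤ M, F s ≤ Fm) (hFm0 : 0 ≤ Fm) {l : ℝ} (hl : 0 < l) :
    ∫⁻ z in D ×ˢ Ioo 0 τ, ‖((ζ z.1 ^ m * χ z.2) * f (v z)) • G z
        + F (v z) • spaceGrad (fun z : E n × ℝ => ζ z.1 ^ m * χ z.2) z‖ₑ
      ≤ ENNReal.ofReal ((l ^ (1 - p) * (2 * Λ * (energyConst p Λ m * N * L ^ p))
          + (l * fm + Fm * (m * L))) * volume.real (superlevel D τ v x₀ ρ k)) := by
  set U := D ×ˢ Ioo 0 τ with hU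
  set W := superlevel D τ v x₀ ρ k with hW
  set c : E n × ℝ → ℝ := fun z => ζ z.1 ^ m * χ z.2 with hc
  have hUm : MeasurableSet U := S.isOpen_cylinder.measurableSet
  have hWm : MeasurableSet W := S.measurableSet_superlevel ρ k
  have hWU : W ⊆ U := fun z hz => hz.1
  have hL0 := hζ.nonneg
  have hm0 : m ≠ 0 := by
    rintro rfl
    simp only [Nat.cast_zero] at hm; linarith
  have hFmono := monotone_of_hasDerivAt_nonneg hF hf0
  have hFv : ∀ s, 0 ≤ F s := fun s => by
    rcases le_total s k with h | h
    · rw [hFk s h]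
    · rw [← hFk k le_rfl]; exact hFmono h
  -- The level `k` itself is included since `F` attains its minimum there; superlevel sets are
  -- defined by the strict inequality.
  have hfk : ∀ s ≤ k, f s = 0 := fun s hs => by
    have h1 : IsLocalMin F s := Eventually.of_forall fun y => by rw [hFk s hs]; exact hFv y
    exact h1.hasDerivAt_eq_zero (hF s)
  have hcd : ContDiff ℝ 1 c := contDiff_spaceTimeCutoff hζ.contDiff hχ hχc
  have hcs : tsupport c ⊆ {z | z.1 ∈ tsupport ζ ∧ z.2 ≤ t₂} :=
    tsupport_spaceTimeCutoff_subset hm0 hχt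
  have hc0 : ∀ z, c z ∈ Icc (0 : ℝ) 1 := fun z => by
    have h1 := pow_nonneg (hζ.mem_Icc z.1).1 m
    have h2 : ζ z.1 ^ m ≤ 1 := pow_le_one₀ (hζ.mem_Icc z.1).1 (hζ.mem_Icc z.1).2
    exact ⟨mul_nonneg h1 (hχ0 _).1, mul_le_one₀ h2 (hχ0 _).1 (hχ0 _).2⟩
  set R₂ := l * fm + Fm * (m * L) with hR₂
  set X : E n × ℝ → ℝ := fun z => f (v z) * ‖G z‖ ^ p * c z with hX
  have hX0 : ∀ z, 0 ≤ X z := fun z => mul_nonneg (mul_nonneg (hf0 _) (by positivity)) (hc0 z).1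
  have hXi : IntegrableOn X U := S.integrableOn_energy hp hf hk (fun s hs => hfk s hs.le)
    hcd.continuous hζ.hasCompactSupport (hζ.tsupport_subset_ball hρ) ht₂
    fun z hz => hcs (subset_tsupport c hz)
  have hUfin : IsFiniteMeasure (volume.restrict U) := ⟨by simpa using S.volume_cylinder.lt_top⟩
  have hWi : IntegrableOn (W.indicator fun _ => R₂) U :=
    (integrable_const (μ := volume.restrict U) R₂).indicator hWm
  have hpt : ∀ z ∈ U, ‖(c z * f (v z)) • G z + F (v z) • spaceGrad c z‖
      ≤ l ^ (1 - p) * X z + W.indicator (fun _ => R₂) z := by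
    intro z hz
    have hg := norm_spaceGrad_cutoff_le (m := m) hζ.contDiff hζ.mem_Icc hχ0 hζ.norm_fderiv_le z
    refine (norm_add_le _ _).trans ?_
    rw [norm_smul, norm_smul, Real.norm_of_nonneg (mul_nonneg (hc0 z).1 (hf0 _)),
      Real.norm_of_nonneg (hFv _)]
    have hXl : 0 ≤ l ^ (1 - p) * X z := mul_nonneg (by positivity) (hX0 z)
    by_cases hzW : z ∈ W
    · rw [indicator_of_mem hzW]
      have e1 : c z * f (v z) * ‖G z‖ ≤ l ^ (1 - p) * X z + l * fm := by
        calc c z * f (v z) * ‖G z‖ ≤ c z * f (v z) * (l ^ (1 - p) * ‖G z‖ ^ p + l) :=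
              mul_le_mul_of_nonneg_left (le_rpow_mul_rpow_add (by linarith) hl (norm_nonneg _))
                (mul_nonneg (hc0 z).1 (hf0 _))
          _ = l ^ (1 - p) * X z + l * (c z * f (v z)) := by rw [hX]; ring
          _ ≤ _ := by
              gcongr
              exact (mul_le_of_le_one_left (hf0 _) (hc0 z).2).trans (hfm _ (S.le_sup z hz))
      have e2 : F (v z) * ‖spaceGrad c z‖ ≤ Fm * (m * L) := by
        refine mul_le_mul (hFm _ (S.le_sup z hz)) (hg.trans ?_) (norm_nonneg _) hFm0
        have h1 : m * ζ z.1 ^ (m - 1) * L ≤ m * L := by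
          refine mul_le_mul_of_nonneg_right (mul_le_of_le_one_right m.cast_nonneg ?_) hL0
          exact pow_le_one₀ (hζ.mem_Icc _).1 (hζ.mem_Icc _).2
        have h2 : 0 ≤ m * ζ z.1 ^ (m - 1) * L :=
          mul_nonneg (mul_nonneg m.cast_nonneg (pow_nonneg (hζ.mem_Icc _).1 _)) hL0
        exact (mul_le_of_le_one_left h2 (hχ0 _).2).trans h1
      rw [hR₂]; linarith
    · rw [indicator_of_notMem hzW, add_zero]
      suffices h : c z * f (v z) * ‖G z‖ + F (v z) * ‖spaceGrad c z‖ = 0 by rw [h]; exact hXl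
      by_cases h1 : k < v z
      · have h2 : z.1 ∉ tsupport ζ := fun h => hzW ⟨hz, hζ.tsupport_subset h, h1⟩
        have h3 : spaceGrad c z = 0 := by
          by_contra h0
          exact h2 (hcs (support_spaceGrad_subset hcd h0)).1
        have h4 : c z = 0 := by
          simp [hc, image_eq_zero_of_notMem_tsupport h2, hm0]
        simp [h3, h4]
      · simp [hfk _ (not_lt.1 h1), hFk _ (not_lt.1 h1)]
  have hcac := S.caccioppoli hp hΛ hF hf hf0 hk hFk hN0 hN hζ.contDiff hζ.mem_Icc
    hζ.hasCompactSupport (hζ.tsupport_subset_ball hρ) hζ.norm_fderiv_le hm hχ hχc hχL hχ0 ht₂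
    hχt hχ' hWm hWU fun z hz h2 h3 => ⟨hz, hζ.tsupport_subset h3, h2⟩
  have hJ : 0 ≤ -(∫ z in U, jumpPrimitive f id k (v z) * ζ z.1 ^ m * χ' z.2) := by
    rw [← integral_neg]
    refine integral_nonneg fun z => ?_
    have h1 := mul_nonneg (jumpPrimitive_nonneg hf0 monotone_id k (v z))
      (pow_nonneg (hζ.mem_Icc z.1).1 m)
    exact neg_nonneg.2 (mul_nonpos_of_nonneg_of_nonpos h1 (hχ' _))
  have hΛ0 : 0 < Λ := by linarith
  have hXle : ∫ z in U, X z ≤ 2 * Λ * (energyConst p Λ m * N * L ^ p) * volume.real W := by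
    have h1 : (2 * Λ)⁻¹ * ∫ z in U, X z ≤ energyConst p Λ m * N * L ^ p * volume.real W := by
      rw [energyConst]; linarith
    rw [inv_mul_le_iff₀ (by positivity)] at h1
    linarith
  calc ∫⁻ z in U, ‖(c z * f (v z)) • G z + F (v z) • spaceGrad c z‖ₑ
      ≤ ∫⁻ z in U, ENNReal.ofReal (l ^ (1 - p) * X z + W.indicator (fun _ => R₂) z) := by
        refine setLIntegral_mono' hUm fun z hz => ?_
        rw [← ofReal_norm]
        exact ENNReal.ofReal_le_ofReal (hpt z hz)
    _ = ENNReal.ofReal (∫ z in U, (l ^ (1 - p) * X z + W.indicator (fun _ => R₂) z)) := by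
        refine (ofReal_integral_eq_lintegral_ofReal ((hXi.const_mul _).add hWi)
          ((ae_restrict_iff' hUm).2 (ae_of_all _ fun z hz => ?_))).symm
        exact (norm_nonneg _).trans (hpt z hz)
    _ ≤ _ := by
        refine ENNReal.ofReal_le_ofReal ?_
        rw [integral_add (hXi.const_mul _) hWi, integral_const_mul, setIntegral_indicator hWm,
          setIntegral_const, smul_eq_mul, inter_eq_right.2 hWU]
        have := mul_le_mul_of_nonneg_left hXle (by positivity : 0 ≤ l ^ (1 - p))
        linarith

/-- The basic measure estimate for superlevel sets in the De Giorgi iteration. -/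
lemma mul_volume_superlevel_le_sobolev (S : SolutionData p Λ D τ x₀ r k₀ M β v G a) (hn : 2 ≤ n)
    (hp : 2 ≤ p) (hΛ : 1 ≤ Λ) (hF : ∀ s, HasDerivAt F (f s) s) (hf : Continuous f)
    (hf0 : ∀ s, 0 ≤ f s) (hk : k₀ < k) (hFk : ∀ s ≤ k, F s = 0) (hN0 : 0 ≤ N)
    (hN : ∀ s ≤ M, F s ^ p ≤ N * f s ^ (p - 1)) (hζ : IsSpaceCutoff x₀ ρ' ρ L ζ) (hρ : ρ < r)
    (hm : p ≤ m) (hkk : k ≤ k') {fm Fm : ℝ} (hfm : ∀ s ≤ M, f s ≤ fm)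
    (hfm0 : 0 ≤ fm) (hFm : ∀ s ≤ M, F s ≤ Fm) (hFm0 : 0 ≤ Fm) {l : ℝ} (hl : 0 < l)
    {s : ℝ} (hs0 : 0 ≤ s)
    (hs : energyConst p Λ m * N * L ^ p * volume.real (superlevel D τ v x₀ ρ k)
      ≤ jumpPrimitive f id k k' * s) (hJ : 0 < jumpPrimitive f id k k') :
    F k' * volume.real (superlevel D τ v x₀ ρ' k')
      ≤ sobolevConst n * s ^ (1 / (n : ℝ)) *
        ((l ^ (1 - p) * (2 * Λ * (energyConst p Λ m * N * L ^ p))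
          + (l * fm + Fm * (m * L))) * volume.real (superlevel D τ v x₀ ρ k)) := by
  set A := superlevel D τ v x₀ ρ' k' with hA
  set R := (l ^ (1 - p) * (2 * Λ * (energyConst p Λ m * N * L ^ p))
          + (l * fm + Fm * (m * L))) * volume.real (superlevel D τ v x₀ ρ k) with hR
  have hL0 := hζ.nonneg
  have hm0 : m ≠ 0 := by
    rintro rfl
    simp only [Nat.cast_zero] at hm; linarith
  have hR0 : 0 ≤ R := by
    rw [hR, energyConst]; positivity
  have hFmono := monotone_of_hasDerivAt_nonneg hF hf0
  have hFk' : 0 ≤ F k' := by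
    rw [← hFk k le_rfl]; exact hFmono hkk
  have hAm : MeasurableSet A := S.measurableSet_superlevel ρ' k'
  have hUm : MeasurableSet (D ×ˢ Ioo 0 τ) := S.isOpen_cylinder.measurableSet
  -- The energy part of the Caccioppoli inequality bounds every slice, its gradient part the right
  -- side of the Sobolev inequality; together they make the estimate superlinear in the measure.
  have hslice : ∀ t, volume {x | (x, t) ∈ A} ≤ ENNReal.ofReal s := fun t => by
    have h1 := S.mul_volume_slice_le hp hΛ hF hf hf0 hk hFk hN0 hN hζ hρ hm hkk t
    have hfin : volume {x | (x, t) ∈ A} ≠ ∞ :=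
      measure_ne_top_of_subset (fun x hx => hx.1.1) S.finite
    rw [← ENNReal.ofReal_toReal hfin]
    exact ENNReal.ofReal_le_ofReal (le_of_mul_le_mul_left (h1.trans hs) hJ)
  -- Admissible time cutoffs vanish before `τ`, so `A` is exhausted by pieces on which such a cutoff
  -- is still one.
  set B : ℕ → Set (E n × ℝ) := fun j => A ∩ {z | z.2 ≤ τ - 1 / ((j : ℝ) + 1)} with hB
  have hBm : ∀ j, MeasurableSet (B j) := fun j =>
    hAm.inter (isClosed_le continuous_snd continuous_const).measurableSet
  have hstep : ∀ j, ENNReal.ofReal (F k') * volume (B j)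
      ≤ ENNReal.ofReal (sobolevConst n * s ^ (1 / (n : ℝ)) * R) := by
    intro j
    set δ := 1 / ((j : ℝ) + 1) with hδ
    have hδ0 : 0 < δ := by positivity
    obtain ⟨χ, χ', hχ, hχc, hχL, hχ0, hχ1, hχt, hχ', -⟩ := exists_timeCutoff (τ - δ) (half_pos hδ0)
    have ht₂ : τ - δ + δ / 2 < τ := by linarith
    have hcd : ContDiff ℝ 1 fun z : E n × ℝ => ζ z.1 ^ m * χ z.2 :=
      contDiff_spaceTimeCutoff hζ.contDiff hχ hχc
    have hcs : tsupport (fun z : E n × ℝ => ζ z.1 ^ m * χ z.2)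
        ⊆ {z | z.1 ∈ tsupport ζ ∧ z.2 ≤ τ - δ + δ / 2} :=
      tsupport_spaceTimeCutoff_subset hm0 hχt
    obtain ⟨k₁, hk₀₁, hk₁⟩ := exists_between hk
    obtain ⟨K₁, hK₁U, hK₁, hK⟩ := S.compact_superlevel _ (hζ.tsupport_subset_ball hρ)
      hζ.hasCompactSupport _ ht₂ k₁ hk₀₁
    obtain ⟨K, hKU, hap⟩ := exists_hasC1Approx (by linarith : 1 ≤ p) S.isOpen_cylinder S.cont
      S.grad_meas S.grad hF hf hk₁ hFk hcd hK₁ hK₁U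
      fun z hz h1 h2 => hK z hz (hcs h1).1 (hcs h1).2 h2
    have hsob := hap.setLIntegral_le_sobolev hn (by linarith) (hBm j) ENNReal.ofReal_ne_top
      fun t => (measure_mono fun x (hx : (x, t) ∈ B j) => hx.1).trans (hslice t)
    have hlow : ENNReal.ofReal (F k') * volume (B j) ≤ ∫⁻ z in B j,
        ‖(D ×ˢ Ioo 0 τ).indicator (fun z => F (v z) * (ζ z.1 ^ m * χ z.2)) z‖ₑ := by
      rw [← setLIntegral_const]
      refine setLIntegral_mono' (hBm j) fun z hz => ?_
      have h1 : z.2 ≤ τ - δ := hz.2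
      rw [indicator_of_mem hz.1.1, hζ.eq_one _ hz.1.2.1, hχ1 _ h1, one_pow, mul_one, mul_one]
      have h2 : F k' ≤ F (v z) := hFmono hz.1.2.2.le
      rw [← ofReal_norm, Real.norm_of_nonneg (hFk'.trans h2)]
      exact ENNReal.ofReal_le_ofReal h2
    have hgrad := S.lintegral_grad_truncation_le hp hΛ hF hf hf0 hk hFk hN0 hN hζ hρ hm hχ hχc hχL
      hχ0 ht₂ hχt hχ' hfm hFm hFm0 hl
    rw [← lintegral_indicator hUm] at hgrad
    refine hlow.trans (hsob.trans ?_)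
    have hind : ∫⁻ z, ‖(D ×ˢ Ioo 0 τ).indicator (fun z => ((ζ z.1 ^ m * χ z.2) * f (v z)) • G z
        + F (v z) • spaceGrad (fun z : E n × ℝ => ζ z.1 ^ m * χ z.2) z) z‖ₑ ≤ ENNReal.ofReal R := by
      simp_rw [enorm_indicator_eq_indicator_enorm]
      exact hgrad
    rw [ENNReal.ofReal_mul (by positivity), ENNReal.ofReal_mul (by positivity),
      ENNReal.ofReal_coe_nnreal, ENNReal.ofReal_rpow_of_nonneg hs0 (by positivity)]
    gcongr
  have hlim : Tendsto (fun j => ENNReal.ofReal (F k') * volume (B j)) atTop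
      (𝓝 (ENNReal.ofReal (F k') * volume A)) := by
    have hmono : Monotone B := by
      intro i j hij z hz
      refine ⟨hz.1, (show z.2 ≤ _ from hz.2).trans ?_⟩
      have : 1 / ((j : ℝ) + 1) ≤ 1 / ((i : ℝ) + 1) := by gcongr
      linarith
    have hU : ⋃ j, B j = A := by
      refine subset_antisymm (iUnion_subset fun j => inter_subset_left) fun z hz => ?_
      obtain ⟨j, hj⟩ := exists_nat_one_div_lt (sub_pos.2 hz.1.2.2)
      exact mem_iUnion.2 ⟨j, hz, show z.2 ≤ _ by linarith⟩
    have h1 := tendsto_measure_iUnion_atTop (μ := volume) hmono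
    rw [hU] at h1
    exact ENNReal.Tendsto.const_mul h1 (Or.inr ENNReal.ofReal_ne_top)
  have hfin := le_of_tendsto' hlim hstep
  have h2 := ENNReal.toReal_mono ENNReal.ofReal_ne_top hfin
  rwa [ENNReal.toReal_mul, ENNReal.toReal_ofReal hFk', ENNReal.toReal_ofReal (by positivity)] at h2

end SolutionData

end

/-! ### The De Giorgi iteration. -/

section

variable {n : ℕ}

/-! ### The De Giorgi iteration -/

/-- Fast geometric convergence. -/
lemma geometric_decay (hn : n ≠ 0) {K a b : ℝ} (hK : 0 < K) (ha : 1 ≤ a) (hb : 1 ≤ b)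
    {Y : ℕ → ℝ} (hY0 : ∀ j, 0 ≤ Y j)
    (hY : ∀ j, Y (j + 1) ≤ K * a ^ j * (b ^ j * Y j) ^ (1 / (n : ℝ)) * Y j)
    (h0 : Y 0 ≤ ((a ^ n * b)⁻¹ / K) ^ n) (j : ℕ) : Y j ≤ ((a ^ n * b)⁻¹) ^ j * Y 0 := by
  have ha0 : 0 < a := by linarith
  have hb0 : 0 < b := by linarith
  set q := (a ^ n * b)⁻¹ with hq
  have hq0 : 0 < q := by positivity
  induction j with
  | zero => simp
  | succ j ih =>
    -- The ratio `q` is chosen with `b q = a ^ (-n)`, so the `n`-th root produces exactly the factor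
    -- that cancels `a ^ j`.
    have h1 : b ^ j * Y j ≤ ((a ^ j)⁻¹ * (q / K)) ^ n := by
      calc b ^ j * Y j ≤ b ^ j * (q ^ j * (q / K) ^ n) := by gcongr; exact ih.trans (by gcongr)
        _ = (b * q) ^ j * (q / K) ^ n := by rw [mul_pow]; ring
        _ = ((a ^ n)⁻¹) ^ j * (q / K) ^ n := by
            rw [hq, mul_inv, mul_comm _ b⁻¹, ← mul_assoc, mul_inv_cancel₀ hb0.ne', one_mul]
        _ = _ := by rw [mul_pow, inv_pow, inv_pow, ← pow_mul, ← pow_mul, mul_comm n j]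
    have h2 : (b ^ j * Y j) ^ (1 / (n : ℝ)) ≤ (a ^ j)⁻¹ * (q / K) := by
      calc (b ^ j * Y j) ^ (1 / (n : ℝ)) ≤ (((a ^ j)⁻¹ * (q / K)) ^ n) ^ (1 / (n : ℝ)) :=
            Real.rpow_le_rpow (mul_nonneg (by positivity) (hY0 j)) h1 (by positivity)
        _ = _ := by rw [one_div]; exact Real.pow_rpow_inv_natCast (by positivity) hn
    calc Y (j + 1) ≤ K * a ^ j * (b ^ j * Y j) ^ (1 / (n : ℝ)) * Y j := hY j
      _ ≤ K * a ^ j * ((a ^ j)⁻¹ * (q / K)) * Y j := by gcongr; exact hY0 j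
      _ = q * Y j := by field_simp
      _ ≤ q * (q ^ j * Y 0) := by gcongr
      _ = _ := by ring

lemma hasDerivAt_sq_posPart (k s : ℝ) :
    HasDerivAt (fun s => max (s - k) 0 ^ 2) (2 * max (s - k) 0) s := by
  have hg : ∀ y ≠ k, HasDerivAt (fun s => max (s - k) 0 ^ 2) (2 * max (y - k) 0) y := by
    intro y hy
    rcases lt_or_gt_of_ne hy with h | h
    · rw [max_eq_right (by linarith), mul_zero]
      refine (hasDerivAt_const y (0 : ℝ)).congr_of_eventuallyEq ?_
      filter_upwards [Iio_mem_nhds h] with s hs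
      rw [max_eq_right (by linarith [mem_Iio.1 hs])]; simp
    · rw [max_eq_left (by linarith)]
      have h1 : HasDerivAt (fun s => (s - k) ^ 2) (2 * (y - k)) y := by
        simpa using ((hasDerivAt_id y).sub_const k).fun_pow 2
      refine h1.congr_of_eventuallyEq ?_
      filter_upwards [Ioi_mem_nhds h] with s hs
      rw [max_eq_left (by linarith [mem_Ioi.1 hs])]
  by_cases hs : s = k
  · subst hs
    exact hasDerivAt_of_hasDerivAt_of_ne (g := fun y => 2 * max (y - s) 0) hg
      (by fun_prop) (by fun_prop)
  · exact hg s hs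

namespace SolutionData

variable {p Λ : ℝ} {D : Set (E n)} {τ : ℝ} {x₀ : E n} {r k₀ M : ℝ} {β : ℝ → ℝ}
    {v : E n × ℝ → ℝ} {G a : E n × ℝ → E n} {ζ : E n → ℝ} {ρ' ρ L k k' θ : ℝ} {m : ℕ}

/-- The measure estimate for `F = (s - k)₊²`, where the square makes `F` of class `C¹`. Since `(s -
k)₊ ≤ θ` up to `M`, the structural inequality holds with `N = θ ^ (p + 1)`. The scale `l = θ L`
gives all parts of the gradient bound the common size `θ² L`. -/
lemma deGiorgi_step (S : SolutionData p Λ D τ x₀ r k₀ M β v G a) (hn : 2 ≤ n) (hp : 2 ≤ p)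
    (hΛ : 1 ≤ Λ) (hk : k₀ < k) (hkk : k < k') (hθ : 0 < θ) (hM : M - k ≤ θ) (hL : 0 < L)
    (hζ : IsSpaceCutoff x₀ ρ' ρ L ζ) (hρ : ρ < r) (hm : p ≤ m) :
    (k' - k) ^ 2 * volume.real (superlevel D τ v x₀ ρ' k')
      ≤ sobolevConst n * (8 / (k' - k) ^ 3 * (energyConst p Λ m * θ ^ (p + 1) * L ^ p
          * volume.real (superlevel D τ v x₀ ρ k))) ^ (1 / (n : ℝ))
        * ((2 * Λ * energyConst p Λ m + 2 + m) * θ ^ 2 * L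
          * volume.real (superlevel D τ v x₀ ρ k)) := by
  set F : ℝ → ℝ := fun s => max (s - k) 0 ^ 2 with hFd
  set f : ℝ → ℝ := fun s => 2 * max (s - k) 0 with hfd
  have hF : ∀ s, HasDerivAt F (f s) s := hasDerivAt_sq_posPart k
  have hf : Continuous f := by fun_prop
  have hf0 : ∀ s, 0 ≤ f s := fun s => by simp only [hfd]; positivity
  have hFk : ∀ s ≤ k, F s = 0 := fun s hs => by
    simp only [hFd]; rw [max_eq_right (by linarith)]; simp
  have hmax : ∀ s ≤ M, max (s - k) 0 ≤ θ := fun s hs => max_le (by linarith) hθ.le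
  have hN : ∀ s ≤ M, F s ^ p ≤ θ ^ (p + 1) * f s ^ (p - 1) := fun s hs => by
    set h := max (s - k) 0 with hh
    have hh0 : 0 ≤ h := le_max_right _ _
    have e1 : F s ^ p = h ^ (p + 1) * h ^ (p - 1) := by
      simp only [hFd]
      rw [← hh, ← Real.rpow_natCast, ← Real.rpow_mul hh0, ← Real.rpow_add_of_nonneg hh0
        (by linarith) (by linarith)]
      congr 1; push_cast; ring
    have e2 : h ^ (p - 1) ≤ f s ^ (p - 1) :=
      Real.rpow_le_rpow hh0 (by simp only [hfd]; linarith) (by linarith)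
    rw [e1]
    gcongr
    exact hmax s hs
  have hh : 0 < k' - k := by linarith
  -- The convexity inequality based at the midpoint of `k` and `k'`.
  have hJ : (k' - k) ^ 3 / 8 ≤ jumpPrimitive f id k k' := by
    have h1 := mul_sub_le_jumpPrimitive_sub hF hf hf0 monotone_id (hFk k le_rfl) k' ((k + k') / 2)
    have h2 := jumpPrimitive_nonneg hf0 monotone_id k ((k + k') / 2)
    simp only [hFd, id] at h1
    rw [max_eq_left (by linarith)] at h1
    have h3 : ((k + k') / 2 - k) ^ 2 * (k' - (k + k') / 2) = (k' - k) ^ 3 / 8 := by ring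
    linarith
  have hΛ0 : 0 < Λ := by linarith
  have hE : 0 ≤ energyConst p Λ m := by rw [energyConst]; positivity
  set y := volume.real (superlevel D τ v x₀ ρ k) with hy
  have hy0 : 0 ≤ y := measureReal_nonneg
  have hX : 0 ≤ energyConst p Λ m * θ ^ (p + 1) * L ^ p * y := by positivity
  have hmain := S.mul_volume_superlevel_le_sobolev (N := θ ^ (p + 1)) (fm := 2 * θ) (Fm := θ ^ 2)
    (l := θ * L) (s := 8 / (k' - k) ^ 3 * (energyConst p Λ m * θ ^ (p + 1) * L ^ p * y))
    hn hp hΛ hF hf hf0 hk hFk (by positivity) hN hζ hρ hm hkk.le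
    (fun s hs => mul_le_mul_of_nonneg_left (hmax s hs) zero_le_two) (by positivity)
    (fun s hs => pow_le_pow_left₀ (le_max_right _ _) (hmax s hs) 2) (by positivity) (by positivity)
    (by positivity) (by
      calc _ = (k' - k) ^ 3 / 8 * (8 / (k' - k) ^ 3 *
            (energyConst p Λ m * θ ^ (p + 1) * L ^ p * y)) := by field_simp; rw [hy]
        _ ≤ _ := by gcongr) (lt_of_lt_of_le (by positivity) hJ)
  have e1 : F k' = (k' - k) ^ 2 := by simp only [hFd]; rw [max_eq_left hh.le]
  have e2 : (θ * L) ^ (1 - p) * (2 * Λ * (energyConst p Λ m * θ ^ (p + 1) * L ^ p))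
      = 2 * Λ * energyConst p Λ m * θ ^ 2 * L := by
    have h1 : θ ^ (1 - p) * θ ^ (p + 1) = θ ^ 2 := by
      rw [← Real.rpow_add hθ, ← Real.rpow_natCast]; congr 1; push_cast; ring
    have h2 : L ^ (1 - p) * L ^ p = L := by rw [← Real.rpow_add hL]; simp
    rw [Real.mul_rpow hθ.le hL.le]
    calc _ = 2 * Λ * energyConst p Λ m * (θ ^ (1 - p) * θ ^ (p + 1)) * (L ^ (1 - p) * L ^ p) := by
          ring
      _ = _ := by rw [h1, h2]
  rw [e1, e2] at hmain
  refine hmain.trans (le_of_eq ?_)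
  ring

/-- **De Giorgi lemma**: if `v` is close to its supremum only on a small set, then it is bounded
away from its supremum on a smaller ball. -/
lemma exists_deGiorgi_const (n : ℕ) (hn : 2 ≤ n) (p Λ : ℝ) (hp : 2 ≤ p) (hΛ : 1 ≤ Λ) :
    ∃ ν : ℝ, 0 < ν ∧ ∀ (D : Set (E n)) (τ : ℝ) (x₀ : E n) (r k₀ M : ℝ) (β : ℝ → ℝ)
      (v : E n × ℝ → ℝ) (G a : E n × ℝ → E n) (θ ω : ℝ),
      SolutionData p Λ D τ x₀ r k₀ M β v G a → 0 < r → 0 < τ → 0 < θ → k₀ < M - θ → θ ≤ ω →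
      τ ≤ ω ^ (2 - p) * r ^ p →
      volume.real (superlevel D τ v x₀ (r / 2) (M - θ)) ≤ ν * (r ^ n * τ) →
      ∀ z ∈ D ×ˢ Ioo 0 τ, z.1 ∈ Metric.ball x₀ (r / 4) → v z ≤ M - θ / 2 := by
  obtain ⟨C, hC0, hC⟩ := exists_isSpaceCutoff
  set m := ⌈p⌉₊ with hmd
  have hm : p ≤ m := Nat.le_ceil p
  have hΛ0 : 0 < Λ := by linarith
  set e := energyConst p Λ m with he
  have hE : 0 ≤ e := by rw [he, energyConst]; positivity
  set K₂ := 512 * 8 ^ m * e * C ^ p with hK₂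
  have hK₂0 : 0 ≤ K₂ := by positivity
  set K₃ := 2 * Λ * e + 2 + m with hK₃
  have hK₃0 : 0 ≤ K₃ := by positivity
  set K := 128 * sobolevConst n * K₃ * C * K₂ ^ (1 / (n : ℝ)) + 1 with hK
  have hK0 : 0 < K := by positivity
  -- In the slice bound the cutoff contributes at most `2 ^ (m j)` and the cubed level gap `8 ^ j`.
  -- The separate factor `8 ^ j` of the recursion is `4 ^ j` from the squared level gap and `2 ^ j`
  -- from the cutoff.
  set b : ℝ := 2 ^ (m + 3) with hb
  have hb1 : 1 ≤ b := one_le_pow₀ (by norm_num)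
  refine ⟨((8 ^ n * b)⁻¹ / K) ^ n, by positivity, ?_⟩
  intro D τ x₀ r k₀ M β v G a θ ω S hr hτ hθ hk₀ hθω hτω hsmall z hz hzr
  -- Levels rise from `M - θ` to `M - θ / 2` while radii shrink from `r / 2` to `r / 4`; the time
  -- interval is never shortened.
  set k : ℕ → ℝ := fun j => M - θ / 2 - θ / 2 ^ (j + 1) with hk
  set ρ : ℕ → ℝ := fun j => r / 4 + r / 2 ^ (j + 2) with hρ
  set A : ℕ → Set (E n × ℝ) := fun j => superlevel D τ v x₀ (ρ j) (k j) with hA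
  set Y : ℕ → ℝ := fun j => volume.real (A j) / (r ^ n * τ) with hY
  have hY0 : ∀ j, 0 ≤ Y j := fun j => by positivity
  have hvol : ∀ j, volume.real (A j) = r ^ n * τ * Y j := fun j => by
    simp only [hY]; field_simp
  have hkd : ∀ j, k (j + 1) - k j = θ / 2 ^ (j + 2) := fun j => by
    simp only [hk]; field_simp; ring
  have hρd : ∀ j, ρ j - ρ (j + 1) = r / 2 ^ (j + 3) := fun j => by
    simp only [hρ]; field_simp; ring
  have hkθ : ∀ j, M - k j ≤ θ := fun j => by
    simp only [hk]
    have : θ / 2 ^ (j + 1) ≤ θ / 2 := by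
      gcongr
      exact le_self_pow₀ (by norm_num) (by omega)
    linarith
  have hρr : ∀ j, ρ j < r := fun j => by
    simp only [hρ]
    have : r / 2 ^ (j + 2) ≤ r / 2 := by
      gcongr
      exact le_self_pow₀ (by norm_num) (by omega)
    linarith
  have hω : 0 < ω := hθ.trans_le hθω
  -- Degeneracy helps here: by `p ≥ 2` and `θ ≤ ω`, the time length adapted to `ω` is admissible for
  -- `θ`. Hence the final smallness constant is free of `θ`.
  have hscale : θ ^ (p - 2) * τ ≤ r ^ p := by
    calc θ ^ (p - 2) * τ ≤ ω ^ (p - 2) * (ω ^ (2 - p) * r ^ p) := by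
          gcongr
      _ = r ^ p := by
          rw [← mul_assoc, ← Real.rpow_add hω]; simp
  have hrec : ∀ j, Y (j + 1) ≤ K * 8 ^ j * (b ^ j * Y j) ^ (1 / (n : ℝ)) * Y j := by
    intro j
    obtain ⟨ζ, hζ⟩ := hC n x₀ (ρ (j + 1)) (ρ j) (by simp only [hρ]; positivity)
      (by have := hρd j; have h2 : 0 < r / 2 ^ (j + 3) := by positivity
          linarith)
    rw [hρd] at hζ
    set L := C / (r / 2 ^ (j + 3)) with hL
    have hLe : L = C * 2 ^ (j + 3) / r := by rw [hL]; field_simp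
    have hL0 : 0 < L := by positivity
    have hstep := S.deGiorgi_step hn hp hΛ (k := k j) (k' := k (j + 1))
      (by have := hkθ j; linarith)
      (by have := hkd j; have h2 : 0 < θ / 2 ^ (j + 2) := by positivity
          linarith) hθ (hkθ j) hL0 hζ (hρr j) hm
    rw [hkd] at hstep
    change _ * volume.real (A (j + 1)) ≤ _ * (_ * (_ * volume.real (A j))) ^ _ *
      (_ * volume.real (A j)) at hstep
    rw [hvol, hvol] at hstep
    have hs : 8 / (θ / 2 ^ (j + 2)) ^ 3 * (e * θ ^ (p + 1) * L ^ p * (r ^ n * τ * Y j))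
        ≤ K₂ * (b ^ j * Y j) * r ^ n := by
      have h1 : θ ^ (p + 1) = θ ^ (p - 2) * θ ^ 3 := by
        rw [← Real.rpow_natCast, ← Real.rpow_add hθ]; congr 1; push_cast; ring
      have h2 : L ^ p ≤ C ^ p * (2 ^ (j + 3)) ^ m / r ^ p := by
        rw [hLe, Real.div_rpow (by positivity) hr.le, Real.mul_rpow hC0.le (by positivity)]
        gcongr
        rw [← Real.rpow_natCast (_ ^ _) m]
        exact Real.rpow_le_rpow_of_exponent_le (one_le_pow₀ (by norm_num)) hm
      have hY0j := hY0 j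
      have hrp : 0 < r ^ p := by positivity
      calc 8 / (θ / 2 ^ (j + 2)) ^ 3 * (e * θ ^ (p + 1) * L ^ p * (r ^ n * τ * Y j))
          ≤ 8 / (θ / 2 ^ (j + 2)) ^ 3 * (e * θ ^ (p + 1) * (C ^ p * (2 ^ (j + 3)) ^ m / r ^ p)
            * (r ^ n * τ * Y j)) := by gcongr
        _ = 8 * (2 ^ (j + 2)) ^ 3 * e * C ^ p * (2 ^ (j + 3)) ^ m *
            ((θ ^ (p - 2) * τ) / r ^ p) * (r ^ n * Y j) := by
            rw [h1]; field_simp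
        _ ≤ 8 * (2 ^ (j + 2)) ^ 3 * e * C ^ p * (2 ^ (j + 3)) ^ m * 1 * (r ^ n * Y j) := by
            gcongr
            exact (div_le_one hrp).2 hscale
        _ = K₂ * (b ^ j * Y j) * r ^ n := by
            have h3 : ((2 : ℝ) ^ (j + 2)) ^ 3 = 64 * (2 ^ 3) ^ j := by
              rw [pow_add, mul_pow, pow_right_comm]; norm_num; ring
            have h4 : ((2 : ℝ) ^ (j + 3)) ^ m = (2 ^ m) ^ j * 8 ^ m := by
              rw [pow_add, mul_pow, pow_right_comm]; norm_num
            rw [h3, h4, hK₂, hb, pow_add, mul_pow]; ring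
    have hs' : (8 / (θ / 2 ^ (j + 2)) ^ 3 * (e * θ ^ (p + 1) * L ^ p * (r ^ n * τ * Y j)))
        ^ (1 / (n : ℝ)) ≤ K₂ ^ (1 / (n : ℝ)) * (b ^ j * Y j) ^ (1 / (n : ℝ)) * r := by
      have hY0j := hY0 j
      refine (Real.rpow_le_rpow (by positivity) hs (by positivity)).trans (le_of_eq ?_)
      rw [Real.mul_rpow (by positivity) (by positivity), Real.mul_rpow hK₂0 (by positivity)]
      congr 1
      rw [one_div]; exact Real.pow_rpow_inv_natCast hr.le (by omega)
    have hY0j := hY0 j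
    set Q := (b ^ j * Y j) ^ (1 / (n : ℝ)) with hQ
    have hQ0 : 0 ≤ Q := by positivity
    have h5 : (θ / 2 ^ (j + 2)) ^ 2 * (r ^ n * τ * Y (j + 1))
        ≤ sobolevConst n * (K₂ ^ (1 / (n : ℝ)) * Q * r) * (K₃ * θ ^ 2 * L * (r ^ n * τ * Y j)) :=
      hstep.trans (by gcongr)
    have h6 : (θ / 2 ^ (j + 2)) ^ 2 * (r ^ n * τ) * Y (j + 1)
        ≤ (θ / 2 ^ (j + 2)) ^ 2 * (r ^ n * τ) * ((K - 1) * 8 ^ j * Q * Y j) := by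
      calc _ = (θ / 2 ^ (j + 2)) ^ 2 * (r ^ n * τ * Y (j + 1)) := by ring
        _ ≤ _ := h5
        _ = _ := by
          have h3 : ((8 : ℝ)) ^ j = 2 ^ j * 2 ^ j * 2 ^ j := by
            rw [← mul_pow, ← mul_pow]; norm_num
          rw [hLe, hK, h3, pow_add, pow_add]
          field_simp
          ring
    refine (le_of_mul_le_mul_left h6 (by positivity)).trans ?_
    gcongr
    linarith
  have hA0 : A 0 = superlevel D τ v x₀ (r / 2) (M - θ) := by
    simp only [hA, hρ, hk]
    congr 1 <;> ring
  have hdecay := geometric_decay (by omega : n ≠ 0) hK0 (by norm_num : (1 : ℝ) ≤ 8) hb1 hY0 hrec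
    (by
      simp only [hY, hA0]
      rw [div_le_iff₀ (by positivity)]
      exact hsmall)
  by_contra! hlt
  have hq1 : (8 ^ n * b)⁻¹ < (1 : ℝ) := by
    refine inv_lt_one_of_one_lt₀ ?_
    have h1 : (1 : ℝ) < 8 ^ n := one_lt_pow₀ (by norm_num) (by omega)
    nlinarith
  have hYlim : Tendsto Y atTop (𝓝 0) := by
    refine squeeze_zero hY0 hdecay ?_
    simpa using (tendsto_pow_atTop_nhds_zero_of_lt_one (by positivity) hq1).mul_const (Y 0)
  -- By continuity this set is open, so one bad point would give it positive measure. It lies in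
  -- every `A j`, which contradicts `Y → 0`; the conclusion is thus pointwise.
  set V : Set (E n × ℝ) := (D ×ˢ Ioo 0 τ ∩ v ⁻¹' Ioi (M - θ / 2)) ∩
    {z | z.1 ∈ Metric.ball x₀ (r / 4)} with hV
  have hVo : IsOpen V := (S.cont.isOpen_inter_preimage S.isOpen_cylinder isOpen_Ioi).inter
    (Metric.isOpen_ball.preimage continuous_fst)
  have hVA : ∀ j, V ⊆ A j := fun j w hw => by
    refine ⟨hw.1.1, ?_, ?_⟩
    · refine Metric.closedBall_subset_closedBall ?_ (Metric.ball_subset_closedBall hw.2)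
      simp only [hρ]
      have : 0 < r / 2 ^ (j + 2) := by positivity
      linarith
    · have h1 : M - θ / 2 < v w := hw.1.2
      simp only [hk]
      have : 0 < θ / 2 ^ (j + 1) := by positivity
      linarith
  have hV0 : 0 < volume V := hVo.measure_pos volume ⟨z, ⟨hz, hlt⟩, hzr⟩
  have hVfin : volume V ≠ ∞ := measure_ne_top_of_subset (fun w hw => hw.1.1) S.volume_cylinder
  have hVY : ∀ j, volume.real V / (r ^ n * τ) ≤ Y j := fun j => by
    simp only [hY]
    gcongr
    · exact S.volume_superlevel_ne_top _ _
    · exact hVA j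
  have h1 := ge_of_tendsto' hYlim hVY
  have h2 : 0 < volume.real V / (r ^ n * τ) :=
    div_pos (ENNReal.toReal_pos hV0.ne' hVfin) (by positivity)
  linarith

end SolutionData

end

/-! ### The logarithmic estimate and the reduction of the supremum. -/

section

variable {n : ℕ}

/-! ### The logarithmic estimate -/

/-- The derivative of the truncated function `u (u⁻¹ - c⁻¹)²`, where `u = M + d - s`. -/
def logDensity (M d c s : ℝ) : ℝ := max ((max (M + d - s) d ^ 2)⁻¹ - (c ^ 2)⁻¹) 0

/-- The function `u (u⁻¹ - c⁻¹)²`, where `u = M + d - s`, truncated to `0` where `u ≥ c` and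
extended linearly above `M`. -/
def logTruncation (M d c s : ℝ) : ℝ := ∫ σ in (M + d - c)..s, logDensity M d c σ

section LogTruncation

variable {M d c : ℝ}

lemma continuous_logDensity (hd : 0 < d) : Continuous (logDensity M d c) := by
  have h : Continuous fun s => (max (M + d - s) d ^ 2)⁻¹ := by
    refine Continuous.inv₀ (by fun_prop) fun s => ?_
    have : 0 < max (M + d - s) d := lt_max_of_lt_right hd
    positivity
  exact (h.sub continuous_const).max continuous_const

lemma logDensity_nonneg (s : ℝ) : 0 ≤ logDensity M d c s := le_max_right _ _

lemma hasDerivAt_logTruncation (hd : 0 < d) (s : ℝ) :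
    HasDerivAt (logTruncation M d c) (logDensity M d c s) s :=
  intervalIntegral.integral_hasDerivAt_right ((continuous_logDensity hd).intervalIntegrable _ _)
    ((continuous_logDensity hd).stronglyMeasurableAtFilter _ _) (continuous_logDensity hd).continuousAt

lemma logDensity_of_le (hd : 0 < d) (hc : d < c) {s : ℝ} (hs : s ≤ M + d - c) :
    logDensity M d c s = 0 := by
  refine max_eq_right (sub_nonpos.2 ?_)
  have h : c ≤ max (M + d - s) d := le_max_of_le_left (by linarith)
  have hc0 : 0 < c := hd.trans hc
  gcongr

lemma logDensity_of_mem (hd : 0 < d) {s : ℝ} (hs : M + d - c ≤ s) (hsM : s ≤ M) :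
    logDensity M d c s = ((M + d - s) ^ 2)⁻¹ - (c ^ 2)⁻¹ := by
  rw [logDensity, max_eq_left (by linarith : d ≤ M + d - s)]
  refine max_eq_left (sub_nonneg.2 ?_)
  have h0 : 0 < M + d - s := by linarith
  gcongr
  linarith

lemma logTruncation_of_le (hd : 0 < d) (hc : d < c) {s : ℝ} (hs : s ≤ M + d - c) :
    logTruncation M d c s = 0 := by
  rw [logTruncation, intervalIntegral.integral_congr (g := fun _ => 0) fun σ hσ => ?_]
  · simp
  · rw [uIcc_of_ge hs] at hσ
    exact logDensity_of_le hd hc hσ.2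

/-- In `u = M + d - s` an antiderivative of the density is `1/u + u/c²`; subtracting its value `2/c`
at `u = c` completes the square. -/
lemma logTruncation_of_mem (hd : 0 < d) (hc : d < c) {s : ℝ} (hs : M + d - c ≤ s) (hsM : s ≤ M) :
    logTruncation M d c s = ((M + d - s)⁻¹ - c⁻¹) ^ 2 * (M + d - s) := by
  have hc0 : 0 < c := hd.trans hc
  have hderiv : ∀ σ ∈ uIcc (M + d - c) s,
      HasDerivAt (fun σ => (M + d - σ)⁻¹ + (M + d - σ) * (c ^ 2)⁻¹) (logDensity M d c σ) σ := by
    intro σ hσ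
    rw [uIcc_of_le hs] at hσ
    have h0 : 0 < M + d - σ := by linarith [hσ.2]
    rw [logDensity_of_mem hd hσ.1 (hσ.2.trans hsM)]
    have h1 : HasDerivAt (fun σ => M + d - σ) (-1) σ := by
      simpa using (hasDerivAt_id σ).const_sub (M + d)
    refine HasDerivAt.congr_deriv ((h1.fun_inv h0.ne').fun_add (h1.mul_const (c ^ 2)⁻¹)) ?_
    rw [neg_neg, one_div]
    ring
  rw [logTruncation, intervalIntegral.integral_eq_sub_of_hasDerivAt hderiv
    ((continuous_logDensity hd).intervalIntegrable _ _)]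
  have h0 : 0 < M + d - s := by linarith
  have h2 : M + d - (M + d - c) = c := by ring
  rw [h2]
  field_simp
  ring

/-- With `y = u⁻¹ - c⁻¹` the truncation is `y² u` and its density is at least `y/u`. Split `(y² u)^p
= (y u)^(p+1) u^(p-2) (y/u)^(p-1)` and use `y u ≤ 1`, `u ≤ c`. The factor `c ^ (p - 2)` is
independent of `d`, although the density blows up as `d → 0`. -/
lemma logTruncation_rpow_le {p : ℝ} (hp : 2 ≤ p) (hd : 0 < d) (hc : d < c) {s : ℝ} (hsM : s ≤ M) :
    logTruncation M d c s ^ p ≤ c ^ (p - 2) * logDensity M d c s ^ (p - 1) := by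
  have hc0 : 0 < c := hd.trans hc
  rcases le_total s (M + d - c) with hs | hs
  · rw [logTruncation_of_le hd hc hs, Real.zero_rpow (by linarith)]
    have := logDensity_nonneg (M := M) (d := d) (c := c) s
    positivity
  rw [logTruncation_of_mem hd hc hs hsM, logDensity_of_mem hd hs hsM]
  set u := M + d - s with hu
  have hu0 : 0 < u := by linarith
  have huc : u ≤ c := by linarith
  set y := u⁻¹ - c⁻¹ with hy
  have hy0 : 0 ≤ y := sub_nonneg.2 (by gcongr)
  have hyu : y ≤ u⁻¹ := by
    have : 0 < c⁻¹ := inv_pos.2 hc0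
    linarith
  have h1 : y * u⁻¹ ≤ (u ^ 2)⁻¹ - (c ^ 2)⁻¹ := by
    have h2 : (u ^ 2)⁻¹ - (c ^ 2)⁻¹ = y * (u⁻¹ + c⁻¹) := by rw [hy, ← inv_pow, ← inv_pow]; ring
    rw [h2]
    have : 0 < c⁻¹ := inv_pos.2 hc0
    exact mul_le_mul_of_nonneg_left (by linarith) hy0
  have e1 : (y ^ 2 * u) ^ p = (y * u) ^ (p + 1) * u ^ (p - 2) * (y * u⁻¹) ^ (p - 1) := by
    have e2 : u ^ p = u ^ (p + 1) * u ^ (p - 2) * u⁻¹ ^ (p - 1) := by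
      rw [Real.inv_rpow hu0.le, ← Real.rpow_neg hu0.le, ← Real.rpow_add hu0, ← Real.rpow_add hu0]
      congr 1; ring
    have e3 : (y ^ 2) ^ p = y ^ (p + 1) * y ^ (p - 1) := by
      rw [← Real.rpow_natCast, ← Real.rpow_mul hy0, ← Real.rpow_add_of_nonneg hy0
        (by linarith) (by linarith)]
      congr 1; push_cast; ring
    rw [Real.mul_rpow (by positivity) hu0.le, Real.mul_rpow hy0 hu0.le,
      Real.mul_rpow hy0 (by positivity), e2, e3]
    ring
  have h3 : (y * u) ^ (p + 1) ≤ 1 := by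
    refine Real.rpow_le_one (by positivity) ?_ (by linarith)
    calc y * u ≤ u⁻¹ * u := by gcongr
      _ = 1 := inv_mul_cancel₀ hu0.ne'
  rw [e1]
  calc (y * u) ^ (p + 1) * u ^ (p - 2) * (y * u⁻¹) ^ (p - 1)
      ≤ 1 * c ^ (p - 2) * ((u ^ 2)⁻¹ - (c ^ 2)⁻¹) ^ (p - 1) := by
        gcongr
        linarith
    _ = _ := by ring

/-- The energy of the logarithmic truncation is unbounded as `d → 0`. -/
lemma le_jumpPrimitive_logDensity (hd : 0 < d) (hc : d < c) (j : ℕ) (hj : d * 2 ^ j ≤ c) :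
    ((j : ℝ) - 1) / 8 ≤ jumpPrimitive (logDensity M d c) id (M + d - c) (M + d - c / 2 ^ j) := by
  have hc0 : 0 < c := hd.trans hc
  induction j with
  | zero =>
    refine le_trans ?_ (jumpPrimitive_nonneg logDensity_nonneg monotone_id _ _)
    norm_num
  | succ j ih =>
    have hpow : (2 : ℝ) ^ (j + 1) = 2 * 2 ^ j := by ring
    have h2j : (0 : ℝ) < 2 ^ j := by positivity
    have hj' : d * 2 ^ j ≤ c := by
      rw [hpow] at hj
      nlinarith
    rcases Nat.eq_zero_or_pos j with rfl | hj0
    · refine le_trans ?_ (jumpPrimitive_nonneg logDensity_nonneg monotone_id _ _)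
      norm_num
    -- Each halving of `u` from `c / 2 ^ j` gains at least `1/8` when `j ≥ 1`. At `j = 0` the
    -- truncation vanishes and gives nothing, whence `j - 1` in the bound.
    have h1 := mul_sub_le_jumpPrimitive_sub (hasDerivAt_logTruncation (M := M) (c := c) hd)
      (continuous_logDensity hd) logDensity_nonneg monotone_id
      (logTruncation_of_le hd hc le_rfl) (M + d - c / 2 ^ (j + 1)) (M + d - c / 2 ^ j)
    have hdj : d ≤ c / 2 ^ j := by rwa [le_div_iff₀ h2j]
    have hcj : c / 2 ^ j ≤ c := div_le_self hc0.le (one_le_pow₀ (by norm_num))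
    rw [logTruncation_of_mem hd hc (by linarith) (by linarith)] at h1
    have h3 : M + d - (M + d - c / 2 ^ j) = c / 2 ^ j := by ring
    simp only [id] at h1
    rw [h3] at h1
    have hx : (2 : ℝ) ≤ 2 ^ j := le_self_pow₀ (by norm_num) (by omega)
    have h4 : (1 : ℝ) / 8 ≤ ((c / 2 ^ j)⁻¹ - c⁻¹) ^ 2 * (c / 2 ^ j) *
        (M + d - c / 2 ^ (j + 1) - (M + d - c / 2 ^ j)) := by
      have h5 : ((c / 2 ^ j)⁻¹ - c⁻¹) ^ 2 * (c / 2 ^ j) *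
          (M + d - c / 2 ^ (j + 1) - (M + d - c / 2 ^ j))
          = (2 ^ j - 1) ^ 2 / (2 * (2 ^ j) ^ 2) := by
        rw [hpow]; field_simp; ring
      rw [h5, div_le_div_iff₀ (by norm_num) (by positivity)]
      nlinarith
    have h6 := ih hj'
    push_cast
    linarith

end LogTruncation

namespace SolutionData

/-- The energy of the truncation at the level `M - d` is at least `(s - 1)/8`, while the right side
of the measure bound does not grow with `s`: intrinsic scaling bounds `τ c^(p-2) L^p`, because `c ≤
ω` and `L` is a multiple of `1/r`. -/
lemma exists_logarithmic_const (n : ℕ) (p Λ : ℝ) (hp : 2 ≤ p) (hΛ : 1 ≤ Λ) :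
    ∃ C : ℝ, 0 < C ∧ ∀ (D : Set (E n)) (τ : ℝ) (x₀ : E n) (r M : ℝ) (β : ℝ → ℝ)
      (v : E n × ℝ → ℝ) (G a : E n × ℝ → E n) (ω : ℝ),
      SolutionData p Λ D τ x₀ r (M - ω / 8) M β v G a → D ⊆ Metric.ball x₀ r → 0 < r → 0 < τ →
      0 < ω → τ ≤ ω ^ (2 - p) * r ^ p → ∀ s : ℕ, 2 ≤ s →
      volume.real (superlevel D τ v x₀ (r / 2) (M - ω / 2 ^ (s + 4)))
        ≤ C / ((s : ℝ) - 1) * (r ^ n * τ) := by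
  obtain ⟨C, hC0, hC⟩ := exists_isSpaceCutoff
  set m := ⌈p⌉₊ with hmd
  have hm : p ≤ m := Nat.le_ceil p
  have hΛ0 : 0 < Λ := by linarith
  set e := energyConst p Λ m with he
  have hE : 0 ≤ e := by rw [he, energyConst]; positivity
  set w := volume.real (Metric.ball (0 : E n) 1) with hw
  have hw0 : 0 ≤ w := measureReal_nonneg
  refine ⟨8 * (e * (4 * C) ^ p * w) + 1, by positivity, ?_⟩
  intro D τ x₀ r M β v G a ω S hDr hr hτ hω hτω s hs
  set d := ω / 2 ^ (s + 4) with hd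
  set c := ω / 8 with hc
  have hd0 : 0 < d := by positivity
  -- With this relation `M + d - c / 2 ^ s` is exactly `M - d`. The base level `M + d - c` lies
  -- strictly above `M - ω / 8`, by `d`.
  have hdc' : d * 2 ^ (s + 1) = c := by
    rw [hd, hc, pow_add, pow_add]; field_simp; norm_num
  have hdc : d < c := by
    rw [← hdc']
    exact lt_mul_of_one_lt_right hd0 (one_lt_pow₀ (by norm_num) (by omega))
  have hc0 : 0 < c := by positivity
  obtain ⟨ζ, hζ⟩ := hC n x₀ (r / 2) (3 / 4 * r) (by positivity) (by linarith)
  set L := C / (3 / 4 * r - r / 2) with hL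
  have hLe : L = 4 * C / r := by rw [hL]; field_simp; ring
  have h2s : (1 : ℝ) < 2 ^ s := one_lt_pow₀ (by norm_num) (by omega)
  have hcs : c / 2 ^ s = 2 * d := by
    rw [← hdc', pow_succ]; field_simp
  have hJ := le_jumpPrimitive_logDensity (M := M) hd0 hdc s (by
    rw [← hdc']; gcongr <;> norm_num)
  have hk' : M + d - c / 2 ^ s = M - d := by rw [hcs]; ring
  rw [hk'] at hJ
  have h1 := S.mul_volume_superlevel_le hp hΛ hτ.le (hasDerivAt_logTruncation (M := M) (c := c) hd0)
    (continuous_logDensity hd0) logDensity_nonneg (k := M + d - c) (k' := M - d) (by linarith)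
    (fun s hs => logTruncation_of_le hd0 hdc hs) (by positivity : 0 ≤ c ^ (p - 2))
    (fun s hs => logTruncation_rpow_le hp hd0 hdc hs) hζ (by linarith) hm
    (by rw [← hk']; gcongr; exact div_le_self hc0.le h2s.le)
  set A := volume.real (superlevel D τ v x₀ (r / 2) (M - d)) with hA
  have hs1 : (1 : ℝ) ≤ s - 1 := by
    have : (2 : ℝ) ≤ s := by exact_mod_cast hs
    linarith
  have hW : volume.real (superlevel D τ v x₀ (3 / 4 * r) (M + d - c)) ≤ r ^ n * w * τ := by
    have h2 : superlevel D τ v x₀ (3 / 4 * r) (M + d - c) ⊆ Metric.ball x₀ r ×ˢ Ioo 0 τ :=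
      fun z hz => ⟨hDr hz.1.1, hz.1.2⟩
    have h3 : volume.real (Metric.ball x₀ r ×ˢ Ioo 0 τ) = r ^ n * w * τ := by
      rw [Measure.volume_eq_prod, measureReal_prod_prod, measureReal_def,
        Measure.addHaar_ball_of_pos _ _ hr, ENNReal.toReal_mul]
      simp [hτ.le, hw, measureReal_def, hr.le]
    rw [← h3]
    refine measureReal_mono h2 ?_
    rw [Measure.volume_eq_prod, Measure.prod_prod]
    exact ENNReal.mul_ne_top measure_ball_lt_top.ne (by simp)
  have hscale : τ * (c ^ (p - 2) * L ^ p) ≤ (4 * C) ^ p := by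
    have h4 : c ^ (p - 2) ≤ ω ^ (p - 2) :=
      Real.rpow_le_rpow hc0.le (by rw [hc]; linarith) (by linarith)
    have hrp : 0 < r ^ p := by positivity
    rw [hLe, Real.div_rpow (by positivity) hr.le]
    calc τ * (c ^ (p - 2) * ((4 * C) ^ p / r ^ p))
        ≤ (ω ^ (2 - p) * r ^ p) * (ω ^ (p - 2) * ((4 * C) ^ p / r ^ p)) := by gcongr
      _ = (ω ^ (2 - p) * ω ^ (p - 2)) * (4 * C) ^ p := by field_simp
      _ = (4 * C) ^ p := by rw [← Real.rpow_add hω]; simp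
  have hA0 : 0 ≤ A := measureReal_nonneg
  have hfin : ((s : ℝ) - 1) / 8 * A ≤ e * (4 * C) ^ p * w * (r ^ n * τ) := by
    calc ((s : ℝ) - 1) / 8 * A ≤ _ := mul_le_mul_of_nonneg_right hJ hA0
      _ ≤ _ := h1
      _ ≤ τ * (e * c ^ (p - 2) * L ^ p * (r ^ n * w * τ)) := by
          have := hζ.nonneg
          gcongr
      _ = τ * (c ^ (p - 2) * L ^ p) * (e * (r ^ n * w * τ)) := by ring
      _ ≤ (4 * C) ^ p * (e * (r ^ n * w * τ)) := by gcongr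
      _ = _ := by ring
  rw [div_mul_eq_mul_div, le_div_iff₀ (by linarith)]
  have hrt : 0 ≤ r ^ n * τ := by positivity
  linarith

/-- **Reduction of the supremum** for solutions that are bounded away from it initially. -/
lemma exists_reduction (n : ℕ) (hn : 2 ≤ n) (p Λ : ℝ) (hp : 2 ≤ p) (hΛ : 1 ≤ Λ) :
    ∃ κ : ℝ, 0 < κ ∧ κ < 1 ∧ ∀ (D : Set (E n)) (τ : ℝ) (x₀ : E n) (r M : ℝ) (β : ℝ → ℝ)
      (v : E n × ℝ → ℝ) (G a : E n × ℝ → E n) (ω : ℝ),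
      SolutionData p Λ D τ x₀ r (M - ω / 8) M β v G a → D ⊆ Metric.ball x₀ r → 0 < r → 0 < τ →
      0 < ω → τ ≤ ω ^ (2 - p) * r ^ p →
      ∀ z ∈ D ×ˢ Ioo 0 τ, z.1 ∈ Metric.ball x₀ (r / 4) → v z ≤ M - κ * ω := by
  obtain ⟨ν, hν0, hν⟩ := exists_deGiorgi_const n hn p Λ hp hΛ
  obtain ⟨C, hC0, hC⟩ := exists_logarithmic_const n p Λ hp hΛ
  -- The number `s` makes the logarithmic fraction at most `ν`; the iteration then gains half of `θ
  -- = ω / 2 ^ (s + 4)`, which is the final constant.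
  obtain ⟨s₀, hs₀⟩ := exists_nat_ge (C / ν + 1)
  set s := s₀ + 2 with hs
  have hpow : (16 : ℝ) ≤ 2 ^ (s + 4) := by
    rw [pow_add]; nlinarith [one_le_pow₀ (n := s) (by norm_num : (1 : ℝ) ≤ 2)]
  refine ⟨1 / 2 ^ (s + 4) / 2, by positivity, ?_, ?_⟩
  · rw [div_div, div_lt_one (by positivity)]; linarith
  intro D τ x₀ r M β v G a ω S hDr hr hτ hω hτω z hz hzr
  have hθ0 : 0 < ω / 2 ^ (s + 4) := by positivity
  have hθ16 : ω / 2 ^ (s + 4) ≤ ω / 16 := by gcongr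
  have hsmall := hC D τ x₀ r M β v G a ω S hDr hr hτ hω hτω s (by omega)
  have hCν : C / ((s : ℝ) - 1) ≤ ν := by
    have h1 : C / ν ≤ (s : ℝ) - 1 := by rw [hs]; push_cast; linarith
    have h2 : 0 < C / ν := by positivity
    rw [div_le_iff₀ (by linarith)]
    rwa [div_le_iff₀' hν0] at h1
  have := hν D τ x₀ r (M - ω / 8) M β v G a (ω / 2 ^ (s + 4)) ω S hr hτ hθ0 (by linarith)
    (by linarith) hτω (hsmall.trans (by gcongr)) z hz hzr
  refine this.trans (le_of_eq ?_)
  ring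

end SolutionData

end

/-! ### Passage from a weak solution to the data of the energy estimates. -/

section

variable {n : ℕ}

/-! ### Solutions of the regularized problem -/

/-- The substitution `σ = s - ε y` moves `s` into the monotone factor, so that monotonicity in `s`
follows from `ρ ≥ 0`. -/
lemma mollifiedHeaviside_eq {ρ : ℝ → ℝ} (b : ℝ) {ε : ℝ} (hε : 0 < ε) (s : ℝ) :
    mollifiedHeaviside ρ b ε s = ∫ y, ρ y * heaviside b (s - ε * y) := by
  set h : ℝ → ℝ := fun x => ε⁻¹ * (ρ (x / ε) * heaviside b (s - ε * (x / ε))) with hh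
  have e1 : mollifiedHeaviside ρ b ε s = ∫ σ, h (s - σ) := by
    refine integral_congr_ae (ae_of_all _ fun σ => ?_)
    simp only [hh]
    rw [mul_div_cancel₀ _ hε.ne', sub_sub_cancel, mul_assoc]
  rw [e1, integral_sub_left_eq_self h volume s, integral_const_mul,
    Measure.integral_comp_div (fun x => ρ x * heaviside b (s - ε * x)) ε, abs_of_pos hε, smul_eq_mul,
    inv_mul_cancel_left₀ hε.ne']

lemma monotone_heaviside (b : ℝ) : Monotone (heaviside b) := fun s t hst => by
  unfold heaviside
  split_ifs <;> linarith

lemma IsMollifier.integrable {ρ : ℝ → ℝ} (h : IsMollifier ρ) : Integrable ρ :=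
  h.smooth.continuous.integrable_of_hasCompactSupport
    (HasCompactSupport.of_support_subset_isCompact (isCompact_Icc (a := (-1 : ℝ)) (b := 1))
      ((subset_tsupport ρ).trans (h.support.trans Ioo_subset_Icc_self)))

lemma monotone_mollifiedHeaviside {ρ : ℝ → ℝ} (h : IsMollifier ρ) (b : ℝ) {ε : ℝ} (hε : 0 < ε) :
    Monotone (mollifiedHeaviside ρ b ε) := by
  have hi : ∀ s, Integrable fun y => ρ y * heaviside b (s - ε * y) := fun s => by
    refine h.integrable.mul_bdd (c := 1)
      ((monotone_heaviside b).measurable.comp (by fun_prop)).aestronglyMeasurable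
      (ae_of_all _ fun y => ?_)
    unfold heaviside
    split_ifs <;> simp
  intro s t hst
  rw [mollifiedHeaviside_eq b hε, mollifiedHeaviside_eq b hε]
  refine integral_mono (hi s) (hi t) fun y => ?_
  exact mul_le_mul_of_nonneg_left (monotone_heaviside b (by linarith)) (h.nonneg y)

/-- Superposition of a Carathéodory function with a strongly measurable function. -/
lemma aestronglyMeasurable_comp_caratheodory {α W X : Type*} [MeasurableSpace α] {μ : Measure α}
    [TopologicalSpace W] [NormedAddCommGroup X] {B : α → W → X}
    (hm : ∀ c, AEStronglyMeasurable (fun z => B z c) μ) (hc : ∀ᵐ z ∂μ, Continuous (B z))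
    {w : α → W} (hw : StronglyMeasurable w) : AEStronglyMeasurable (fun z => B z (w z)) μ := by
  classical
  have hsimple : ∀ φ : SimpleFunc α W, AEStronglyMeasurable (fun z => B z (φ z)) μ := by
    intro φ
    have h1 : (fun z => B z (φ z))
        = fun z => ∑ c ∈ φ.range, (φ ⁻¹' {c}).indicator (fun z => B z c) z := by
      ext1 z
      rw [Finset.sum_eq_single_of_mem (φ z) (SimpleFunc.mem_range_self φ z)]
      · rw [indicator_of_mem]; rfl
      · intro c _ hne
        refine indicator_of_notMem (fun h => hne ?_) _
        exact (mem_singleton_iff.1 h).symm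
    rw [h1]
    exact Finset.aestronglyMeasurable_fun_sum _ fun c _ =>
      (hm c).indicator (φ.measurableSet_fiber c)
  -- Simple functions reduce to finitely many frozen arguments; continuity of `B z` passes to the
  -- limit.
  refine aestronglyMeasurable_of_tendsto_ae atTop (fun j => hsimple (hw.approx j)) ?_
  filter_upwards [hc] with z hz
  exact hz.continuousAt.tendsto.comp (hw.tendsto_approx z)

/-- A bounded open set is a countable union of compact sets, on each of which the gradient is in
`L^p`. This provides the strongly measurable representative used in the energy estimates. -/
lemma IsWeakSpaceGrad.aestronglyMeasurable {p : ℝ} {U : Set (E n × ℝ)} {v : E n × ℝ → ℝ}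
    {G : E n × ℝ → E n} (h : IsWeakSpaceGrad p U v G) (hU : IsOpen U)
    (hb : Bornology.IsBounded U) : AEStronglyMeasurable G (volume.restrict U) := by
  obtain ⟨K, hK, hKU, hUK, -⟩ := hU.exists_iUnion_isClosed
  rw [← hUK, aestronglyMeasurable_iUnion_iff]
  exact fun j => (h.memLp_grad (K j) (hKU j)
    (Metric.isCompact_of_isClosed_isBounded (hK j) (hb.subset (hKU j)))).aestronglyMeasurable

lemma IsWeakSpaceGrad.congr {p : ℝ} {U : Set (E n × ℝ)} {v : E n × ℝ → ℝ}
    {G G' : E n × ℝ → E n} (h : IsWeakSpaceGrad p U v G) (hG : G =ᵐ[volume.restrict U] G') :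
    IsWeakSpaceGrad p U v G' where
  memLp := h.memLp
  memLp_grad K hKU hK := (memLp_congr_ae (ae_mono (Measure.restrict_mono hKU le_rfl) hG)).1
    (h.memLp_grad K hKU hK)
  byParts φ hφ := by
    rw [h.byParts φ hφ]
    congr 1
    refine integral_congr_ae ?_
    filter_upwards [hG] with z hz
    rw [hz]

lemma IsPField.mono {p Λ : ℝ} {U V : Set (E n × ℝ)} {A : E n × ℝ → ℝ → E n → E n}
    (h : IsPField p Λ U A) (hVU : V ⊆ U) : IsPField p Λ V A where
  measurable u ξ := (h.measurable u ξ).mono_measure (Measure.restrict_mono hVU le_rfl)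
  continuous := ae_mono (Measure.restrict_mono hVU le_rfl) h.continuous
  growth := ae_mono (Measure.restrict_mono hVU le_rfl) h.growth
  coercive := ae_mono (Measure.restrict_mono hVU le_rfl) h.coercive

/-- The superlevel sets of a continuous function with small initial and lateral boundary values
stay away from the parabolic boundary. -/
lemma exists_compact_superlevel {Ω : Set (E n)} (hΩ : IsOpen Ω) {T τ : ℝ} (hτT : τ ≤ T)
    (hτ : 0 < τ) {x₀ : E n} {r k₀ : ℝ} {g v : E n × ℝ → ℝ}
    (hv : ContinuousOn v (closure ((Metric.ball x₀ r ∩ Ω) ×ˢ Ioo 0 τ)))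
    (hvg : EqOn v g (closure ((Metric.ball x₀ r ∩ Ω) ×ˢ Ioo 0 τ) ∩ parabolicBoundary Ω T))
    (hini : ∀ x ∈ Metric.ball x₀ r ∩ Ω, v (x, 0) ≤ k₀)
    (hlat : ∀ x ∈ Metric.ball x₀ r ∩ frontier Ω, ∀ t ∈ Ioo 0 τ, g (x, t) ≤ k₀)
    {S : Set (E n)} (hS : S ⊆ Metric.ball x₀ r) (hSc : IsCompact S) {t₂ k₁ : ℝ} (ht₂ : t₂ < τ)
    (hk₁ : k₀ < k₁) :
    ∃ K₁ ⊆ (Metric.ball x₀ r ∩ Ω) ×ˢ Ioo 0 τ, IsCompact K₁ ∧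
      ∀ z ∈ (Metric.ball x₀ r ∩ Ω) ×ˢ Ioo 0 τ, z.1 ∈ S → z.2 ≤ t₂ → k₁ ≤ v z → z ∈ K₁ := by
  set D := Metric.ball x₀ r ∩ Ω with hD
  set Q := D ×ˢ Ioo 0 τ with hQ
  have hcl : closure Q = closure D ×ˢ Icc 0 τ := by
    rw [hQ, closure_prod_eq, closure_Ioo hτ.ne]
  have hQc : IsCompact (closure Q) := by
    rw [hcl]
    exact ((Metric.isBounded_ball.subset inter_subset_left).isCompact_closure).prod isCompact_Icc
  refine ⟨(closure Q ∩ v ⁻¹' Ici k₁) ∩ {z | z.1 ∈ S ∧ z.2 ≤ t₂}, ?_, ?_, ?_⟩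
  · rintro ⟨x, t⟩ ⟨⟨hz, hzk⟩, hxS, htt⟩
    have hzk' : k₁ ≤ v (x, t) := hzk
    have hz' := hz
    rw [hcl] at hz'
    have hxr : x ∈ Metric.ball x₀ r := hS hxS
    have htτ : t < τ := lt_of_le_of_lt htt ht₂
    have hxΩ : x ∈ closure Ω := closure_mono inter_subset_right hz'.1
    rcases (show 0 ≤ t from hz'.2.1).eq_or_lt with h0 | h0
    · exfalso
      -- The initial bound is given on `D` only; continuity carries it to the closure, hence to
      -- points of `∂Ω` at time zero.
      have hcont : ContinuousOn (fun y : E n => v (y, 0)) (closure D) :=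
        hv.comp (by fun_prop) fun y hy => by rw [hcl]; exact ⟨hy, left_mem_Icc.2 hτ.le⟩
      have hclosed : IsClosed (closure D ∩ (fun y : E n => v (y, 0)) ⁻¹' Iic k₀) :=
        hcont.preimage_isClosed_of_isClosed isClosed_closure isClosed_Iic
      have h1 : closure D ⊆ closure D ∩ (fun y : E n => v (y, 0)) ⁻¹' Iic k₀ :=
        closure_minimal (fun y hy => ⟨subset_closure hy, hini y hy⟩) hclosed
      have h2 : v (x, 0) ≤ k₀ := (h1 hz'.1).2
      rw [h0] at h2
      linarith
    · by_cases hx : x ∈ Ω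
      · exact ⟨⟨hxr, hx⟩, h0, htτ⟩
      · exfalso
        -- As `S` lies in the open ball, the only way to leave `D` is through `∂Ω`, where `v = g ≤
        -- k₀ < k₁`.
        have hfr : x ∈ frontier Ω := ⟨hxΩ, by rwa [hΩ.interior_eq]⟩
        have h1 : v (x, t) = g (x, t) := hvg ⟨hz, Or.inr ⟨hfr, h0, htτ.le.trans hτT⟩⟩
        have h2 := hlat x ⟨hxr, hfr⟩ t ⟨h0, htτ⟩
        linarith
  · refine (hQc.of_isClosed_subset (hv.preimage_isClosed_of_isClosed isClosed_closure isClosed_Ici)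
      inter_subset_left).inter_right ?_
    exact (hSc.isClosed.preimage continuous_fst).inter (isClosed_le continuous_snd continuous_const)
  · exact fun z hz h1 h2 h3 => ⟨⟨subset_closure hz, h3⟩, h1, h2⟩

/-- A weak solution with small initial and lateral boundary values provides `SolutionData`. -/
lemma exists_solutionData {p Λ : ℝ} {Ω : Set (E n)} (hΩ : IsOpen Ω) {T τ : ℝ} (hτT : τ ≤ T)
    (hτ : 0 < τ) {x₀ : E n} {r k₀ M : ℝ} {A : E n × ℝ → ℝ → E n → E n} {H : ℝ → ℝ}
    {g v : E n × ℝ → ℝ} (hA : IsPField p Λ (spaceTime Ω T) A) (hH : Monotone H)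
    (hv : ContinuousOn v (closure ((Metric.ball x₀ r ∩ Ω) ×ˢ Ioo 0 τ)))
    (hsol : IsWeakSolution p A H (Metric.ball x₀ r ∩ Ω) τ v)
    (hvg : EqOn v g (closure ((Metric.ball x₀ r ∩ Ω) ×ˢ Ioo 0 τ) ∩ parabolicBoundary Ω T))
    (hini : ∀ x ∈ Metric.ball x₀ r ∩ Ω, v (x, 0) ≤ k₀)
    (hlat : ∀ x ∈ Metric.ball x₀ r ∩ frontier Ω, ∀ t ∈ Ioo 0 τ, g (x, t) ≤ k₀)
    (hM : ∀ z ∈ (Metric.ball x₀ r ∩ Ω) ×ˢ Ioo 0 τ, v z ≤ M) :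
    ∃ G a, SolutionData p Λ (Metric.ball x₀ r ∩ Ω) τ x₀ r k₀ M (fun s => s + H s) v G a := by
  obtain ⟨-, G, hG, hweak⟩ := hsol
  set D := Metric.ball x₀ r ∩ Ω with hD
  have hDo : IsOpen D := Metric.isOpen_ball.inter hΩ
  have hDb : Bornology.IsBounded D := Metric.isBounded_ball.subset inter_subset_left
  have hUo : IsOpen (D ×ˢ Ioo 0 τ) := hDo.prod isOpen_Ioo
  have hUb : Bornology.IsBounded (D ×ˢ Ioo 0 τ) := hDb.prod (Metric.isBounded_Ioo 0 τ)
  have hGm := hG.aestronglyMeasurable hUo hUb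
  set G' := hGm.mk G with hG'
  have hGG' : G =ᵐ[volume.restrict (D ×ˢ Ioo 0 τ)] G' := hGm.ae_eq_mk
  have hvU : ContinuousOn v (D ×ˢ Ioo 0 τ) := hv.mono subset_closure
  have hAU : IsPField p Λ (D ×ˢ Ioo 0 τ) A :=
    hA.mono fun z hz => ⟨hz.1.2, hz.2.1, hz.2.2.le.trans hτT⟩
  have hflux : AEStronglyMeasurable (fun z => A z (v z) (G' z))
      (volume.restrict (D ×ˢ Ioo 0 τ)) := by
    have h1 := aestronglyMeasurable_comp_caratheodory (B := fun z (w : ℝ × E n) => A z w.1 w.2)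
      (fun c => hAU.measurable c.1 c.2) hAU.continuous
      ((hvU.stronglyMeasurable_indicator_of_measurableSet hUo.measurableSet).prodMk
        hGm.stronglyMeasurable_mk)
    refine h1.congr ?_
    filter_upwards [ae_restrict_mem hUo.measurableSet] with z hz
    simp only [indicator_of_mem hz]
    rfl
  obtain ⟨C, hC⟩ := (hUb.isCompact_closure).exists_bound_of_continuousOn hv
  refine ⟨G', fun z => A z (v z) (G' z), ?_⟩
  exact
    { isOpen := hDo
      finite := hDb.measure_lt_top.ne
      cont := hvU
      bdd := ⟨C, fun z hz => hC z (subset_closure hz)⟩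
      le_sup := hM
      grad := hG.congr hGG'
      grad_meas := hGm.stronglyMeasurable_mk
      flux_meas := hflux
      growth := by
        filter_upwards [hAU.growth] with z hz using hz _ _
      coercive := by
        filter_upwards [hAU.coercive] with z hz using hz _ _
      weak := fun φ hφ => by
        refine Eq.trans (integral_congr_ae ?_) (hweak φ hφ)
        filter_upwards [hGG'] with z hz
        rw [hz]
      mono := by simpa using hH
      compact_superlevel := fun S hS hSc t₂ ht₂ k₁ hk₁ =>
        exists_compact_superlevel hΩ hτT hτ hv hvg hini hlat hS hSc ht₂ hk₁ }

end

end StefanInitial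

end

/-! ### The reduction of the supremum on the initial cylinder. -/

theorem proposition3p4
    (n : ℕ) (hn : 2 ≤ n) (p Λ δ q : ℝ) (hp : 2 ≤ p) (hΛ : 1 ≤ Λ)
    (hδ : δ ∈ Set.Ioo (0 : ℝ) 1) (hq : StefanInitial.qBar n p < q) :
    ∃ ε₄ : ℝ, 0 < ε₄ ∧ ε₄ < 1 ∧
      ∀ (Ω : Set (StefanInitial.E n)) (rΩ T : ℝ)
        (A : StefanInitial.E n × ℝ → ℝ → StefanInitial.E n → StefanInitial.E n)
        (ρ : ℝ → ℝ) (b ε : ℝ) (g v : StefanInitial.E n × ℝ → ℝ)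
        (x₀ : StefanInitial.E n) (r ω : ℝ),
        StefanInitial.IsBoundedDomain Ω → 0 < rΩ → StefanInitial.OuterDensity Ω δ rΩ →
        0 < T →
        StefanInitial.IsPField p Λ (StefanInitial.spaceTime Ω T) A →
        StefanInitial.IsMollifier ρ → 0 < ε →
        UniformContinuousOn g (StefanInitial.parabolicBoundary Ω T) →
        x₀ ∈ closure Ω → 0 < r → 0 < ω →
        -- `v ∈ C(closure Q)` solves the equation in `Q`
        ContinuousOn v (closure (StefanInitial.iniCyl Ω p T x₀ r ω 1)) →
        StefanInitial.IsWeakSolution p A (StefanInitial.mollifiedHeaviside ρ b ε)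
          (Metric.ball x₀ r ∩ Ω) (StefanInitial.iniTime p T r ω) v →
        -- with Cauchy-Dirichlet datum `g`
        Set.EqOn v g (closure (StefanInitial.iniCyl Ω p T x₀ r ω 1) ∩
          StefanInitial.parabolicBoundary Ω T) →
        -- the initial values in `B_r(x₀) ∩ Ω` are at least `ω / 8` below `sup_Q v`
        sSup ((fun x => v (x, 0)) '' (Metric.ball x₀ r ∩ Ω)) ≤
          sSup (v '' StefanInitial.iniCyl Ω p T x₀ r ω 1) - ω / 8 →
        -- and so is the lateral datum, if `B_r(x₀)` meets `∂Ω` at all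
        (∀ x ∈ Metric.ball x₀ r ∩ frontier Ω,
          ∀ t ∈ Set.Ioo (0 : ℝ) (StefanInitial.iniTime p T r ω),
            g (x, t) ≤ sSup (v '' StefanInitial.iniCyl Ω p T x₀ r ω 1) - ω / 8) →
        sSup (v '' StefanInitial.iniCyl Ω p T x₀ r ω (1 / 4)) ≤
          sSup (v '' StefanInitial.iniCyl Ω p T x₀ r ω 1) - ε₄ * ω := by
  obtain ⟨κ, hκ0, hκ1, hκ⟩ := StefanInitial.SolutionData.exists_reduction n hn p Λ hp hΛ
  refine ⟨κ, hκ0, hκ1, ?_⟩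
  intro Ω rΩ T A ρ b ε g v x₀ r ω hΩ _ _ hT hA hρ hε _ hx₀ hr hω hv hsol hvg hini hlat
  have hτ : 0 < StefanInitial.iniTime p T r ω :=
    lt_min (mul_pos (Real.rpow_pos_of_pos hω _) (Real.rpow_pos_of_pos hr _)) hT
  have hτT : StefanInitial.iniTime p T r ω ≤ T := min_le_right _ _
  set τ := StefanInitial.iniTime p T r ω with hτd
  have hQ : StefanInitial.iniCyl Ω p T x₀ r ω 1 = (Metric.ball x₀ r ∩ Ω) ×ˢ Set.Ioo 0 τ := by
    rw [StefanInitial.iniCyl, one_mul]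
  rw [hQ] at hv hvg hini hlat ⊢
  have hDb : Bornology.IsBounded (Metric.ball x₀ r ∩ Ω) :=
    Metric.isBounded_ball.subset Set.inter_subset_left
  have hQc : IsCompact (closure ((Metric.ball x₀ r ∩ Ω) ×ˢ Set.Ioo 0 τ)) :=
    (hDb.prod (Metric.isBounded_Ioo 0 τ)).isCompact_closure
  have hbdd := hQc.bddAbove_image hv
  -- The initial slice lies in the compact closure of `Q`, where `v` is bounded above; so its real
  -- supremum is a genuine upper bound.
  have hini' : ∀ x ∈ Metric.ball x₀ r ∩ Ω,
      v (x, 0) ≤ sSup (v '' (Metric.ball x₀ r ∩ Ω) ×ˢ Set.Ioo 0 τ) - ω / 8 := by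
    intro x hx
    refine (le_csSup (hbdd.mono ?_) (Set.mem_image_of_mem _ hx)).trans hini
    rintro _ ⟨y, hy, rfl⟩
    refine Set.mem_image_of_mem v ?_
    rw [closure_prod_eq, closure_Ioo hτ.ne]
    exact ⟨subset_closure hy, Set.left_mem_Icc.2 hτ.le⟩
  obtain ⟨G, a, S⟩ := StefanInitial.exists_solutionData hΩ.isOpen hτT hτ hA
    (StefanInitial.monotone_mollifiedHeaviside hρ b hε) hv hsol hvg hini' hlat
    fun z hz => le_csSup (hbdd.mono (Set.image_mono subset_closure)) (Set.mem_image_of_mem v hz)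
  have hbound := hκ _ τ x₀ r _ _ v G a ω S Set.inter_subset_left hr hτ hω (min_le_left _ _)
  refine csSup_le ?_ ?_
  -- The smaller cylinder is nonempty because `x₀` lies in the closure of `Ω`; over an empty set the
  -- supremum would be the default value zero.
  · obtain ⟨x, hx, hxΩ⟩ := mem_closure_iff.1 hx₀ (Metric.ball x₀ (1 / 4 * r)) Metric.isOpen_ball
      (Metric.mem_ball_self (by positivity))
    exact ⟨_, (x, τ / 2), ⟨⟨hx, hxΩ⟩, by constructor <;> linarith⟩, rfl⟩
  · rintro _ ⟨z, hz, rfl⟩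
    have hz1 : z.1 ∈ Metric.ball x₀ (1 / 4 * r) := hz.1.1
    refine hbound z ⟨⟨Metric.ball_subset_ball (by linarith) hz1, hz.1.2⟩, hz.2⟩ ?_
    rwa [show r / 4 = 1 / 4 * r by ring]
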